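/- Let $d\ge 1$, $m=\lceil (d-1)/2\rceil$, let $\Lambda$ be an at most countable index set and $S\subseteq\mathbb R^d$. All functions are real-valued, $*$ is convolution and $F_n$ is the Fourier transform on $\mathbb R^n$. *Definitions.* A family $(u_\lambda)$ in $L^1(\mathbb R^n)\cap L^2(\mathbb R^n)$ is a convolutional frame on $\mathbb R^n$ if there are $A,B>0$ with $A\|f\|_2^2\le\sum_\lambda\|u_\lambda*f\|_2^2\le B\|f\|_2^2$ for all $f\in L^2(\mathbb R^n)$; its canonical dual is the family $(u_\lambda^+)$ in $L^2(\mathbb R^n)$ with $F_nu_\lambda^+=F_nu_\lambda/\sum_\mu|F_nu_\mu|^2$ almost everywhere. For smooth $f$ on $\mathbb R^d$ let $p$ be the smooth solution on $\mathbb R^d\times[0,\infty)$ of $p_{tt}=\Delta p$, $p(\cdot,0)=f$, $p_t(\cdot,0)=0$. For $x\in S$ put $\mathbf Wf(x,t)=p(x,|t|)$, that is, the data on $S\times(0,\infty)$ are extended evenly to $t\in\mathbb R$; $\circledast_t$ is convolution in $t\in\mathbb R$. Call $v:\mathbb R\to\mathbb R$ admissible if it is even, $s\mapsto v(\sqrt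 s)$ is in $C^m([0,\infty))$, and there are $C$ and $\alpha>2m+1$ with $|(\tfrac1{2t}\tfrac{\partial}{\partial t})^mv(t)|\le C(1+|t|)^{-\alpha}$ for all $t$ (at $t=0$ the left side is defined by its limit). For admissible $v$ and $x\in\mathbb R^d$ set $$R^\sharp v(x)=\begin{cases}\dfrac{(-1)^{(d-1)/2}}{\sqrt{\pi^{d-1}}}\Bigl(\bigl(\tfrac1{2t}\tfrac{\partial}{\partial t}\bigr)^{(d-1)/2}v\Bigr)(\|x\|), & d\text{ odd},\\[2mm] \dfrac{2(-1)^{d/2}}{\sqrt{\pi^{d}}}\displaystyle\int_{\|x\|}^\infty\frac{(\frac1{2t}\frac{\partial}{\partial t})^{d/2}v(t)}{\sqrt{t^2-\|x\|^2}}\,t\,dt, & d\text{ even}.\end{cases}$$ For $v\in L^2(\mathbb R)$ and $u\in L^2(\mathbb R^d)$ we say that $u=R^\sharp v$ in the $L^2$ sense if $(v,u)$ is a limit in $L^2(\mathbb R)\times L^2(\mathbb R^d)$ of pairs $(w,R^\sharp w)$ with $w$ admissible, $w\in L^2(\mathbb R)$ and $R^\sharp w\in L^2(\mathbb R^d)$.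 **Theorem.** Let $(v_\lambda)_{\lambda\in\Lambda}$ be a convolutional frame on $\mathbb R$ consisting of admissible functions, and let $u_\lambda=R^\sharp v_\lambda$. 1. $((u_\lambda),(v_\lambda))$ is a convolution factorization of $\mathbf W$: $(u_\lambda)$ is a convolutional frame on $\mathbb R^d$, $(v_\lambda)$ is a convolutional frame on $\mathbb R$, and for all $f\in C_c^\infty(\mathbb R^d)$ and all $\lambda$ the time convolution $v_\lambda\circledast_t\mathbf Wf$ exists and $\mathbf W(u_\lambda*f)=v_\lambda\circledast_t\mathbf Wf$. 2. The canonical duals $(v_\lambda^+)$ and $(u_\lambda^+)$ exist, there are $A',B'>0$ with $A'\|f\|_2^2\le\sum_\lambda\|u_\lambda^+*f\|_2^2\le B'\|f\|_2^2$ for all $f\in L^2(\mathbb R^d)$, and $u_\lambda^+=R^\sharp v_\lambda^+$ in the $L^2$ sense for all $\lambda$. If $v_\lambda^+$ agrees almost everywhere with an admissible function $w$, then $u_\lambda^+=R^\sharp w$ almost everywhere. 3. For all $f\in C_c^\infty(\mathbb R^d)$ the initial value problems with initial data $f$ and $f_\lambda:=u_\lambda*f$ have smooth solutions, and $$f=\sum_{\lambda\in\Lambda}u_\lambda^+*f_\lambda,\qquad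 \mathbf Wf_\lambda=v_\lambda\circledast_t\mathbf Wf,$$ where the series has terms in $L^2(\mathbb R^d)$ and converges unconditionally in $L^2(\mathbb R^d)$. Hence $f$ can be recovered from $\mathbf Wf$: if $X$ is a set of functions on $\mathbb R^d$ that contains all $f_\lambda$ and on which $\mathbf W$ is injective (with $\mathbf W$ of a function set to $0$ if the initial value problem has no smooth solution), and $g_\lambda\in X$ satisfy $\mathbf Wg_\lambda=v_\lambda\circledast_t\mathbf Wf$, then $f=\sum_\lambda u_\lambda^+*g_\lambda$ in $L^2(\mathbb R^d)$. -/

import Mathlib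

open MeasureTheory Set Filter Topology
open scoped ENNReal Convolution FourierTransform Laplacian ContDiff

noncomputable section

namespace PAT

/-- Euclidean space `ℝ^d`. -/
abbrev Space (d : ℕ) : Type := EuclideanSpace ℝ (Fin d)

section Frames

variable {V : Type*} [NormedAddCommGroup V] [InnerProductSpace ℝ V] [FiniteDimensional ℝ V]
  [MeasurableSpace V] [BorelSpace V] {Λ : Type*}

/-- Convolution `u ⊛ f` of real functions with respect to Lebesgue measure. -/
def conv (u f : V → ℝ) : V → ℝ :=
  u ⋆[ContinuousLinearMap.lsmul ℝ ℝ, volume] f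

/-- `A ‖f‖² ≤ ∑_λ ‖u_λ ⊛ f‖² ≤ B ‖f‖²` for all `f ∈ L²(V)`, with some constants `A, B > 0`.
The norms and the sum take values in `[0, ∞]`, so the upper bound contains the statements that
`u_λ ⊛ f ∈ L²(V)` and that the sum is finite. -/
def HasFrameBounds (u : Λ → V → ℝ) : Prop :=
  ∃ A B : ℝ, 0 < A ∧ 0 < B ∧ ∀ f : V → ℝ, MemLp f 2 volume →
    ENNReal.ofReal A * eLpNorm f 2 volume ^ 2 ≤ ∑' l, eLpNorm (conv (u l) f) 2 volume ^ 2 ∧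
    ∑' l, eLpNorm (conv (u l) f) 2 volume ^ 2 ≤ ENNReal.ofReal B * eLpNorm f 2 volume ^ 2

/-- Convolutional frame: a family in `L¹(V) ∩ L²(V)` with frame bounds. -/
structure IsConvFrame (u : Λ → V → ℝ) : Prop where
  memL1 : ∀ l, MemLp (u l) 1 volume
  memL2 : ∀ l, MemLp (u l) 2 volume
  bounds : HasFrameBounds u

/-- `w` is the canonical dual of the convolutional frame `u`: the `w_λ ∈ L²(V)` are given by
`F w_λ = F u_λ / ∑_μ |F u_μ|²` almost everywhere. The Fourier transform of `w_λ` is the `L²`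
(Plancherel) transform, that of `u_λ ∈ L¹(V)` is the Fourier integral. Mathlib's transform has
the kernel `exp (-2πi⟨x, ξ⟩)`; the relation is unchanged by a rescaling of `ξ`, so it is the same
for the kernel `exp (-i⟨x, ξ⟩)`. -/
def IsCanonicalDual (u w : Λ → V → ℝ) : Prop :=
  ∀ l, ∃ hw : MemLp (fun x => (w l x : ℂ)) 2 (volume : Measure V),
    ((𝓕 (hw.toLp (fun x => (w l x : ℂ))) : Lp ℂ 2 (volume : Measure V)) : V → ℂ) =ᵐ[volume]
      fun ξ => 𝓕 (fun x => (u l x : ℂ)) ξ /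
        ((∑' k, ‖𝓕 (fun x => (u k x : ℂ)) ξ‖ ^ 2 : ℝ) : ℂ)

/-- The series `∑_λ g_λ` of functions in `L²(V)` converges unconditionally in `L²(V)` to `f`. -/
def HasL2Sum (g : Λ → V → ℝ) (f : V → ℝ) : Prop :=
  (∀ l, MemLp (g l) 2 volume) ∧ MemLp f 2 volume ∧
    Tendsto (fun s : Finset Λ => eLpNorm (fun x => f x - ∑ l ∈ s, g l x) 2 volume) atTop (𝓝 0)

end Frames

section Wave

variable {d : ℕ}

/-- `p` is a smooth solution on `ℝ^d × [0, ∞)` of `p_tt = Δp`, `p(·, 0) = f`, `p_t(·, 0) = 0`.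
Only the values of `p` at times `t ≥ 0` matter. -/
structure IsPressure (f : Space d → ℝ) (p : Space d → ℝ → ℝ) : Prop where
  smooth : ContDiffOn ℝ ∞ (fun z : Space d × ℝ => p z.1 z.2) (univ ×ˢ Ici 0)
  wave : ∀ x t, 0 < t → iteratedDeriv 2 (p x) t = Δ (fun y => p y t) x
  init : ∀ x, p x 0 = f x
  init_deriv : ∀ x, derivWithin (p x) (Ici 0) 0 = 0

open Classical in
/-- The pressure with initial data `f` (zero if the initial value problem has no solution). -/
def pressure (f : Space d → ℝ) : Space d → ℝ → ℝ :=
  if h : ∃ p, IsPressure f p then h.choose else 0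

/-- The forward operator `W`: restriction of the pressure to the detection set `S`. The datum at
`x ∈ S`, a function of `t > 0`, is extended evenly to `t ∈ ℝ`, so that it can be convolved in time
with functions on `ℝ`. -/
def waveOp (S : Set (Space d)) (f : Space d → ℝ) : S → ℝ → ℝ :=
  fun x t => pressure f x |t|

/-- Convolution in the time variable. -/
def timeConv {S : Set (Space d)} (v : ℝ → ℝ) (g : S → ℝ → ℝ) : S → ℝ → ℝ :=
  fun x => conv v (g x)

/-- Convolution factorization of the wave operator with data on `S`. In the commutation relation
the time convolution is required to exist as a convergent integral. -/
structure IsConvFactorization {Λ : Type*} (S : Set (Space d)) (u : Λ → Space d → ℝ)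
    (v : Λ → ℝ → ℝ) : Prop where
  frame_space : IsConvFrame u
  frame_time : IsConvFrame v
  comm : ∀ f : Space d → ℝ, ContDiff ℝ ∞ f → HasCompactSupport f → ∀ l,
    (∀ x : S, ConvolutionExists (v l) (waveOp S f x) (ContinuousLinearMap.lsmul ℝ ℝ) volume) ∧
    waveOp S (conv (u l) f) = timeConv (v l) (waveOp S f)

end Wave

section InverseRadon

/-- `((1/(2t)) ∂/∂t)^k v (t)`. Since `(1/(2t)) ∂/∂t` is differentiation with respect to `s = t²`,
this is the `k`-th derivative of `s ↦ v(√s)` on `[0, ∞)`, taken at `s = t²` (the derivative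
is one-sided at `s = 0`); see `radialDeriv_eq_iterate` below. -/
def radialDeriv (k : ℕ) (v : ℝ → ℝ) (t : ℝ) : ℝ :=
  iteratedDerivWithin k (fun s => v (√s)) (Ici 0) (t ^ 2)

theorem radialDeriv_eq_iterate {m : ℕ} {v : ℝ → ℝ}
    (hv : ContDiffOn ℝ m (fun s => v (√s)) (Ici 0)) (k : ℕ) (hk : k ≤ m) (t : ℝ) (ht : 0 < t) :
    (fun (w : ℝ → ℝ) (t : ℝ) => 1 / (2 * t) * deriv w t)^[k] v t = radialDeriv k v t := by
  induction k generalizing t with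
  | zero => simp [radialDeriv, Real.sqrt_sq ht.le]
  | succ k ih =>
    rw [Function.iterate_succ_apply']
    have hev : (fun (w : ℝ → ℝ) (t : ℝ) => 1 / (2 * t) * deriv w t)^[k] v =ᶠ[𝓝 t]
        radialDeriv k v := by
      filter_upwards [lt_mem_nhds ht] with s hs
      exact ih (by omega) s hs
    have hmem : Ici (0 : ℝ) ∈ 𝓝 (t ^ 2) := Ici_mem_nhds (by positivity)
    have hd := (hv.differentiableOn_iteratedDerivWithin (m := k)
      (by exact_mod_cast (show k < m by omega)) (uniqueDiffOn_Ici 0)) (t ^ 2)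
      (mem_Ici.2 (sq_nonneg t))
    have h1 := (hd.differentiableAt hmem).hasDerivAt
    have hp : HasDerivAt (fun s : ℝ => s ^ 2) (2 * t) t := by simpa using hasDerivAt_pow 2 t
    have h2 : HasDerivAt (radialDeriv k v) _ t := HasDerivAt.comp t h1 hp
    rw [hev.deriv_eq, h2.deriv, radialDeriv, iteratedDerivWithin_succ,
      derivWithin_of_mem_nhds hmem]
    field_simp

/-- The operator `R^♯`, the inverse of the Radon transform on radial functions. -/
def RSharp (d : ℕ) (v : ℝ → ℝ) (x : Space d) : ℝ :=
  if Odd d then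
    (-1) ^ ((d - 1) / 2) / √(Real.pi ^ (d - 1)) * radialDeriv ((d - 1) / 2) v ‖x‖
  else
    2 * (-1) ^ (d / 2) / √(Real.pi ^ d) *
      ∫ t in Ioi ‖x‖, radialDeriv (d / 2) v t / √(t ^ 2 - ‖x‖ ^ 2) * t

/-- The class of functions to which `R^♯` is applied: even functions `v` such that `s ↦ v(√s)` is
of class `C^m` on `[0, ∞)`, where `m = ⌈(d - 1) / 2⌉` (in Lean: the rounded-down `d / 2`), and
with sufficient decay: `((1/(2t)) ∂/∂t)^m v = O((1 + |t|)^(-α))` for some `α > 2m + 1`. -/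
structure IsAdmissible (d : ℕ) (v : ℝ → ℝ) : Prop where
  even : ∀ t, v (-t) = v t
  smooth : ContDiffOn ℝ (d / 2 : ℕ) (fun s => v (√s)) (Ici 0)
  decay : ∃ C α : ℝ, 2 * ((d / 2 : ℕ) : ℝ) + 1 < α ∧
    ∀ t, |radialDeriv (d / 2) v t| ≤ C * (1 + |t|) ^ (-α)

/-- `u = R^♯ v` in the sense of the `L²` closure: `(v, u)` is a limit in `L²(ℝ) × L²(ℝ^d)` of pairs
`(w, R^♯ w)` with `w` in the class on which `R^♯` is given by its explicit formula. -/
def IsRSharpL2 (d : ℕ) (v : ℝ → ℝ) (u : Space d → ℝ) : Prop :=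
  MemLp v 2 volume ∧ MemLp u 2 volume ∧
  ∀ ε : ℝ, 0 < ε → ∃ w : ℝ → ℝ, IsAdmissible d w ∧
    MemLp w 2 volume ∧ MemLp (RSharp d w) 2 volume ∧
    eLpNorm (v - w) 2 volume ≤ ENNReal.ofReal ε ∧
    eLpNorm (u - RSharp d w) 2 volume ≤ ENNReal.ofReal ε

end InverseRadon

end PAT

end

/-!
Everything happens on the Fourier side. By the Fourier slice theorem (`IsAdmissible.fourier_RSharp`)
the Fourier transform of `R^♯ v` is the radial extension of that of the even function `v`:
`F_d (R^♯ v)(ξ) = F_1 v (‖ξ‖)`. To see this for an admissible `v`, let `n = 2 ⌊d/2⌋`. The derivative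
`(-π)^(-n/2) (d/ds)^(n/2)` of `s ↦ v(√s)`, taken at `s = ‖x‖²`, is an integrable radial function on
`ℝ^(n+1)`, whose integrals over the translates of `ℝ^n` give back `v`
(`IsAdmissible.integral_liftProfile`), so that its transform restricted to a line is that of `v`.
For odd `d` this function is `R^♯ v`; for even `d` the integrals over the translates of a line are
`R^♯ v`. Admissibility alone does not suffice: polynomials in `t²` of degree less than `⌊d/2⌋` are
admissible. Membership of `v` in some `L^p`, `p < ∞`, excludes them and makes all lower derivatives
decay.

A family with the transforms `a_λ` is a frame if and only if `∑_λ |a_λ|²` is bounded between two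
positive constants almost everywhere (`hasFrameBounds_of_symbol`, `HasFrameBounds.symbol`). Since
null sets of radii give null sets of vectors (`ae_norm_of_ae`), such bounds pass from `ℝ` to `ℝ^d`.
The canonical duals have the transforms `a_λ / ∑_μ a_μ²`, which yields their existence, their frame
bounds, and by dominated convergence the reproducing formula (`hasL2Sum_dual`). The transforms of
the two duals are again an even function and its radial extension. The relation `u⁺ = R^♯ v⁺` in the
`L²` sense then says that these can be approximated simultaneously in `L²(ℝ)` and `L²(ℝ^d)` by
transforms of admissible functions; finite combinations of Gaussians suffice
(`exists_admissible_approx`).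

For a test function `f` the solution of the wave equation is
`p(x, t) = ∫ cos(2π‖ξ‖t) F f(ξ) exp(2πi⟨x, ξ⟩) dξ` (`isPressure_waveInt`). Convolution in time with
the even function `v` multiplies `cos(2π‖ξ‖t)` by `F_1 v (‖ξ‖)`, that is, by the transform of
`R^♯ v`; this is the commutation relation (`wave_conv`). As the pressure is an arbitrary smooth
solution, uniqueness for the initial value problem is needed (`IsPressure.unique`). It is proved by
an energy estimate with a weight whose level sets are spacelike, so that no assumption on the growth
of the solution enters.
-/

noncomputable section

namespace PAT

/-! ### The Fourier transform on `L²` as a relation between functions -/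

section FourierPairs

variable {V : Type*} [NormedAddCommGroup V] [InnerProductSpace ℝ V] [FiniteDimensional ℝ V]
  [MeasurableSpace V] [BorelSpace V]

/-- `g` is almost everywhere equal to the Plancherel transform of the square integrable function
`f`. Working with this relation instead of with elements of `Lp` keeps all statements about
honest functions. -/
def IsFT (f g : V → ℂ) : Prop :=
  ∃ hf : MemLp f 2 (volume : Measure V),
    ((𝓕 (hf.toLp f) : Lp ℂ 2 (volume : Measure V)) : V → ℂ) =ᵐ[volume] g

variable {f f' g g' : V → ℂ}

theorem IsFT.memLp_left (h : IsFT f g) : MemLp f 2 (volume : Measure V) := h.1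

theorem IsFT.memLp_right (h : IsFT f g) : MemLp g 2 (volume : Measure V) := by
  obtain ⟨hf, h⟩ := h
  exact (memLp_congr_ae h).1 (Lp.memLp _)

theorem IsFT.eLpNorm_eq (h : IsFT f g) :
    eLpNorm g 2 (volume : Measure V) = eLpNorm f 2 (volume : Measure V) := by
  obtain ⟨hf, h⟩ := h
  rw [← eLpNorm_congr_ae h, ← eLpNorm_congr_ae hf.coeFn_toLp, ← Lp.enorm_def, ← Lp.enorm_def,
    ← ofReal_norm, ← ofReal_norm, Lp.norm_fourier_eq]

theorem IsFT.congr (h : IsFT f g) (hf : f =ᵐ[volume] f') (hg : g =ᵐ[volume] g') : IsFT f' g' := by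
  obtain ⟨h2, h⟩ := h
  refine ⟨(memLp_congr_ae hf).1 h2, ?_⟩
  rw [← MemLp.toLp_congr h2 ((memLp_congr_ae hf).1 h2) hf]
  exact h.trans hg

theorem IsFT.sub (h : IsFT f g) (h' : IsFT f' g') : IsFT (f - f') (g - g') := by
  obtain ⟨h2, h⟩ := h
  obtain ⟨h2', h'⟩ := h'
  refine ⟨h2.sub h2', ?_⟩
  have e : (𝓕 ((h2.sub h2').toLp (f - f')) : Lp ℂ 2 (volume : Measure V)) =
      𝓕 (h2.toLp f) - 𝓕 (h2'.toLp f') := by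
    rw [MemLp.toLp_sub h2 h2']
    exact (Lp.fourierTransformₗᵢ V ℂ).map_sub _ _
  rw [e]
  exact (Lp.coeFn_sub _ _).trans (h.sub h')

theorem IsFT.right_unique (h : IsFT f g) (h' : IsFT f g') : g =ᵐ[volume] g' := by
  obtain ⟨h2, h⟩ := h
  obtain ⟨h2', h'⟩ := h'
  exact h.symm.trans h'

theorem IsFT.left_unique (h : IsFT f g) (h' : IsFT f' g) : f =ᵐ[volume] f' := by
  have h0 := (h.sub h').eLpNorm_eq
  rw [sub_self, eLpNorm_zero, eq_comm, eLpNorm_eq_zero_iff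
    (h.memLp_left.sub h'.memLp_left).aestronglyMeasurable (by simp)] at h0
  filter_upwards [h0] with x hx
  simpa [sub_eq_zero] using hx

theorem exists_isFT (hf : MemLp f 2 (volume : Measure V)) : ∃ g, IsFT f g :=
  ⟨_, hf, Filter.EventuallyEq.rfl⟩

theorem exists_isFT_left (hg : MemLp g 2 (volume : Measure V)) : ∃ f, IsFT f g := by
  refine ⟨((𝓕⁻ (hg.toLp g) : Lp ℂ 2 (volume : Measure V)) : V → ℂ), Lp.memLp _, ?_⟩
  rw [Lp.toLp_coeFn, FourierTransform.fourier_fourierInv_eq]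
  exact hg.coeFn_toLp

theorem integral_fourier_smul_schwartz (hf : Integrable f) (φ : SchwartzMap V ℂ) :
    ∫ x, φ x • 𝓕 f x = ∫ x, (𝓕 φ) x • f x := by
  have := VectorFourier.integral_fourierIntegral_smul_eq_flip (e := Real.fourierChar)
    (L := innerₗ V) Real.continuous_fourierChar continuous_inner φ.integrable
    hf (μ := volume) (ν := volume)
  rw [flip_innerₗ] at this
  exact this.symm

theorem integral_fourierInv_smul_schwartz (hf : Integrable f) (φ : SchwartzMap V ℂ) :
    ∫ x, φ x • 𝓕⁻ f x = ∫ x, (𝓕⁻ φ) x • f x := by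
  have hc : Continuous fun p : V × V => (-innerₗ V) p.1 p.2 := by
    have : (fun p : V × V => (-innerₗ V) p.1 p.2) = fun p => -inner ℝ p.1 p.2 := by
      ext p; simp
    rw [this]; fun_prop
  have := VectorFourier.integral_fourierIntegral_smul_eq_flip (e := Real.fourierChar)
    (L := -innerₗ V) Real.continuous_fourierChar hc φ.integrable
    hf (μ := volume) (ν := volume)
  have h2 : (-innerₗ V).flip = -innerₗ V := by
    ext x y; simp [real_inner_comm]
  rw [h2] at this
  simp only [VectorFourier.fourierIntegral, LinearMap.neg_apply, innerₗ_apply_apply,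
    neg_neg] at this
  simp only [SchwartzMap.fourierInv_coe, Real.fourierInv_eq]
  exact this.symm

/-- On `L¹ ∩ L²` the Plancherel transform is the Fourier integral: both are the Fourier transform
of the same tempered distribution. -/
theorem isFT_fourier (h1 : Integrable f) (h2 : MemLp f 2 (volume : Measure V)) :
    IsFT f (𝓕 f) := by
  refine ⟨h2, ?_⟩
  have hcont : Continuous (𝓕 f) :=
    VectorFourier.fourierIntegral_continuous Real.continuous_fourierChar continuous_inner h1
  refine ae_eq_of_integral_contDiff_smul_eq
    ((Lp.memLp _).locallyIntegrable (by norm_num)) hcont.locallyIntegrable fun φ hφ hφc => ?_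
  let ψ : SchwartzMap V ℂ := (hφc.comp_left (g := Complex.ofReal) rfl).toSchwartzMap
    (Complex.ofRealCLM.contDiff.comp hφ)
  have hψ : ∀ x, ψ x = (φ x : ℂ) := fun _ => rfl
  have key := congrArg (fun T => T ψ) (Lp.fourier_toTemperedDistribution_eq (h2.toLp f))
  simp only [TemperedDistribution.fourier_apply, Lp.toTemperedDistribution_apply] at key
  have e1 : ∫ x, φ x • ((𝓕 (h2.toLp f) : Lp ℂ 2 (volume : Measure V)) : V → ℂ) x =
      ∫ x, ψ x • ((𝓕 (h2.toLp f) : Lp ℂ 2 (volume : Measure V)) : V → ℂ) x := by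
    simp [hψ]
  have e2 : ∫ x, φ x • 𝓕 f x = ∫ x, ψ x • 𝓕 f x := by simp [hψ]
  rw [e1, e2, ← key, integral_fourier_smul_schwartz h1]
  refine integral_congr_ae ?_
  filter_upwards [h2.coeFn_toLp] with x hx
  rw [hx]

/-- The Fourier inversion of an `L¹ ∩ L²` function by the integral agrees with that in `L²`; the
transform `g` itself need not be continuous. -/
theorem isFT_fourierInv (h1 : Integrable g) (h2 : MemLp g 2 (volume : Measure V)) :
    IsFT (𝓕⁻ g) g := by
  have hcont : Continuous (𝓕⁻ g) := by
    rw [Real.fourierInv_eq_fourier_comp_neg]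
    exact VectorFourier.fourierIntegral_continuous Real.continuous_fourierChar continuous_inner
      h1.comp_neg
  have hae : ((𝓕⁻ (h2.toLp g) : Lp ℂ 2 (volume : Measure V)) : V → ℂ) =ᵐ[volume] 𝓕⁻ g := by
    refine ae_eq_of_integral_contDiff_smul_eq
      ((Lp.memLp _).locallyIntegrable (by norm_num)) hcont.locallyIntegrable fun φ hφ hφc => ?_
    let ψ : SchwartzMap V ℂ := (hφc.comp_left (g := Complex.ofReal) rfl).toSchwartzMap
      (Complex.ofRealCLM.contDiff.comp hφ)
    have hψ : ∀ x, ψ x = (φ x : ℂ) := fun _ => rfl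
    have key := congrArg (fun T => T ψ) (Lp.fourierInv_toTemperedDistribution_eq (h2.toLp g))
    simp only [TemperedDistribution.fourierInv_apply, Lp.toTemperedDistribution_apply] at key
    have e1 : ∫ x, φ x • ((𝓕⁻ (h2.toLp g) : Lp ℂ 2 (volume : Measure V)) : V → ℂ) x =
        ∫ x, ψ x • ((𝓕⁻ (h2.toLp g) : Lp ℂ 2 (volume : Measure V)) : V → ℂ) x := by
      simp [hψ]
    have e2 : ∫ x, φ x • 𝓕⁻ g x = ∫ x, ψ x • 𝓕⁻ g x := by simp [hψ]
    rw [e1, e2, ← key, integral_fourierInv_smul_schwartz h1]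
    refine integral_congr_ae ?_
    filter_upwards [h2.coeFn_toLp] with x hx
    rw [hx]
  have h : IsFT ((𝓕⁻ (h2.toLp g) : Lp ℂ 2 (volume : Measure V)) : V → ℂ) g := by
    refine ⟨Lp.memLp _, ?_⟩
    rw [Lp.toLp_coeFn, FourierTransform.fourier_fourierInv_eq]
    exact h2.coeFn_toLp
  exact h.congr hae Filter.EventuallyEq.rfl

/-- A pair that can be approximated by transform pairs is a transform pair. -/
theorem IsFT.of_approx (hf : MemLp f 2 (volume : Measure V))
    (hg : AEStronglyMeasurable g (volume : Measure V))
    (H : ∀ ε : ℝ≥0∞, ε ≠ 0 → ∃ f' g', IsFT f' g' ∧ eLpNorm (f - f') 2 (volume : Measure V) ≤ ε ∧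
      eLpNorm (g - g') 2 (volume : Measure V) ≤ ε) : IsFT f g := by
  obtain ⟨k, hk⟩ := exists_isFT hf
  refine hk.congr Filter.EventuallyEq.rfl ?_
  have h0 : eLpNorm (k - g) 2 (volume : Measure V) = 0 := by
    refine le_antisymm (ENNReal.le_of_forall_pos_le_add fun ε hε _ => ?_) zero_le
    have hε2 : (ε : ℝ≥0∞) / 2 ≠ 0 := by simp [hε.ne']
    obtain ⟨f', g', h', h1, h2⟩ := H ((ε : ℝ≥0∞) / 2) hε2
    have e : k - g = (k - g') - (g - g') := by abel
    rw [e, zero_add]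
    refine (eLpNorm_sub_le (hk.memLp_right.sub h'.memLp_right).aestronglyMeasurable
      (hg.sub h'.memLp_right.aestronglyMeasurable) (by norm_num)).trans ?_
    rw [(hk.sub h').eLpNorm_eq]
    exact (add_le_add h1 h2).trans (ENNReal.add_halves _).le
  rw [eLpNorm_eq_zero_iff (hk.memLp_right.aestronglyMeasurable.sub hg) (by simp)] at h0
  filter_upwards [h0] with x hx
  simpa [sub_eq_zero] using hx

/-- A rule for the Fourier integral of integrable functions that is given by operations which
preserve `L²` distances holds for the Plancherel transform. -/
theorem IsFT.transfer {T U : (V → ℂ) → V → ℂ}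
    (hTm : ∀ f, MemLp f 2 (volume : Measure V) → MemLp (T f) 2 (volume : Measure V))
    (hUm : ∀ f, MemLp f 2 (volume : Measure V) → MemLp (U f) 2 (volume : Measure V))
    (hT : ∀ f f', MemLp f 2 (volume : Measure V) → MemLp f' 2 (volume : Measure V) →
      eLpNorm (T f - T f') 2 (volume : Measure V) = eLpNorm (f - f') 2 (volume : Measure V))
    (hU : ∀ f f', MemLp f 2 (volume : Measure V) → MemLp f' 2 (volume : Measure V) →
      eLpNorm (U f - U f') 2 (volume : Measure V) = eLpNorm (f - f') 2 (volume : Measure V))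
    (hTi : ∀ f, Integrable f → Integrable (T f)) (hTU : ∀ f, 𝓕 (T f) = U (𝓕 f))
    (h : IsFT f g) : IsFT (T f) (U g) := by
  refine IsFT.of_approx (hTm _ h.memLp_left) (hUm _ h.memLp_right).aestronglyMeasurable
    fun ε hε => ?_
  obtain ⟨f', hc, hle, hcont, hf'⟩ := h.memLp_left.exists_hasCompactSupport_eLpNorm_sub_le
    (by norm_num) hε
  have hi : Integrable f' := hcont.integrable_of_hasCompactSupport hc
  have h' := isFT_fourier hi hf'
  refine ⟨T f', U (𝓕 f'), ?_, ?_, ?_⟩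
  · rw [← hTU]
    exact isFT_fourier (hTi _ hi) (hTm _ hf')
  · rwa [hT _ _ h.memLp_left hf']
  · rwa [hU _ _ h.memLp_right h'.memLp_right, (h.sub h').eLpNorm_eq]

end FourierPairs

/-! ### Convolution and frame bounds in terms of Fourier transforms -/

section FourierConvolution

variable {V : Type*} [NormedAddCommGroup V] [InnerProductSpace ℝ V] [FiniteDimensional ℝ V]
  [MeasurableSpace V] [BorelSpace V]

theorem eLpNorm_two_sq {α E : Type*} [MeasurableSpace α] [NormedAddCommGroup E] (μ : Measure α)
    (f : α → E) : eLpNorm f 2 μ ^ 2 = ∫⁻ x, ‖f x‖ₑ ^ 2 ∂μ := by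
  have h := eLpNorm_nnreal_pow_eq_lintegral (μ := μ) (f := f) (p := 2) (by norm_num)
  have e : ((2 : NNReal) : ℝ≥0∞) = 2 := by norm_num
  rw [e] at h
  have e2 : ((2 : NNReal) : ℝ) = ((2 : ℕ) : ℝ) := by norm_num
  simpa only [e2, ENNReal.rpow_natCast] using h

theorem eLpNorm_ofReal {α : Type*} [MeasurableSpace α] {μ : Measure α} (p : ℝ≥0∞) (f : α → ℝ) :
    eLpNorm (fun x => (f x : ℂ)) p μ = eLpNorm f p μ :=
  eLpNorm_congr_norm_ae (.of_forall fun x => by simp)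

theorem memLp_ofReal_iff {α : Type*} [MeasurableSpace α] {μ : Measure α} {p : ℝ≥0∞} {f : α → ℝ} :
    MemLp (fun x => (f x : ℂ)) p μ ↔ MemLp f p μ :=
  ⟨fun h => by simpa using h.re, fun h => h.ofReal⟩

theorem IsFT.comp_sub_left {f g : V → ℂ} (h : IsFT f g) (x : V) :
    IsFT (fun y => f (x - y)) (fun ξ => (Real.fourierChar (-inner ℝ x ξ) : ℂ) * g (-ξ)) := by
  have mp : MeasurePreserving (fun y : V => x - y) volume volume :=
    Measure.measurePreserving_sub_left volume x
  have mn : MeasurePreserving (fun y : V => -y) volume volume :=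
    Measure.measurePreserving_neg volume
  have hc : Continuous fun ξ : V => (Real.fourierChar (-inner ℝ x ξ) : ℂ) := by
    have := Real.continuous_fourierChar
    fun_prop
  have hUm : ∀ f : V → ℂ, MemLp f 2 (volume : Measure V) →
      MemLp (fun ξ => (Real.fourierChar (-inner ℝ x ξ) : ℂ) * f (-ξ)) 2
        (volume : Measure V) := fun f hf => by
    have := hf.comp_measurePreserving mn
    refine this.of_le (hc.aestronglyMeasurable.mul this.aestronglyMeasurable)
      (.of_forall fun ξ => ?_)
    simp [Circle.norm_coe]
  refine IsFT.transfer (T := fun f y => f (x - y))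
    (U := fun g ξ => (Real.fourierChar (-inner ℝ x ξ) : ℂ) * g (-ξ))
    (fun f hf => hf.comp_measurePreserving mp) hUm ?_ ?_ (fun f hf => hf.comp_sub_left x) ?_ h
  · intro f f' hf hf'
    exact eLpNorm_comp_measurePreserving (hf.sub hf').aestronglyMeasurable mp
  · intro f f' hf hf'
    rw [← eLpNorm_comp_measurePreserving (hf.sub hf').aestronglyMeasurable mn]
    refine eLpNorm_congr_norm_ae (.of_forall fun ξ => ?_)
    simp [← mul_sub, Circle.norm_coe]
  · intro f
    ext ξ
    simp only [Real.fourier_eq]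
    rw [← integral_sub_left_eq_self _ _ x, ← integral_const_mul]
    refine integral_congr_ae (.of_forall fun y => ?_)
    simp only [sub_sub_cancel, inner_sub_left, neg_sub, inner_neg_right, neg_neg, Circle.smul_def,
      smul_eq_mul]
    rw [sub_eq_neg_add, AddChar.map_add_eq_mul, Circle.coe_mul, mul_assoc]

theorem IsFT.conj {f g : V → ℂ} (h : IsFT f g) :
    IsFT (fun y => (starRingEnd ℂ) (f y)) (fun ξ => (starRingEnd ℂ) (g (-ξ))) := by
  have mn : MeasurePreserving (fun y : V => -y) volume volume :=
    Measure.measurePreserving_neg volume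
  refine IsFT.transfer (T := fun f y => (starRingEnd ℂ) (f y))
    (U := fun g ξ => (starRingEnd ℂ) (g (-ξ)))
    (fun f hf => hf.star) (fun f hf => (hf.comp_measurePreserving mn).star) ?_ ?_
    (fun f hf => hf.norm.mono' (Complex.continuous_conj.comp_aestronglyMeasurable hf.1)
      (.of_forall fun x => by simp)) ?_ h
  · intro f f' hf hf'
    refine eLpNorm_congr_norm_ae (.of_forall fun ξ => ?_)
    simp [← map_sub]
  · intro f f' hf hf'
    rw [← eLpNorm_comp_measurePreserving (hf.sub hf').aestronglyMeasurable mn]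
    refine eLpNorm_congr_norm_ae (.of_forall fun ξ => ?_)
    simp [← map_sub]
  · intro f
    ext ξ
    simp only [Real.fourier_eq]
    rw [← integral_conj]
    refine integral_congr_ae (.of_forall fun y => ?_)
    simp [Circle.smul_def, ← Circle.coe_inv_eq_conj, AddChar.map_neg_eq_inv]

/-- Functions whose transform is conjugate symmetric are real. -/
theorem exists_real_isFT {g : V → ℂ} (hg : MemLp g 2 (volume : Measure V))
    (hs : ∀ ξ, (starRingEnd ℂ) (g (-ξ)) = g ξ) : ∃ f : V → ℝ, IsFT (fun x => (f x : ℂ)) g := by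
  obtain ⟨f, hf⟩ := exists_isFT_left hg
  have h2 := hf.conj
  simp only [hs] at h2
  refine ⟨fun x => (f x).re, hf.congr ?_ Filter.EventuallyEq.rfl⟩
  filter_upwards [hf.left_unique h2] with x hx
  exact (Complex.conj_eq_iff_re.1 hx.symm).symm

theorem IsFT.conj_symm {f : V → ℝ} {g : V → ℂ} (h : IsFT (fun x => (f x : ℂ)) g) :
    ∀ᵐ ξ : V, (starRingEnd ℂ) (g (-ξ)) = g ξ := by
  have h2 := h.conj
  simp only [Complex.conj_ofReal] at h2
  exact h2.right_unique h

/-- Parseval's identity. -/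
theorem IsFT.integral_conj_mul {f g f' g' : V → ℂ} (h : IsFT f g) (h' : IsFT f' g') :
    ∫ x, f' x * (starRingEnd ℂ) (f x) = ∫ ξ, g' ξ * (starRingEnd ℂ) (g ξ) := by
  obtain ⟨h2, h⟩ := h
  obtain ⟨h2', h'⟩ := h'
  have key := Lp.inner_fourier_eq (h2.toLp f) (h2'.toLp f')
  simp only [L2.inner_def, RCLike.inner_apply] at key
  calc _ = _ := integral_congr_ae ?_
    _ = _ := key.symm
    _ = _ := integral_congr_ae ?_
  · filter_upwards [h2.coeFn_toLp, h2'.coeFn_toLp] with x hx hx'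
    rw [hx, hx']
  · filter_upwards [h, h'] with x hx hx'
    rw [hx, hx']

/-- The convolution of two square integrable functions is, at every point, the inverse Fourier
integral of the product of the transforms, which is integrable. -/
theorem conv_eq_fourierInv {w f : V → ℝ} {a b : V → ℂ} (hw : IsFT (fun x => (w x : ℂ)) a)
    (hf : IsFT (fun x => (f x : ℂ)) b) (x : V) :
    (conv w f x : ℂ) = 𝓕⁻ (fun ξ => a ξ * b ξ) x := by
  have h1 := (hf.comp_sub_left x).integral_conj_mul hw
  have h2 : (conv w f x : ℂ) =
      ∫ y, (w y : ℂ) * (starRingEnd ℂ) ((f (x - y) : ℝ) : ℂ) := by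
    simp only [Complex.conj_ofReal, conv, convolution_def]
    simp only [ContinuousLinearMap.lsmul_apply, smul_eq_mul]
    rw [← integral_complex_ofReal]
    simp
  rw [h2, h1, Real.fourierInv_eq]
  refine integral_congr_ae ?_
  filter_upwards [hf.conj_symm] with ξ hξ
  rw [map_mul, hξ, ← Circle.coe_inv_eq_conj, ← AddChar.map_neg_eq_inv, neg_neg, Circle.smul_def,
    smul_eq_mul, real_inner_comm]
  ring

/-- The bound on `a` ensures that the convolution is square integrable. -/
theorem IsFT.conv {w f : V → ℝ} {a b : V → ℂ} (hw : IsFT (fun x => (w x : ℂ)) a)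
    (hf : IsFT (fun x => (f x : ℂ)) b) {C : ℝ} (hC : ∀ᵐ ξ : V, ‖a ξ‖ ≤ C) :
    IsFT (fun x => (conv w f x : ℂ)) (fun ξ => a ξ * b ξ) := by
  simp_rw [conv_eq_fourierInv hw hf]
  refine isFT_fourierInv (hw.memLp_right.integrable_mul hf.memLp_right) ?_
  refine (hf.memLp_right.const_mul (C : ℂ)).of_le
    (hw.memLp_right.aestronglyMeasurable.mul hf.memLp_right.aestronglyMeasurable) ?_
  filter_upwards [hC] with ξ hξ
  rw [norm_mul, norm_mul, Complex.norm_real]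
  exact mul_le_mul_of_nonneg_right (hξ.trans (le_abs_self C)) (norm_nonneg _)

theorem tsum_eLpNorm_conv_sq {Λ : Type*} [Countable Λ] {u a : Λ → V → ℝ}
    (hu : ∀ l, IsFT (fun x => (u l x : ℂ)) (fun ξ => (a l ξ : ℂ)))
    (hC : ∀ l, ∃ C : ℝ, ∀ᵐ ξ : V, |a l ξ| ≤ C) {f : V → ℝ} {b : V → ℂ}
    (hf : IsFT (fun x => (f x : ℂ)) b) :
    ∑' l, eLpNorm (PAT.conv (u l) f) 2 (volume : Measure V) ^ 2 =
      ∫⁻ ξ, (∑' l, ‖a l ξ‖ₑ ^ 2) * ‖b ξ‖ₑ ^ 2 := by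
  have h1 : ∀ l, eLpNorm (PAT.conv (u l) f) 2 (volume : Measure V) ^ 2 =
      ∫⁻ ξ, ‖a l ξ‖ₑ ^ 2 * ‖b ξ‖ₑ ^ 2 := fun l => by
    obtain ⟨C, hC⟩ := hC l
    rw [← eLpNorm_ofReal, ← ((hu l).conv hf (C := C) (by simpa using hC)).eLpNorm_eq,
      eLpNorm_two_sq]
    refine lintegral_congr fun ξ => ?_
    rw [enorm_mul, mul_pow]
    congr 2
    simp [← ofReal_norm]
  simp_rw [h1]
  rw [← lintegral_tsum]
  · simp_rw [ENNReal.tsum_mul_right]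
  · intro l
    have : AEMeasurable (a l) := (memLp_ofReal_iff.1 (hu l).memLp_right).aemeasurable
    exact (this.enorm.pow_const 2).mul (hf.memLp_right.aemeasurable.enorm.pow_const 2)

theorem hasFrameBounds_of_symbol {Λ : Type*} [Countable Λ] {u a : Λ → V → ℝ}
    (hu : ∀ l, IsFT (fun x => (u l x : ℂ)) (fun ξ => (a l ξ : ℂ))) {A B : ℝ} (hA : 0 < A)
    (hB : 0 < B) (hl : ∀ᵐ ξ : V, ENNReal.ofReal A ≤ ∑' l, ‖a l ξ‖ₑ ^ 2)
    (hr : ∀ᵐ ξ : V, ∑' l, ‖a l ξ‖ₑ ^ 2 ≤ ENNReal.ofReal B) : HasFrameBounds u := by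
  refine ⟨A, B, hA, hB, fun f hf => ?_⟩
  obtain ⟨b, hb⟩ := exists_isFT (memLp_ofReal_iff.2 hf)
  have hC : ∀ l, ∃ C : ℝ, ∀ᵐ ξ : V, |a l ξ| ≤ C := fun l => by
    refine ⟨√B, ?_⟩
    filter_upwards [hr] with ξ hξ
    have h1 := (ENNReal.le_tsum l).trans hξ
    rw [← ofReal_norm, ← ENNReal.ofReal_pow (norm_nonneg _),
      ENNReal.ofReal_le_ofReal_iff hB.le] at h1
    exact Real.le_sqrt_of_sq_le h1
  rw [tsum_eLpNorm_conv_sq hu hC hb, ← eLpNorm_ofReal, ← hb.eLpNorm_eq, eLpNorm_two_sq,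
    ← lintegral_const_mul' _ _ (by simp), ← lintegral_const_mul' _ _ (by simp)]
  constructor
  · refine lintegral_mono_ae ?_
    filter_upwards [hl] with ξ hξ
    gcongr
  · refine lintegral_mono_ae ?_
    filter_upwards [hr] with ξ hξ
    gcongr

/-- Frame bounds are pointwise bounds for `∑_λ |F u_λ|²`. They are tested on the functions whose
transform is the indicator of a symmetric set of finite measure; symmetry makes them real. -/
theorem HasFrameBounds.symbol {Λ : Type*} [Countable Λ] {u a : Λ → V → ℝ}
    (hb : HasFrameBounds u) (hu : ∀ l, IsFT (fun x => (u l x : ℂ)) (fun ξ => (a l ξ : ℂ)))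
    (ham : ∀ l, Measurable (a l)) (hev : ∀ l ξ, a l (-ξ) = a l ξ)
    (hC : ∀ l, ∃ C : ℝ, ∀ ξ : V, |a l ξ| ≤ C) :
    ∃ A B : ℝ, 0 < A ∧ 0 < B ∧ (∀ᵐ ξ : V, ENNReal.ofReal A ≤ ∑' l, ‖a l ξ‖ₑ ^ 2) ∧
      ∀ᵐ ξ : V, ∑' l, ‖a l ξ‖ₑ ^ 2 ≤ ENNReal.ofReal B := by
  obtain ⟨A, B, hA, hB, h⟩ := hb
  set s : V → ℝ≥0∞ := fun ξ => ∑' l, ‖a l ξ‖ₑ ^ 2 with hs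
  have hsm : Measurable s := Measurable.tsum fun l => (ham l).enorm.pow_const 2
  have hsev : ∀ ξ, s (-ξ) = s ξ := fun ξ => by simp [hs, hev]
  have key : ∀ E : Set V, MeasurableSet E → (∀ ξ, -ξ ∈ E ↔ ξ ∈ E) → volume E ≠ ⊤ →
      ENNReal.ofReal A * volume E ≤ ∫⁻ ξ in E, s ξ ∧
        ∫⁻ ξ in E, s ξ ≤ ENNReal.ofReal B * volume E := by
    intro E hE hsym hfin
    obtain ⟨f, hf⟩ := exists_real_isFT (g := E.indicator fun _ => (1 : ℂ))
      (memLp_indicator_const 2 hE 1 (Or.inr hfin)) (fun ξ => by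
        by_cases hξ : ξ ∈ E
        · simp [hξ, (hsym ξ).2 hξ]
        · simp [hξ, mt (hsym ξ).1 hξ])
    have h1 := h f (memLp_ofReal_iff.1 hf.memLp_left)
    rw [tsum_eLpNorm_conv_sq hu (fun l => (hC l).imp fun C hC => .of_forall hC) hf,
      ← eLpNorm_ofReal, ← hf.eLpNorm_eq, eLpNorm_two_sq] at h1
    have e1 : ∀ ξ, ‖E.indicator (fun _ => (1 : ℂ)) ξ‖ₑ ^ 2 = E.indicator 1 ξ := fun ξ => by
      by_cases hξ : ξ ∈ E <;> simp [hξ]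
    have e2 : ∀ ξ, s ξ * E.indicator 1 ξ = E.indicator s ξ := fun ξ => by
      by_cases hξ : ξ ∈ E <;> simp [hξ]
    simp only [e1] at h1
    rw [lintegral_indicator_one hE] at h1
    change _ ≤ ∫⁻ ξ, s ξ * E.indicator 1 ξ ∧ ∫⁻ ξ, s ξ * E.indicator 1 ξ ≤ _ at h1
    simp only [e2, lintegral_indicator hE] at h1
    exact h1
  refine ⟨A, B, hA, hB, ?_, ?_⟩
  · have hnull : ∀ n : ℕ, volume ({ξ | s ξ < ENNReal.ofReal A} ∩ Metric.ball 0 n) = 0 := by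
      intro n
      have hE : MeasurableSet ({ξ | s ξ < ENNReal.ofReal A} ∩ Metric.ball 0 n) :=
        (measurableSet_lt hsm measurable_const).inter measurableSet_ball
      have hfin : volume ({ξ | s ξ < ENNReal.ofReal A} ∩ Metric.ball (0 : V) n) ≠ ⊤ :=
        ((measure_mono inter_subset_right).trans_lt measure_ball_lt_top).ne
      have h1 := (key _ hE (fun ξ => by simp [hsev]) hfin).1
      by_contra h0
      have hlt : ∀ ξ ∈ {ξ | s ξ < ENNReal.ofReal A} ∩ Metric.ball (0 : V) n,
          s ξ < ENNReal.ofReal A := fun ξ hξ => hξ.1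
      have h2 := setLIntegral_strict_mono hE h0 measurable_const
        (((setLIntegral_mono measurable_const fun ξ hξ => (hlt ξ hξ).le).trans_lt
          (by rw [setLIntegral_const]; exact ENNReal.mul_lt_top (by simp) hfin.lt_top)).ne)
        (.of_forall hlt)
      rw [setLIntegral_const] at h2
      exact absurd h1 (not_le.2 h2)
    rw [ae_iff]
    refine measure_mono_null (fun ξ hξ => ?_) (measure_iUnion_null hnull)
    obtain ⟨n, hn⟩ := exists_nat_gt ‖ξ‖
    exact mem_iUnion.2 ⟨n, not_le.1 hξ, by simpa using hn⟩
  · have hnull : ∀ n : ℕ, volume ({ξ | ENNReal.ofReal B < s ξ} ∩ Metric.ball 0 n) = 0 := by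
      intro n
      have hE : MeasurableSet ({ξ | ENNReal.ofReal B < s ξ} ∩ Metric.ball 0 n) :=
        (measurableSet_lt measurable_const hsm).inter measurableSet_ball
      have hfin : volume ({ξ | ENNReal.ofReal B < s ξ} ∩ Metric.ball (0 : V) n) ≠ ⊤ :=
        ((measure_mono inter_subset_right).trans_lt measure_ball_lt_top).ne
      have h1 := (key _ hE (fun ξ => by simp [hsev]) hfin).2
      by_contra h0
      have h2 := setLIntegral_strict_mono hE h0 hsm
        (by rw [setLIntegral_const]; exact (ENNReal.mul_lt_top (by simp) hfin.lt_top).ne)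
        (.of_forall fun ξ hξ => hξ.1)
      rw [setLIntegral_const] at h2
      exact absurd h1 (not_le.2 h2)
    rw [ae_iff]
    refine measure_mono_null (fun ξ hξ => ?_) (measure_iUnion_null hnull)
    obtain ⟨n, hn⟩ := exists_nat_gt ‖ξ‖
    exact mem_iUnion.2 ⟨n, not_le.1 hξ, by simpa using hn⟩

end FourierConvolution

/-! ### Decay of the derivatives of functions on a half-line -/

section HalfLine

theorem hasDerivAt_iteratedDerivWithin_Ici {m k : ℕ} {g : ℝ → ℝ}
    (hg : ContDiffOn ℝ m g (Ici 0)) (hk : k < m) {s : ℝ} (hs : 0 < s) :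
    HasDerivAt (iteratedDerivWithin k g (Ici 0)) (iteratedDerivWithin (k + 1) g (Ici 0) s) s := by
  have hmem : Ici (0 : ℝ) ∈ 𝓝 s := Ici_mem_nhds hs
  have hd := (hg.differentiableOn_iteratedDerivWithin (m := k)
    (by exact_mod_cast hk) (uniqueDiffOn_Ici 0)) s hs.le
  rw [iteratedDerivWithin_succ, derivWithin_of_mem_nhds hmem]
  exact (hd.differentiableAt hmem).hasDerivAt

theorem continuousOn_iteratedDerivWithin_Ici {m k : ℕ} {g : ℝ → ℝ}
    (hg : ContDiffOn ℝ m g (Ici 0)) (hk : k ≤ m) :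
    ContinuousOn (iteratedDerivWithin k g (Ici 0)) (Ici 0) :=
  hg.continuousOn_iteratedDerivWithin (by exact_mod_cast hk) (uniqueDiffOn_Ici 0)

/-- A function whose derivative is `O((1 + s)^(-β - 1))` converges with rate `(1 + s)^(-β)`. -/
theorem exists_limit_of_deriv_decay {f f' : ℝ → ℝ} {C β : ℝ} (hβ : 0 < β)
    (hf : ContinuousOn f (Ici 0)) (hd : ∀ s, 0 < s → HasDerivAt f (f' s) s)
    (hb : ∀ s, 0 < s → |f' s| ≤ C * (1 + s) ^ (-(β + 1))) :
    ∃ L, ∀ s, 0 ≤ s → |f s - L| ≤ C / β * (1 + s) ^ (-β) := by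
  have hr : ∀ s : ℝ, 0 ≤ s →
      HasDerivAt (fun s : ℝ => C / β * (1 + s) ^ (-β)) (-(C * (1 + s) ^ (-(β + 1)))) s := by
    intro s hs
    have h1 : HasDerivAt (fun s : ℝ => 1 + s) 1 s := (hasDerivAt_id s).const_add 1
    have h2 := (h1.rpow_const (p := -β) (Or.inl (by positivity))).const_mul (C / β)
    refine h2.congr_deriv ?_
    rw [show -β - 1 = -(β + 1) by ring]
    field_simp
  have hrc : ContinuousOn (fun s : ℝ => C / β * (1 + s) ^ (-β)) (Ici 0) :=
    fun s hs => (hr s hs).continuousAt.continuousWithinAt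
  have hanti : AntitoneOn (fun s => f s + C / β * (1 + s) ^ (-β)) (Ici 0) := by
    refine antitoneOn_of_deriv_nonpos (convex_Ici 0) (hf.add hrc) ?_ ?_
    · rw [interior_Ici]
      exact fun s hs => ((hd s hs).add (hr s (le_of_lt hs))).differentiableAt.differentiableWithinAt
    · rw [interior_Ici]
      intro s hs
      have e : deriv (fun s => f s + C / β * (1 + s) ^ (-β)) s = _ :=
        ((hd s hs).add (hr s (le_of_lt hs))).deriv
      rw [e]
      linarith [(abs_le.1 (hb s hs)).2]
  have hmono : MonotoneOn (fun s => f s - C / β * (1 + s) ^ (-β)) (Ici 0) := by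
    refine monotoneOn_of_deriv_nonneg (convex_Ici 0) (hf.sub hrc) ?_ ?_
    · rw [interior_Ici]
      exact fun s hs => ((hd s hs).sub (hr s (le_of_lt hs))).differentiableAt.differentiableWithinAt
    · rw [interior_Ici]
      intro s hs
      have e : deriv (fun s => f s - C / β * (1 + s) ^ (-β)) s = _ :=
        ((hd s hs).sub (hr s (le_of_lt hs))).deriv
      rw [e]
      linarith [(abs_le.1 (hb s hs)).1]
  have hC : 0 ≤ C := by
    have h1 := (abs_nonneg _).trans (hb 1 one_pos)
    have h2 : (0 : ℝ) < (1 + 1) ^ (-(β + 1)) := by positivity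
    exact nonneg_of_mul_nonneg_left h1 h2
  have hle : ∀ s, 0 ≤ s → ∀ t, 0 ≤ t →
      f t - C / β * (1 + t) ^ (-β) ≤ f s + C / β * (1 + s) ^ (-β) := by
    intro s hs t ht
    have h0 : (0 : ℝ) ≤ max s t := hs.trans (le_max_left _ _)
    have h1 := hmono (mem_Ici.2 ht) (mem_Ici.2 h0) (le_max_right s t)
    have h2 := hanti (mem_Ici.2 hs) (mem_Ici.2 h0) (le_max_left s t)
    have h3 : 0 ≤ C / β * (1 + max s t) ^ (-β) := by positivity
    simp only at h1 h2
    linarith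
  refine ⟨sSup ((fun s => f s - C / β * (1 + s) ^ (-β)) '' Ici 0), fun s hs => ?_⟩
  have hbdd : BddAbove ((fun s => f s - C / β * (1 + s) ^ (-β)) '' Ici 0) := by
    refine ⟨f 0 + C / β * (1 + 0) ^ (-β), ?_⟩
    rintro _ ⟨t, ht, rfl⟩
    exact hle 0 le_rfl t ht
  have h1 := le_csSup hbdd (mem_image_of_mem _ (mem_Ici.2 hs))
  have h2 : sSup ((fun s => f s - C / β * (1 + s) ^ (-β)) '' Ici 0) ≤
      f s + C / β * (1 + s) ^ (-β) := by
    refine csSup_le (Set.Nonempty.image _ ⟨0, self_mem_Ici⟩) ?_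
    rintro _ ⟨t, ht, rfl⟩
    exact hle s hs t ht
  rw [abs_le]
  constructor <;> linarith

/-- If some derivative is eventually above a positive constant, so is the function. -/
theorem eventually_ge_of_iteratedDerivWithin_ge {m : ℕ} {g : ℝ → ℝ}
    (hg : ContDiffOn ℝ m g (Ici 0)) (k : ℕ) (hk : k ≤ m)
    (h : ∃ c > 0, ∀ᶠ s in atTop, c ≤ iteratedDerivWithin k g (Ici 0) s) :
    ∃ c > 0, ∀ᶠ s in atTop, c ≤ g s := by
  induction k with
  | zero => simpa using h
  | succ k ih =>
    refine ih (by omega) ?_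
    obtain ⟨c, hc, h⟩ := h
    obtain ⟨s₀, hs₀⟩ := eventually_atTop.1 h
    set a := max s₀ 1
    have ha : 0 < a := by positivity
    refine ⟨1, one_pos, ?_⟩
    have hlin : ∀ s, a ≤ s → c * (s - a) ≤ iteratedDerivWithin k g (Ici 0) s -
        iteratedDerivWithin k g (Ici 0) a := by
      intro s hs
      refine Convex.mul_sub_le_image_sub_of_le_deriv (convex_Ici a)
        ((continuousOn_iteratedDerivWithin_Ici hg (by omega : k ≤ m)).mono
          (Ici_subset_Ici.2 ha.le)) ?_ ?_ a self_mem_Ici s hs hs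
      · rw [interior_Ici]
        exact fun t ht => (hasDerivAt_iteratedDerivWithin_Ici hg (by omega)
          (ha.trans ht)).differentiableAt.differentiableWithinAt
      · rw [interior_Ici]
        intro t ht
        rw [(hasDerivAt_iteratedDerivWithin_Ici hg (by omega) (ha.trans ht)).deriv]
        exact hs₀ t ((le_max_left _ _).trans (le_of_lt ht))
    have ht : Tendsto (fun s => c * (s - a) + iteratedDerivWithin k g (Ici 0) a) atTop atTop :=
      tendsto_atTop_add_const_right _ _
        ((tendsto_atTop_add_const_right _ (-a) tendsto_id).const_mul_atTop hc)
    filter_upwards [ht.eventually_ge_atTop 1, eventually_ge_atTop a] with s h1 h2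
    linarith [hlin s h2]

/-- Decay of the highest derivative is inherited by the lower ones, provided that the function
is not bounded away from zero at infinity (this excludes polynomials). -/
theorem decay_of_top_decay {m : ℕ} {g : ℝ → ℝ} (hg : ContDiffOn ℝ m g (Ici 0)) {γ C : ℝ}
    (hγ : 0 < γ)
    (hb : ∀ s, 0 ≤ s → |iteratedDerivWithin m g (Ici 0) s| ≤ C * (1 + s) ^ (-(γ + m)))
    (hne : ¬ ∃ c > 0, ∀ᶠ s in atTop, c ≤ |g s|) (j k : ℕ) (hk : k + j = m) :
    ∃ C, ∀ s, 0 ≤ s → |iteratedDerivWithin k g (Ici 0) s| ≤ C * (1 + s) ^ (-(γ + k)) := by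
  induction j generalizing k with
  | zero =>
    obtain rfl : k = m := by omega
    exact ⟨C, hb⟩
  | succ j ih =>
    obtain ⟨C', hC'⟩ := ih (k + 1) (by omega)
    have hβ : 0 < γ + k := by positivity
    obtain ⟨L, hL⟩ := exists_limit_of_deriv_decay hβ
      (continuousOn_iteratedDerivWithin_Ici hg (by omega : k ≤ m))
      (fun s hs => hasDerivAt_iteratedDerivWithin_Ici hg (by omega) hs)
      (C := C') (fun s hs => by
        have := hC' s hs.le
        push_cast at this
        rwa [add_assoc])
    have h0 : Tendsto (fun s : ℝ => C' / (γ + k) * (1 + s) ^ (-(γ + k))) atTop (𝓝 0) := by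
      have h1 := (tendsto_rpow_neg_atTop hβ).comp
        (tendsto_atTop_add_const_left atTop (1 : ℝ) tendsto_id)
      simpa using h1.const_mul (C' / (γ + k))
    have hlim : Tendsto (iteratedDerivWithin k g (Ici 0)) atTop (𝓝 L) := by
      rw [tendsto_iff_norm_sub_tendsto_zero]
      refine squeeze_zero' (.of_forall fun _ => norm_nonneg _) ?_ h0
      filter_upwards [eventually_ge_atTop 0] with s hs
      exact hL s hs
    -- a nonzero limit of a derivative would keep `|g|` away from zero
    have hL0 : L = 0 := by
      by_contra hL0
      apply hne
      rcases lt_or_gt_of_ne hL0 with hneg | hpos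
      · have h1 : ∃ c > 0, ∀ᶠ s in atTop, c ≤ iteratedDerivWithin k (-g) (Ici 0) s := by
          refine ⟨-L / 2, by linarith, ?_⟩
          filter_upwards [hlim.eventually_le_const (by linarith : L < L / 2)] with s hs
          rw [iteratedDerivWithin_neg]
          linarith
        obtain ⟨c, hc, h⟩ := eventually_ge_of_iteratedDerivWithin_ge hg.neg k (by omega) h1
        exact ⟨c, hc, h.mono fun s hs => hs.trans (neg_le_abs _)⟩
      · have h1 : ∃ c > 0, ∀ᶠ s in atTop, c ≤ iteratedDerivWithin k g (Ici 0) s := by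
          refine ⟨L / 2, by linarith, ?_⟩
          exact hlim.eventually_const_le (by linarith : L / 2 < L)
        obtain ⟨c, hc, h⟩ := eventually_ge_of_iteratedDerivWithin_ge hg k (by omega) h1
        exact ⟨c, hc, h.mono fun s hs => hs.trans (le_abs_self _)⟩
    exact ⟨C' / (γ + k), fun s hs => by simpa [hL0] using hL s hs⟩

end HalfLine

/-! ### Integrals of radial functions over even-dimensional spaces -/

section EvenIntegral

variable {m : ℕ} {g : ℝ → ℝ} {γ : ℝ}

theorem continuous_iteratedDerivWithin_add_sq (hg : ContDiffOn ℝ m g (Ici 0)) {k : ℕ} (hk : k ≤ m)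
    {s : ℝ} (hs : 0 ≤ s) :
    Continuous fun y : ℝ => iteratedDerivWithin k g (Ici 0) (s + y ^ 2) :=
  (continuousOn_iteratedDerivWithin_Ici hg hk).comp_continuous (by fun_prop)
    fun y => mem_Ici.2 (by positivity)

theorem integrable_pow_mul_iteratedDerivWithin (hg : ContDiffOn ℝ m g (Ici 0)) (hγ : 1 / 2 < γ)
    {k : ℕ} (hk : k + 1 ≤ m)
    (hb : ∃ C, ∀ s, 0 ≤ s →
      |iteratedDerivWithin (k + 1) g (Ici 0) s| ≤ C * (1 + s) ^ (-(γ + (k + 1 : ℕ))))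
    {s : ℝ} (hs : 0 ≤ s) :
    Integrable fun y : ℝ =>
      y ^ (2 * k + 1) * iteratedDerivWithin (k + 1) g (Ici 0) (s + y ^ 2) := by
  obtain ⟨C, hC⟩ := hb
  have hint := (integrable_rpow_neg_one_add_norm_sq (E := ℝ) (μ := volume) (r := 2 * γ + 1)
    (by simp; linarith)).const_mul C
  refine hint.mono' ((continuous_pow _).mul
    (continuous_iteratedDerivWithin_add_sq hg hk hs)).aestronglyMeasurable (.of_forall fun y => ?_)
  have hC0 : 0 ≤ C := by
    have h1 := (abs_nonneg _).trans (hC 0 le_rfl)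
    simpa using h1
  have h1 := hC (s + y ^ 2) (by positivity)
  have hp : (0 : ℝ) < 1 + y ^ 2 := by positivity
  have h2 : (1 + (s + y ^ 2)) ^ (-(γ + (k + 1 : ℕ))) ≤ (1 + y ^ 2) ^ (-(γ + (k + 1 : ℕ))) := by
    refine Real.rpow_le_rpow_of_nonpos hp (by linarith) ?_
    have : (0 : ℝ) ≤ (k + 1 : ℕ) := by positivity
    linarith
  have h3 : |y ^ (2 * k + 1)| ≤ (1 + y ^ 2) ^ ((k : ℝ) + 1 / 2) := by
    rw [abs_pow, ← Real.rpow_natCast, ← sq_abs y]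
    calc |y| ^ ((2 * k + 1 : ℕ) : ℝ) = (|y| ^ 2) ^ ((k : ℝ) + 1 / 2) := by
          rw [← Real.rpow_natCast |y| 2, ← Real.rpow_mul (abs_nonneg y)]
          congr 1; push_cast; ring
      _ ≤ _ := Real.rpow_le_rpow (by positivity) (by linarith) (by positivity)
  rw [Real.norm_eq_abs, abs_mul, Real.norm_eq_abs, sq_abs]
  calc |y ^ (2 * k + 1)| * |iteratedDerivWithin (k + 1) g (Ici 0) (s + y ^ 2)|
      ≤ (1 + y ^ 2) ^ ((k : ℝ) + 1 / 2) * (C * (1 + y ^ 2) ^ (-(γ + (k + 1 : ℕ)))) := by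
        refine mul_le_mul h3 (h1.trans ?_) (abs_nonneg _) (by positivity)
        exact mul_le_mul_of_nonneg_left h2 hC0
    _ = C * (1 + y ^ 2) ^ (-(2 * γ + 1) / 2) := by
        rw [mul_left_comm, ← Real.rpow_add hp]
        congr 2; push_cast; ring

theorem tendsto_pow_mul_iteratedDerivWithin (hγ : 0 < γ) {k : ℕ}
    (hb : ∃ C, ∀ s, 0 ≤ s → |iteratedDerivWithin k g (Ici 0) s| ≤ C * (1 + s) ^ (-(γ + k)))
    {s : ℝ} (hs : 0 ≤ s) :
    Tendsto (fun y : ℝ => y ^ (2 * k) * iteratedDerivWithin k g (Ici 0) (s + y ^ 2)) atTop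
      (𝓝 0) := by
  obtain ⟨C, hC⟩ := hb
  have hC0 : 0 ≤ C := by simpa using (abs_nonneg _).trans (hC 0 le_rfl)
  have h0 : Tendsto (fun y : ℝ => C * (1 + y ^ 2) ^ (-γ)) atTop (𝓝 0) := by
    have h1 := (tendsto_rpow_neg_atTop hγ).comp
      (tendsto_atTop_add_const_left atTop (1 : ℝ) (tendsto_pow_atTop (α := ℝ) two_ne_zero))
    simpa using h1.const_mul C
  refine squeeze_zero_norm (fun y => ?_) h0
  have h1 := hC (s + y ^ 2) (by positivity)
  have hp : (0 : ℝ) < 1 + y ^ 2 := by positivity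
  have h2 : (1 + (s + y ^ 2)) ^ (-(γ + k)) ≤ (1 + y ^ 2) ^ (-(γ + k)) := by
    refine Real.rpow_le_rpow_of_nonpos hp (by linarith) ?_
    have : (0 : ℝ) ≤ k := by positivity
    linarith
  have h3 : |y ^ (2 * k)| ≤ (1 + y ^ 2) ^ (k : ℝ) := by
    rw [pow_mul, abs_of_nonneg (by positivity), Real.rpow_natCast]
    exact pow_le_pow_left₀ (by positivity) (by linarith) _
  rw [Real.norm_eq_abs, abs_mul]
  calc |y ^ (2 * k)| * |iteratedDerivWithin k g (Ici 0) (s + y ^ 2)|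
      ≤ (1 + y ^ 2) ^ (k : ℝ) * (C * (1 + y ^ 2) ^ (-(γ + k))) := by
        refine mul_le_mul h3 (h1.trans ?_) (abs_nonneg _) (by positivity)
        exact mul_le_mul_of_nonneg_left h2 hC0
    _ = C * (1 + y ^ 2) ^ (-γ) := by
        rw [mul_left_comm, ← Real.rpow_add hp]
        congr 2; ring

/-- Repeated integration by parts in polar coordinates: the boundary terms vanish, except for `g s`
in the last step. -/
theorem integral_pow_mul_iteratedDerivWithin (hg : ContDiffOn ℝ m g (Ici 0)) (hγ : 1 / 2 < γ)
    (hb : ∀ k ≤ m, ∃ C, ∀ s, 0 ≤ s →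
      |iteratedDerivWithin k g (Ici 0) s| ≤ C * (1 + s) ^ (-(γ + k)))
    {s : ℝ} (hs : 0 ≤ s) (k : ℕ) (hk : k + 1 ≤ m) :
    ∫ y in Ioi (0 : ℝ), 2 / (k.factorial : ℝ) *
      (y ^ (2 * k + 1) * iteratedDerivWithin (k + 1) g (Ici 0) (s + y ^ 2)) =
      (-1) ^ (k + 1) * g s := by
  have hder : ∀ j, j < m → ∀ y ∈ Ioi (0 : ℝ), HasDerivAt
      (fun y : ℝ => iteratedDerivWithin j g (Ici 0) (s + y ^ 2))
      (iteratedDerivWithin (j + 1) g (Ici 0) (s + y ^ 2) * (2 * y)) y := by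
    intro j hj y hy
    have hy' : (0 : ℝ) < s + y ^ 2 := by
      have : 0 < y := hy
      positivity
    have hp : HasDerivAt (fun y : ℝ => s + y ^ 2) (2 * y) y := by
      simpa using (hasDerivAt_pow 2 y).const_add s
    exact (hasDerivAt_iteratedDerivWithin_Ici hg hj hy').comp y hp
  have hint : ∀ j, j + 1 ≤ m → IntegrableOn (fun y : ℝ => 2 / (j.factorial : ℝ) *
      (y ^ (2 * j + 1) * iteratedDerivWithin (j + 1) g (Ici 0) (s + y ^ 2))) (Ioi 0) := fun j hj =>
    ((integrable_pow_mul_iteratedDerivWithin hg hγ hj (hb _ hj) hs).const_mul _).integrableOn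
  induction k with
  | zero =>
    have h1 := integral_Ioi_of_hasDerivAt_of_tendsto
      (f := fun y : ℝ => iteratedDerivWithin 0 g (Ici 0) (s + y ^ 2))
      (f' := fun y => 2 / (Nat.factorial 0 : ℝ) *
        (y ^ (2 * 0 + 1) * iteratedDerivWithin (0 + 1) g (Ici 0) (s + y ^ 2))) (a := 0) (m := 0)
      (continuous_iteratedDerivWithin_add_sq hg (Nat.zero_le m) hs).continuousWithinAt
      (fun y hy => (hder 0 (by omega) y hy).congr_deriv (by simp; ring))
      (hint 0 hk) (by
        have := tendsto_pow_mul_iteratedDerivWithin (by linarith) (hb 0 (Nat.zero_le m)) hs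
        simpa using this)
    rw [h1]
    simp
  | succ k ih =>
    have ih := ih (by omega)
    have hsum := (hint k (by omega)).add (hint (k + 1) hk)
    have h1 := integral_Ioi_of_hasDerivAt_of_tendsto
      (f := fun y : ℝ => 1 / ((k + 1).factorial : ℝ) *
        (y ^ (2 * (k + 1)) * iteratedDerivWithin (k + 1) g (Ici 0) (s + y ^ 2)))
      (a := 0) (m := 0)
      (((continuous_pow _).mul
        (continuous_iteratedDerivWithin_add_sq hg (by omega) hs)).const_mul
          _).continuousWithinAt
      (fun y hy => ((((hasDerivAt_pow (2 * (k + 1)) y).mul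
        (hder (k + 1) (by omega) y hy))).const_mul _).congr_deriv (by
          simp only [Pi.add_apply, Nat.factorial_succ]
          have : (k.factorial : ℝ) ≠ 0 := by positivity
          push_cast
          field_simp
          have e : 2 * (k + 1) - 1 = 2 * k + 1 := by omega
          rw [e]
          ring))
      hsum (by
        have := (tendsto_pow_mul_iteratedDerivWithin (by linarith) (hb (k + 1) (by omega))
          hs).const_mul (1 / ((k + 1).factorial : ℝ))
        simpa using this)
    simp only [Pi.add_apply] at h1
    rw [integral_add (hint k (by omega)) (hint (k + 1) hk), ih] at h1
    have e2 : (0 : ℝ) ^ (2 * (k + 1)) = 0 := by simp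
    rw [e2] at h1
    rw [pow_succ]
    linarith

/-- Integrating `(-π)^(-m) (d/ds)^m g` over the `2m`-dimensional fibres recovers `g`. -/
theorem integral_space_even (hg : ContDiffOn ℝ m g (Ici 0)) (hγ : 1 / 2 < γ)
    (hb : ∀ k ≤ m, ∃ C, ∀ s, 0 ≤ s →
      |iteratedDerivWithin k g (Ici 0) s| ≤ C * (1 + s) ^ (-(γ + k)))
    {s : ℝ} (hs : 0 ≤ s) :
    ∫ z : Space (2 * m), (-1) ^ m / Real.pi ^ m * iteratedDerivWithin m g (Ici 0) (s + ‖z‖ ^ 2) =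
      g s := by
  rcases m with _ | k
  -- the zero-dimensional space is a point of mass one
  · have : IsEmpty (Fin (2 * 0)) := by simpa using Fin.isEmpty
    have h1 : ∀ z : Space (2 * 0), ‖z‖ = 0 := fun z => by
      rw [Subsingleton.elim z 0, norm_zero]
    have h2 : volume (univ : Set (Space (2 * 0))) = 1 := by
      rw [← (PiLp.volume_preserving_toLp (Fin (2 * 0))).measure_preimage
        MeasurableSet.univ.nullMeasurableSet]
      simp [volume_pi]
    simp [h1, Measure.real, h2]
  · have : Nontrivial (Space (2 * (k + 1))) := by
      have : Nonempty (Fin (2 * (k + 1))) := ⟨⟨0, by omega⟩⟩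
      infer_instance
    have hdim : Module.finrank ℝ (Space (2 * (k + 1))) = 2 * (k + 1) := by simp
    have hvol : (volume : Measure (Space (2 * (k + 1)))).real (Metric.ball 0 1) =
        Real.pi ^ (k + 1) / (k + 1).factorial := by
      rw [Measure.real, InnerProductSpace.volume_ball_of_dim_even hdim]
      simp only [ENNReal.ofReal_one, one_pow, one_mul]
      exact ENNReal.toReal_ofReal (by positivity)
    rw [integral_fun_norm_addHaar (volume : Measure (Space (2 * (k + 1))))
      (fun r => (-1) ^ (k + 1) / Real.pi ^ (k + 1) *
        iteratedDerivWithin (k + 1) g (Ici 0) (s + r ^ 2)), hvol, hdim]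
    have h1 := integral_pow_mul_iteratedDerivWithin hg hγ hb hs k le_rfl
    have e : ∀ y : ℝ, y ^ (2 * (k + 1) - 1) • ((-1) ^ (k + 1) / Real.pi ^ (k + 1) *
        iteratedDerivWithin (k + 1) g (Ici 0) (s + y ^ 2)) =
        ((-1) ^ (k + 1) / Real.pi ^ (k + 1) * ((k.factorial : ℝ) / 2)) *
        (2 / (k.factorial : ℝ) *
      (y ^ (2 * k + 1) * iteratedDerivWithin (k + 1) g (Ici 0) (s + y ^ 2))) := by
      intro y
      have : (k.factorial : ℝ) ≠ 0 := by positivity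
      have e : 2 * (k + 1) - 1 = 2 * k + 1 := by omega
      rw [e, smul_eq_mul]
      field_simp
    simp_rw [e]
    rw [integral_const_mul, h1]
    have h3 : (k.factorial : ℝ) ≠ 0 := by positivity
    have h4 : ((-1 : ℝ) ^ (k + 1)) * (-1) ^ (k + 1) = 1 := by
      rw [← mul_pow]; simp
    rw [nsmul_eq_mul, smul_eq_mul, Nat.factorial_succ]
    push_cast
    field_simp
    linear_combination g s * h4

end EvenIntegral

/-! ### The inverse Radon transform of radial functions in the Fourier domain -/

section Splitting

variable {n : ℕ}

/-- The splitting `ℝ^(n+1) = ℝ × ℝ^n` into the first coordinate and the others. -/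
def spaceSucc (n : ℕ) : Space (n + 1) ≃ᵐ ℝ × Space n :=
  (MeasurableEquiv.toLp 2 (Fin (n + 1) → ℝ)).symm.trans
    ((MeasurableEquiv.piFinSuccAbove (fun _ => ℝ) 0).trans
      (MeasurableEquiv.prodCongr (MeasurableEquiv.refl ℝ) (MeasurableEquiv.toLp 2 (Fin n → ℝ))))

theorem measurePreserving_spaceSucc (n : ℕ) :
    MeasurePreserving (spaceSucc n) volume volume :=
  (((MeasurePreserving.id volume).prod (PiLp.volume_preserving_toLp (Fin n))).comp
    (volume_preserving_piFinSuccAbove (fun _ : Fin (n + 1) => ℝ) 0)).comp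
      (PiLp.volume_preserving_ofLp (Fin (n + 1)))

theorem spaceSucc_symm_zero (a : ℝ) (z : Space n) : (spaceSucc n).symm (a, z) 0 = a := rfl

theorem spaceSucc_symm_succ (a : ℝ) (z : Space n) (i : Fin n) :
    (spaceSucc n).symm (a, z) i.succ = z i := rfl

theorem norm_spaceSucc_symm (a : ℝ) (z : Space n) :
    ‖(spaceSucc n).symm (a, z)‖ ^ 2 = a ^ 2 + ‖z‖ ^ 2 := by
  simp [EuclideanSpace.norm_sq_eq, Fin.sum_univ_succ, spaceSucc_symm_zero, spaceSucc_symm_succ]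

theorem inner_spaceSucc_symm (a b : ℝ) (z w : Space n) :
    inner ℝ ((spaceSucc n).symm (a, z)) ((spaceSucc n).symm (b, w)) =
      inner ℝ a b + inner ℝ z w := by
  simp [PiLp.inner_apply, Fin.sum_univ_succ, spaceSucc_symm_zero, spaceSucc_symm_succ]

theorem integrable_comp_spaceSucc_symm {F : Space (n + 1) → ℂ} (hF : Integrable F) :
    Integrable (fun p : ℝ × Space n => F ((spaceSucc n).symm p)) (volume.prod volume) :=
  ((measurePreserving_spaceSucc n).symm.integrable_comp_emb
    (spaceSucc n).symm.measurableEmbedding).2 hF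

theorem fourier_eq_integral_prod {F : Space (n + 1) → ℂ} (τ : ℝ) (ξ : Space n) :
    𝓕 F ((spaceSucc n).symm (τ, ξ)) = ∫ p : ℝ × Space n,
      Real.fourierChar (-(inner ℝ p.1 τ + inner ℝ p.2 ξ)) • F ((spaceSucc n).symm p) := by
  rw [Real.fourier_eq, ← (measurePreserving_spaceSucc n).symm.integral_comp']
  refine integral_congr_ae (.of_forall fun p => ?_)
  simp only [← inner_spaceSucc_symm]

theorem integrable_fourierChar_smul_prod {F : Space (n + 1) → ℂ} (hF : Integrable F) (τ : ℝ)
    (ξ : Space n) : Integrable (fun p : ℝ × Space n =>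
      Real.fourierChar (-(inner ℝ p.1 τ + inner ℝ p.2 ξ)) • F ((spaceSucc n).symm p))
      (volume.prod volume) := by
  have h := integrable_comp_spaceSucc_symm hF
  have hc : Continuous fun p : ℝ × Space n =>
      Real.fourierChar (-(inner ℝ p.1 τ + inner ℝ p.2 ξ)) := by
    have := Real.continuous_fourierChar
    fun_prop
  refine h.norm.mono' (hc.aestronglyMeasurable.smul h.aestronglyMeasurable) (.of_forall fun p => ?_)
  simp [Circle.norm_smul]

/-- Integration over the other coordinates restricts the Fourier transform to the first axis. -/
theorem fourier_marginal_fst {F : Space (n + 1) → ℂ} (hF : Integrable F) (τ : ℝ) :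
    𝓕 (fun a : ℝ => ∫ z, F ((spaceSucc n).symm (a, z))) τ = 𝓕 F ((spaceSucc n).symm (τ, 0)) := by
  have h := integrable_fourierChar_smul_prod hF τ 0
  rw [fourier_eq_integral_prod, Measure.volume_eq_prod, integral_prod _ h, Real.fourier_eq]
  refine integral_congr_ae (.of_forall fun a => ?_)
  simp only [inner_zero_right, add_zero, Circle.smul_def, integral_smul]

theorem fourier_marginal_snd {F : Space (n + 1) → ℂ} (hF : Integrable F) (ξ : Space n) :
    𝓕 (fun z : Space n => ∫ a, F ((spaceSucc n).symm (a, z))) ξ =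
      𝓕 F ((spaceSucc n).symm (0, ξ)) := by
  have h := integrable_fourierChar_smul_prod hF 0 ξ
  rw [fourier_eq_integral_prod, Measure.volume_eq_prod, integral_prod_symm _ h, Real.fourier_eq]
  refine integral_congr_ae (.of_forall fun a => ?_)
  simp only [inner_zero_right, zero_add, Circle.smul_def, integral_smul]

end Splitting

/-- The Fourier transform of a radial function is radial, as it is invariant under the reflection
that maps one vector to another one of the same norm. -/
theorem fourier_eq_of_radial {V : Type*} [NormedAddCommGroup V] [InnerProductSpace ℝ V]
    [FiniteDimensional ℝ V] [MeasurableSpace V] [BorelSpace V] {F : V → ℂ} {G : ℝ → ℂ}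
    (hF : ∀ x, F x = G (‖x‖ ^ 2)) {η η' : V} (h : ‖η‖ ^ 2 = ‖η'‖ ^ 2) : 𝓕 F η = 𝓕 F η' := by
  have h' : ‖η‖ = ‖η'‖ := by
    rwa [sq_eq_sq₀ (norm_nonneg _) (norm_nonneg _)] at h
  have h1 := Real.fourier_comp_linearIsometry (ℝ ∙ (η - η'))ᗮ.reflection F η
  rw [Submodule.reflection_sub h'] at h1
  have e : F ∘ (ℝ ∙ (η - η'))ᗮ.reflection = F := funext fun x => by simp [hF]
  rwa [e] at h1

section RSharp

variable {d : ℕ} {v : ℝ → ℝ}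

/-- For an admissible function in some `L^p` with `p < ∞` all derivatives with respect to `s = t²`
up to the order `m` decay, not only the highest one. -/
theorem IsAdmissible.decay_all (hv : IsAdmissible d v) {p : ℝ≥0∞} (hp0 : p ≠ 0) (hp : p ≠ ⊤)
    (hvp : MemLp v p volume) : ∃ γ : ℝ, 1 / 2 < γ ∧ ∀ k ≤ d / 2, ∃ C, ∀ s, 0 ≤ s →
      |iteratedDerivWithin k (fun s => v (√s)) (Ici 0) s| ≤ C * (1 + s) ^ (-(γ + k)) := by
  obtain ⟨C, α, hα, hC⟩ := hv.decay
  have hγ : 1 / 2 < α / 2 - (d / 2 : ℕ) := by linarith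
  have hC0 : 0 ≤ C := by simpa using (abs_nonneg _).trans (hC 0)
  refine ⟨α / 2 - (d / 2 : ℕ), hγ, fun k hk => ?_⟩
  refine decay_of_top_decay (C := C) hv.smooth (by linarith) (fun s hs => ?_) ?_ (d / 2 - k) k
    (by omega)
  · have h1 := hC √s
    rw [radialDeriv, Real.sq_sqrt hs] at h1
    refine h1.trans (mul_le_mul_of_nonneg_left ?_ hC0)
    rw [abs_of_nonneg (Real.sqrt_nonneg s), sub_add_cancel]
    have h2 : (1 + √s) ^ (-α) = ((1 + √s) ^ 2) ^ (-(α / 2)) := by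
      rw [← Real.rpow_natCast, ← Real.rpow_mul (by positivity)]
      congr 1; push_cast; ring
    rw [h2]
    refine Real.rpow_le_rpow_of_nonpos (by positivity) ?_ ?_
    · nlinarith [Real.sq_sqrt hs, Real.sqrt_nonneg s]
    · have : (0 : ℝ) ≤ (d / 2 : ℕ) := by positivity
      linarith
  -- a function in `L^p` cannot stay above `c` on a half-line
  · rintro ⟨c, hc, h⟩
    obtain ⟨s₀, hs₀⟩ := eventually_atTop.1 h
    have h1 := hvp.meas_ge_lt_top hp0 hp (ε := ⟨c, hc.le⟩) (by
      intro h0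
      exact hc.ne' (congrArg NNReal.toReal h0))
    have h2 : Ici (max (√s₀) (max s₀ 1)) ⊆ {x | (⟨c, hc.le⟩ : NNReal) ≤ ‖v x‖₊} := by
      intro x hx
      have hx1 : 1 ≤ x := ((le_max_right _ _).trans (le_max_right _ _)).trans hx
      have hx2 : s₀ ≤ x := ((le_max_left _ _).trans (le_max_right _ _)).trans hx
      have h3 := hs₀ (x ^ 2) (by nlinarith)
      rw [Real.sqrt_sq (by linarith)] at h3
      exact h3
    have h3 := measure_mono (μ := volume) h2
    rw [Real.volume_Ici] at h3
    exact absurd (h3.trans_lt h1) (by simp)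

/-- The radial profile, as a function of `‖x‖²`, of the lift of `v` to the odd dimension
`2 ⌊d/2⌋ + 1`. Its integrals over lines and over `2 ⌊d/2⌋`-dimensional subspaces are `R^♯ v`
(for even `d`) and `v`. -/
def liftProfile (d : ℕ) (v : ℝ → ℝ) (s : ℝ) : ℝ :=
  (-1) ^ (d / 2) / Real.pi ^ (d / 2) * iteratedDerivWithin (d / 2) (fun s => v (√s)) (Ici 0) s

theorem sqrt_pi_pow_two_mul (m : ℕ) : √(Real.pi ^ (2 * m)) = Real.pi ^ m := by
  rw [mul_comm, pow_mul]
  exact Real.sqrt_sq (by positivity)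

theorem RSharp_of_odd (h : Odd d) (x : Space d) : RSharp d v x = liftProfile d v (‖x‖ ^ 2) := by
  obtain ⟨m, rfl⟩ := h
  have e1 : (2 * m + 1 - 1) / 2 = m := by omega
  have e2 : (2 * m + 1) / 2 = m := by omega
  have e3 : 2 * m + 1 - 1 = 2 * m := by omega
  rw [RSharp, if_pos ⟨m, rfl⟩, liftProfile, e1, e2, e3, sqrt_pi_pow_two_mul, radialDeriv]

/-- In even dimensions `R^♯ v` is an integral over lines, by the substitution `t² = a² + ‖x‖²`. -/
theorem RSharp_of_not_odd (h : ¬ Odd d) (x : Space d) :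
    RSharp d v x = ∫ a : ℝ, liftProfile d v (a ^ 2 + ‖x‖ ^ 2) := by
  rw [RSharp, if_neg h]
  obtain ⟨m, hm⟩ := Nat.not_odd_iff_even.1 h
  have hd : d = 2 * m := by omega
  have e2 : d / 2 = m := by omega
  have e3 : √(Real.pi ^ d) = Real.pi ^ m := by rw [hd, sqrt_pi_pow_two_mul]
  rw [e2, e3]
  set r := ‖x‖ with hr
  have hr0 : 0 ≤ r := norm_nonneg x
  have h1 : ∫ a : ℝ, liftProfile d v (a ^ 2 + r ^ 2) =
      2 * ∫ a in Ioi (0 : ℝ), liftProfile d v (a ^ 2 + r ^ 2) := by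
    have := integral_comp_abs (f := fun a => liftProfile d v (a ^ 2 + r ^ 2))
    simpa only [sq_abs] using this
  have himg : (fun t : ℝ => √(t ^ 2 - r ^ 2)) '' Ioi r = Ioi 0 := by
    ext y
    constructor
    · rintro ⟨t, ht, rfl⟩
      have ht : r < t := ht
      exact Real.sqrt_pos.2 (by nlinarith)
    · intro hy
      have hy : 0 < y := hy
      refine ⟨√(y ^ 2 + r ^ 2), ?_, ?_⟩
      · exact mem_Ioi.2 (Real.lt_sqrt_of_sq_lt (by nlinarith))
      · simp only
        rw [Real.sq_sqrt (by positivity), add_sub_cancel_right, Real.sqrt_sq hy.le]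
  have hinj : InjOn (fun t : ℝ => √(t ^ 2 - r ^ 2)) (Ioi r) := by
    intro t ht t' ht' h
    have ht : r < t := ht
    have ht' : r < t' := ht'
    have h2 : t ^ 2 - r ^ 2 = t' ^ 2 - r ^ 2 :=
      (Real.sqrt_inj (by nlinarith) (by nlinarith)).1 h
    have h3 : t ^ 2 = t' ^ 2 := by linarith
    exact (sq_eq_sq₀ (by linarith) (by linarith)).1 h3
  have hder : ∀ t ∈ Ioi r, HasDerivWithinAt (fun t : ℝ => √(t ^ 2 - r ^ 2))
      (t / √(t ^ 2 - r ^ 2)) (Ioi r) t := by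
    intro t ht
    have ht : r < t := ht
    have h2 : HasDerivAt (fun t : ℝ => t ^ 2 - r ^ 2) (2 * t) t := by
      simpa using (hasDerivAt_pow 2 t).sub_const (r ^ 2)
    have h3 := h2.sqrt (by nlinarith)
    refine (h3.congr_deriv ?_).hasDerivWithinAt
    rw [mul_div_mul_left _ _ two_ne_zero]
  rw [h1, ← himg, integral_image_eq_integral_abs_deriv_smul measurableSet_Ioi hder hinj,
    ← integral_const_mul, ← integral_const_mul]
  refine setIntegral_congr_fun measurableSet_Ioi fun t ht => ?_
  have ht : r < t := ht
  rw [abs_of_nonneg (div_nonneg (by linarith) (Real.sqrt_nonneg _)),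
    Real.sq_sqrt (by nlinarith), sub_add_cancel, liftProfile, e2, radialDeriv, smul_eq_mul]
  ring

theorem IsAdmissible.continuousOn_liftProfile (hv : IsAdmissible d v) :
    ContinuousOn (liftProfile d v) (Ici 0) :=
  (continuousOn_iteratedDerivWithin_Ici hv.smooth le_rfl).const_mul _

theorem IsAdmissible.abs_liftProfile_le (hv : IsAdmissible d v) :
    ∃ C α : ℝ, 0 ≤ C ∧ 2 * ((d / 2 : ℕ) : ℝ) + 1 < α ∧
    ∀ s, 0 ≤ s → |liftProfile d v s| ≤ C * (1 + s) ^ (-α / 2) := by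
  obtain ⟨C, α, hα, hC⟩ := hv.decay
  have hC0 : 0 ≤ C := by simpa using (abs_nonneg _).trans (hC 0)
  refine ⟨|(-1) ^ (d / 2) / Real.pi ^ (d / 2)| * C, α, by positivity, hα, fun s hs => ?_⟩
  rw [liftProfile, abs_mul, mul_assoc]
  refine mul_le_mul_of_nonneg_left ?_ (abs_nonneg _)
  have h1 := hC √s
  rw [radialDeriv, Real.sq_sqrt hs] at h1
  refine h1.trans (mul_le_mul_of_nonneg_left ?_ hC0)
  rw [abs_of_nonneg (Real.sqrt_nonneg s)]
  have h2 : (1 + √s) ^ (-α) = ((1 + √s) ^ 2) ^ (-α / 2) := by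
    rw [← Real.rpow_natCast, ← Real.rpow_mul (by positivity)]
    congr 1; push_cast; ring
  rw [h2]
  refine Real.rpow_le_rpow_of_nonpos (by positivity) ?_ ?_
  · nlinarith [Real.sq_sqrt hs, Real.sqrt_nonneg s]
  · have : (0 : ℝ) ≤ (d / 2 : ℕ) := by positivity
    linarith

theorem IsAdmissible.continuous_liftProfile_comp (hv : IsAdmissible d v) {X : Type*}
    [TopologicalSpace X] {r : X → ℝ} (hr : Continuous r) (h0 : ∀ x, 0 ≤ r x) :
    Continuous fun x => liftProfile d v (r x) :=
  hv.continuousOn_liftProfile.comp_continuous hr h0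

theorem IsAdmissible.integrable_liftProfile (hv : IsAdmissible d v) {V : Type*}
    [NormedAddCommGroup V] [InnerProductSpace ℝ V] [FiniteDimensional ℝ V] [MeasurableSpace V]
    [BorelSpace V]
    (hV : Module.finrank ℝ V ≤ 2 * (d / 2) + 1) {r : ℝ} (hr : 0 ≤ r) :
    Integrable (fun x : V => liftProfile d v (‖x‖ ^ 2 + r)) := by
  obtain ⟨C, α, hC, hα, hb⟩ := hv.abs_liftProfile_le
  have hV' : (Module.finrank ℝ V : ℝ) ≤ 2 * ((d / 2 : ℕ) : ℝ) + 1 := by exact_mod_cast hV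
  refine ((integrable_rpow_neg_one_add_norm_sq (E := V) (μ := volume)
    (hV'.trans_lt hα)).const_mul C).mono'
    (hv.continuous_liftProfile_comp (by fun_prop) fun x => by positivity).aestronglyMeasurable
    (.of_forall fun x => ?_)
  refine (hb _ (by positivity)).trans (mul_le_mul_of_nonneg_left ?_ hC)
  refine Real.rpow_le_rpow_of_nonpos (by positivity) (by linarith) ?_
  have : (0 : ℝ) ≤ (d / 2 : ℕ) := by positivity
  linarith

theorem IsAdmissible.norm_integral_liftProfile_le (hv : IsAdmissible d v) {V : Type*}
    [NormedAddCommGroup V] [InnerProductSpace ℝ V] [FiniteDimensional ℝ V] [MeasurableSpace V]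
    [BorelSpace V]
    (hV : Module.finrank ℝ V ≤ 2 * (d / 2) + 1) :
    ∃ K, ∀ r, 0 ≤ r → ‖∫ x : V, liftProfile d v (‖x‖ ^ 2 + r)‖ ≤ K := by
  obtain ⟨C, α, hC, hα, hb⟩ := hv.abs_liftProfile_le
  have hV' : (Module.finrank ℝ V : ℝ) ≤ 2 * ((d / 2 : ℕ) : ℝ) + 1 := by exact_mod_cast hV
  refine ⟨∫ x : V, C * (1 + ‖x‖ ^ 2) ^ (-α / 2), fun r hr => ?_⟩
  refine norm_integral_le_of_norm_le ((integrable_rpow_neg_one_add_norm_sq (E := V) (μ := volume)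
    (hV'.trans_lt hα)).const_mul C) (.of_forall fun x => ?_)
  refine (hb _ (by positivity)).trans (mul_le_mul_of_nonneg_left ?_ hC)
  refine Real.rpow_le_rpow_of_nonpos (by positivity) (by linarith) ?_
  have : (0 : ℝ) ≤ (d / 2 : ℕ) := by positivity
  linarith

theorem IsAdmissible.integral_liftProfile (hv : IsAdmissible d v) {p : ℝ≥0∞} (hp0 : p ≠ 0)
    (hp : p ≠ ⊤) (hvp : MemLp v p volume) (t : ℝ) :
    ∫ z : Space (2 * (d / 2)), liftProfile d v (‖z‖ ^ 2 + t ^ 2) = v t := by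
  obtain ⟨γ, hγ, hb⟩ := hv.decay_all hp0 hp hvp
  have h := integral_space_even hv.smooth hγ hb (sq_nonneg t)
  rw [Real.sqrt_sq_eq_abs] at h
  have e : v |t| = v t := by
    rcases abs_choice t with h | h
    · rw [h]
    · rw [h, hv.even]
  rw [← e, ← h]
  refine integral_congr_ae (.of_forall fun z => ?_)
  simp only [liftProfile, add_comm]

theorem _root_.MeasureTheory.Integrable.memLp_two_of_bound {α : Type*} [MeasurableSpace α]
    {μ : Measure α} {f : α → ℝ} (hf : Integrable f μ) {K : ℝ} (hK : ∀ x, ‖f x‖ ≤ K) :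
    MemLp f 2 μ := by
  rw [memLp_two_iff_integrable_sq hf.aestronglyMeasurable]
  refine (hf.norm.const_mul K).mono' (hf.aestronglyMeasurable.pow 2) (.of_forall fun x => ?_)
  rw [norm_pow, sq]
  exact mul_le_mul_of_nonneg_right (hK x) (norm_nonneg _)

theorem norm_spaceSucc_symm_zero {n : ℕ} (τ : ℝ) :
    ‖(spaceSucc n).symm (τ, 0)‖ ^ 2 = τ ^ 2 := by simp [norm_spaceSucc_symm]

/-- The lift of `v` to dimension `n + 1`, where `n = 2 ⌊d/2⌋`, is integrable, its marginal on the
line is `v`, and so its Fourier transform restricted to a line through the origin is that of `v`. -/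
theorem IsAdmissible.lift (hv : IsAdmissible d v) {p : ℝ≥0∞} (hp0 : p ≠ 0) (hp : p ≠ ⊤)
    (hvp : MemLp v p volume) {n : ℕ} (hn : n = 2 * (d / 2)) :
    Integrable (fun x : Space (n + 1) => liftProfile d v (‖x‖ ^ 2)) ∧ Integrable v ∧
      MemLp v 2 volume ∧ ∀ (η : Space (n + 1)) (τ : ℝ), ‖η‖ ^ 2 = τ ^ 2 →
        𝓕 (fun x : Space (n + 1) => (liftProfile d v (‖x‖ ^ 2) : ℂ)) η =
          𝓕 (fun t => (v t : ℂ)) τ := by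
  have hH : Integrable (fun x : Space (n + 1) => liftProfile d v (‖x‖ ^ 2)) := by
    simpa using hv.integrable_liftProfile (V := Space (n + 1)) (by simp [hn]) le_rfl
  have hHc : Integrable (fun x : Space (n + 1) => (liftProfile d v (‖x‖ ^ 2) : ℂ)) := hH.ofReal
  have hmarg : ∀ a : ℝ,
      ∫ z : Space n, (liftProfile d v (‖(spaceSucc n).symm (a, z)‖ ^ 2) : ℂ) = v a := by
    intro a
    simp_rw [norm_spaceSucc_symm, add_comm (a ^ 2)]
    subst hn
    rw [integral_complex_ofReal, hv.integral_liftProfile hp0 hp hvp]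
  have hvi : Integrable v := by
    have h1 := (integrable_comp_spaceSucc_symm hHc).integral_prod_left
    simp_rw [hmarg] at h1
    simpa using h1.re
  refine ⟨hH, hvi, ?_, fun η τ h => ?_⟩
  · obtain ⟨K, hK⟩ := hv.norm_integral_liftProfile_le (V := Space (2 * (d / 2))) (by simp)
    refine hvi.memLp_two_of_bound (K := K) fun t => ?_
    rw [← hv.integral_liftProfile hp0 hp hvp t]
    exact hK _ (sq_nonneg t)
  · have h1 := fourier_marginal_fst hHc τ
    rw [fourier_eq_of_radial (G := fun s => (liftProfile d v s : ℂ)) (fun _ => rfl)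
      (h.trans (norm_spaceSucc_symm_zero (n := n) τ).symm), ← h1,
      funext hmarg]

theorem IsAdmissible.integrable_of_memLp (hv : IsAdmissible d v) {p : ℝ≥0∞} (hp0 : p ≠ 0)
    (hp : p ≠ ⊤) (hvp : MemLp v p volume) : Integrable v :=
  (hv.lift hp0 hp hvp rfl).2.1

theorem IsAdmissible.memLp_two_of_memLp (hv : IsAdmissible d v) {p : ℝ≥0∞} (hp0 : p ≠ 0)
    (hp : p ≠ ⊤) (hvp : MemLp v p volume) : MemLp v 2 volume :=
  (hv.lift hp0 hp hvp rfl).2.2.1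

/-- The Fourier slice theorem: `R^♯ v` is integrable and square integrable, and its Fourier
transform is the radial extension of that of `v`. -/
theorem IsAdmissible.fourier_RSharp (hv : IsAdmissible d v) {p : ℝ≥0∞} (hp0 : p ≠ 0)
    (hp : p ≠ ⊤) (hvp : MemLp v p volume) :
    Integrable (RSharp d v) ∧ MemLp (RSharp d v) 2 volume ∧
      ∀ ξ, 𝓕 (fun x => (RSharp d v x : ℂ)) ξ = 𝓕 (fun t => (v t : ℂ)) ‖ξ‖ := by
  by_cases hodd : Odd d
  · have hR : RSharp d v = fun x => liftProfile d v (‖x‖ ^ 2) := funext (RSharp_of_odd hodd)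
    obtain ⟨m, hm⟩ := hodd
    obtain ⟨n, rfl⟩ : ∃ n, d = n + 1 := ⟨2 * m, hm⟩
    obtain ⟨h1, -, -, h2⟩ := hv.lift hp0 hp hvp (n := n) (by omega)
    obtain ⟨C, α, hC, hα, hb⟩ := hv.abs_liftProfile_le
    rw [hR]
    refine ⟨h1, h1.memLp_two_of_bound (K := C) fun x => ?_, fun ξ => h2 ξ _ rfl⟩
    refine (hb _ (by positivity)).trans (mul_le_of_le_one_right hC ?_)
    refine Real.rpow_le_one_of_one_le_of_nonpos (by nlinarith [sq_nonneg ‖x‖]) ?_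
    have : (0 : ℝ) ≤ ((n + 1) / 2 : ℕ) := by positivity
    linarith
  · have hR : RSharp d v = fun x => ∫ a : ℝ, liftProfile d v (a ^ 2 + ‖x‖ ^ 2) :=
      funext (RSharp_of_not_odd hodd)
    obtain ⟨m, hm⟩ := Nat.not_odd_iff_even.1 hodd
    obtain ⟨h1, -, -, h2⟩ := hv.lift hp0 hp hvp (n := d) (by omega)
    have h1c : Integrable (fun x : Space (d + 1) => (liftProfile d v (‖x‖ ^ 2) : ℂ)) := h1.ofReal
    have hmarg : ∀ x : Space d,
        ∫ a : ℝ, (liftProfile d v (‖(spaceSucc d).symm (a, x)‖ ^ 2) : ℂ) =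
          (RSharp d v x : ℂ) := by
      intro x
      simp_rw [norm_spaceSucc_symm]
      rw [integral_complex_ofReal, hR]
    have hi : Integrable (RSharp d v) := by
      have h3 := (integrable_comp_spaceSucc_symm h1c).integral_prod_right
      simp_rw [hmarg] at h3
      simpa using h3.re
    refine ⟨hi, ?_, fun ξ => ?_⟩
    · obtain ⟨K, hK⟩ := hv.norm_integral_liftProfile_le (V := ℝ) (by simp)
      refine hi.memLp_two_of_bound (K := K) fun x => ?_
      rw [hR]
      simpa using hK _ (sq_nonneg ‖x‖)
    · rw [← h2 ((spaceSucc d).symm (0, ξ)) ‖ξ‖ (by simp [norm_spaceSucc_symm]),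
        ← fourier_marginal_snd h1c ξ, funext hmarg]

end RSharp

/-! ### Solutions of the wave equation as Fourier integrals -/

section Pairing

variable {V : Type*} [NormedAddCommGroup V] [InnerProductSpace ℝ V]

/-- The negative of the standard pairing of `V × ℝ` with itself. With this sign the Fourier integral
`VectorFourier.fourierIntegral`, whose kernel carries a minus sign, is the inverse transform. The
product `V × ℝ` has no inner product instance, so the pairing is given explicitly. -/
def pairing (V : Type*) [NormedAddCommGroup V] [InnerProductSpace ℝ V] :
    (V × ℝ) →L[ℝ] (V × ℝ) →L[ℝ] ℝ :=
  -(((innerSL ℝ).bilinearComp (ContinuousLinearMap.fst ℝ V ℝ)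
      (ContinuousLinearMap.fst ℝ V ℝ) : (V × ℝ) →L[ℝ] (V × ℝ) →L[ℝ] ℝ) +
    (ContinuousLinearMap.mul ℝ ℝ).bilinearComp (ContinuousLinearMap.snd ℝ V ℝ)
      (ContinuousLinearMap.snd ℝ V ℝ))

theorem pairing_apply (w z : V × ℝ) : pairing V w z = -(inner ℝ w.1 z.1 + w.2 * z.2) := by
  simp [pairing]

theorem toLinearMap₁₂_pairing_apply (w z : V × ℝ) :
    (pairing V).toLinearMap₁₂ w z = -(inner ℝ w.1 z.1 + w.2 * z.2) := pairing_apply w z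

theorem norm_cone {V : Type*} [NormedAddCommGroup V] {ε : ℝ} (hε : |ε| = 1) (ξ : V) :
    ‖(ξ, ε * ‖ξ‖)‖ = ‖ξ‖ := by
  simp [Prod.norm_def, hε]

end Pairing

section WaveIntegral

variable {V : Type*} [NormedAddCommGroup V] [InnerProductSpace ℝ V] [FiniteDimensional ℝ V]
  [MeasurableSpace V] [BorelSpace V]

/-- The solution of the wave equation with initial values `F⁻¹ b` and zero initial velocity:
`∫ b(ξ) cos(2π‖ξ‖t) exp(2πi⟨x, ξ⟩) dξ`. It is defined, and even, for all real times. -/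
def waveInt (b : V → ℂ) (x : V) (t : ℝ) : ℂ :=
  𝓕⁻ (fun ξ => (Real.cos (2 * Real.pi * ‖ξ‖ * t) : ℂ) * b ξ) x

/-- Lebesgue measure `dξ` carried to the cone `τ = ε ‖ξ‖` in frequency space; not its surface
measure. -/
def coneMeasure (V : Type*) [NormedAddCommGroup V] [InnerProductSpace ℝ V]
    [FiniteDimensional ℝ V] [MeasurableSpace V] [BorelSpace V] (ε : ℝ) : Measure (V × ℝ) :=
  (volume : Measure V).map fun ξ => (ξ, ε * ‖ξ‖)

/-- The plane waves with frequencies on one of the two cones `τ = ±‖ξ‖`, superposed with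
amplitude `b`. As the transform of a measure on space-time it is smooth jointly in `x` and `t`,
although `‖ξ‖` is not a smooth function of `ξ`. -/
def halfWave (ε : ℝ) (b : V → ℂ) : V × ℝ → ℂ :=
  VectorFourier.fourierIntegral Real.fourierChar (coneMeasure V ε) (pairing V).toLinearMap₁₂
    fun w => b w.1

theorem halfWave_apply (ε : ℝ) {b : V → ℂ} (hb : Continuous b) (z : V × ℝ) :
    halfWave ε b z =
      ∫ ξ, Real.fourierChar (inner ℝ ξ z.1 + ε * ‖ξ‖ * z.2) • b ξ := by
  have hm : Measurable fun ξ : V => (ξ, ε * ‖ξ‖) := by fun_prop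
  rw [halfWave, VectorFourier.fourierIntegral, coneMeasure, integral_map hm.aemeasurable]
  · simp only [toLinearMap₁₂_pairing_apply, neg_neg]
  · have := Real.continuous_fourierChar
    refine Continuous.aestronglyMeasurable ?_
    simp only [toLinearMap₁₂_pairing_apply]
    fun_prop

theorem waveInt_eq {b : V → ℂ} (hb : Continuous b) (hi : Integrable b) (x : V) (t : ℝ) :
    waveInt b x t = (halfWave 1 b (x, t) + halfWave (-1) b (x, t)) / 2 := by
  have hint : ∀ ε : ℝ, Integrable fun ξ : V =>
      Real.fourierChar (inner ℝ ξ x + ε * ‖ξ‖ * t) • b ξ := by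
    intro ε
    have hc : Continuous fun ξ : V => Real.fourierChar (inner ℝ ξ x + ε * ‖ξ‖ * t) := by
      have := Real.continuous_fourierChar
      fun_prop
    refine hi.norm.mono' (hc.aestronglyMeasurable.smul hi.aestronglyMeasurable)
      (.of_forall fun p => ?_)
    simp [Circle.norm_smul]
  rw [halfWave_apply _ hb, halfWave_apply _ hb, ← integral_add (hint 1) (hint (-1)),
    ← integral_div, waveInt, Real.fourierInv_eq]
  refine integral_congr_ae (.of_forall fun ξ => ?_)
  simp only [AddChar.map_add_eq_mul, Circle.smul_def, Circle.coe_mul, smul_eq_mul, one_mul,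
    neg_mul]
  rw [Complex.ofReal_cos, Complex.cos, Real.fourierChar_apply (‖ξ‖ * t),
    Real.fourierChar_apply (-(‖ξ‖ * t))]
  have e1 : ((2 * Real.pi * ‖ξ‖ * t : ℝ) : ℂ) * Complex.I =
      (2 * Real.pi * (‖ξ‖ * t) : ℝ) * Complex.I := by push_cast; ring
  have e2 : -((2 * Real.pi * ‖ξ‖ * t : ℝ) : ℂ) * Complex.I =
      (2 * Real.pi * -(‖ξ‖ * t) : ℝ) * Complex.I := by push_cast; ring
  rw [e1, e2]
  ring

variable {b : V → ℂ}

theorem integrable_cone (hb : Continuous b)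
    (hi : ∀ k : ℕ, Integrable fun ξ => ‖ξ‖ ^ k * ‖b ξ‖) {ε : ℝ} (hε : |ε| = 1) (k : ℕ) :
    Integrable (fun w : V × ℝ => ‖w‖ ^ k * ‖b w.1‖) (coneMeasure V ε) := by
  have hm : Measurable fun ξ : V => (ξ, ε * ‖ξ‖) := by fun_prop
  rw [coneMeasure, integrable_map_measure (Continuous.aestronglyMeasurable (by fun_prop))
    hm.aemeasurable]
  refine (hi k).congr (.of_forall fun ξ => ?_)
  simp only [Function.comp_apply, norm_cone hε]

theorem contDiff_halfWave (hb : Continuous b)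
    (hi : ∀ k : ℕ, Integrable fun ξ => ‖ξ‖ ^ k * ‖b ξ‖) {ε : ℝ} (hε : |ε| = 1) :
    ContDiff ℝ ∞ (halfWave ε b) :=
  VectorFourier.contDiff_fourierIntegral (N := ⊤) (pairing V)
    fun n _ => integrable_cone hb hi hε n

theorem iteratedFDeriv_halfWave (hb : Continuous b)
    (hi : ∀ k : ℕ, Integrable fun ξ => ‖ξ‖ ^ k * ‖b ξ‖) {ε : ℝ} (hε : |ε| = 1) (z e : V × ℝ) :
    iteratedFDeriv ℝ 2 (halfWave ε b) z ![e, e] =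
      VectorFourier.fourierIntegral Real.fourierChar (coneMeasure V ε) (pairing V).toLinearMap₁₂
        (fun w => -(4 * Real.pi ^ 2 * (inner ℝ w.1 e.1 + w.2 * e.2) ^ 2 : ℝ) * b w.1) z := by
  have hm : AEStronglyMeasurable (fun w : V × ℝ => b w.1) (coneMeasure V ε) :=
    Continuous.aestronglyMeasurable (by fun_prop)
  have h1 := VectorFourier.iteratedFDeriv_fourierIntegral (N := ⊤) (pairing V)
    (fun n _ => integrable_cone hb hi hε n) hm (n := 2) le_top
  rw [halfWave, h1, Real.fourierIntegral_continuousMultilinearMap_apply']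
  · congr 1
    funext w
    rw [VectorFourier.fourierPowSMulRight_apply]
    simp only [pairing_apply, Fin.prod_univ_two, Matrix.cons_val_zero, Matrix.cons_val_one,
      smul_eq_mul]
    simp only [Complex.real_smul]
    push_cast
    have hI := Complex.I_sq
    linear_combination ((4 * (Real.pi : ℂ) ^ 2 * (inner ℝ w.1 e.1 + w.2 * e.2) ^ 2) * b w.1) * hI
  · exact VectorFourier.integrable_fourierPowSMulRight _ (integrable_cone hb hi hε 2) hm

/-- The frequencies lie on the cones `τ² = ‖ξ‖²`, which is the wave equation. -/
theorem wave_halfWave (hb : Continuous b)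
    (hi : ∀ k : ℕ, Integrable fun ξ => ‖ξ‖ ^ k * ‖b ξ‖) {ε : ℝ} (hε : |ε| = 1) {ι : Type*}
    [Fintype ι] (e : OrthonormalBasis ι ℝ V) (z : V × ℝ) :
    iteratedFDeriv ℝ 2 (halfWave ε b) z ![(0, 1), (0, 1)] =
      ∑ i, iteratedFDeriv ℝ 2 (halfWave ε b) z ![(e i, 0), (e i, 0)] := by
  have hm : Measurable fun ξ : V => (ξ, ε * ‖ξ‖) := by fun_prop
  have hε2 : ε ^ 2 = 1 := by rw [← sq_abs, hε, one_pow]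
  simp_rw [iteratedFDeriv_halfWave hb hi hε]
  simp only [VectorFourier.fourierIntegral]
  rw [← integral_finsetSum]
  · rw [coneMeasure]
    refine integral_congr_ae ?_
    have hcl : MeasurableSet {w : V × ℝ | w.2 ^ 2 = ‖w.1‖ ^ 2} :=
      (isClosed_eq (by fun_prop) (by fun_prop)).measurableSet
    have hae : ∀ᵐ w ∂((volume : Measure V).map fun ξ => (ξ, ε * ‖ξ‖)), w.2 ^ 2 = ‖w.1‖ ^ 2 := by
      rw [ae_map_iff hm.aemeasurable hcl]
      exact .of_forall fun ξ => by simp [mul_pow, hε2]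
    filter_upwards [hae] with w hw
    rw [← Finset.smul_sum, ← Finset.sum_mul]
    congr 2
    simp only [inner_zero_right, mul_one, zero_add, mul_zero, add_zero]
    rw [hw, ← e.sum_sq_inner_left w.1]
    push_cast
    rw [Finset.mul_sum, Finset.sum_neg_distrib]
  · intro i _
    have hc : Continuous fun w : V × ℝ => Real.fourierChar (-(pairing V).toLinearMap₁₂ w z) := by
      have := Real.continuous_fourierChar
      simp only [toLinearMap₁₂_pairing_apply]
      fun_prop
    refine ((integrable_cone hb hi hε 2).const_mul (4 * Real.pi ^ 2)).mono'
      (Continuous.aestronglyMeasurable (by fun_prop)) (.of_forall fun w => ?_)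
    rw [Circle.norm_smul, norm_mul, norm_neg, Complex.norm_real, Real.norm_eq_abs, abs_mul,
      abs_of_nonneg (by positivity : (0 : ℝ) ≤ 4 * Real.pi ^ 2), ← mul_assoc]
    gcongr
    rw [abs_pow, mul_zero, add_zero]
    gcongr
    refine (abs_real_inner_le_norm _ _).trans ?_
    rw [e.norm_eq_one, mul_one]
    exact norm_fst_le w

end WaveIntegral

section WaveSolution

theorem two_le_infty : (2 : ℕ∞ω) ≤ (∞ : ℕ∞ω) :=
  WithTop.coe_le_coe.2 (le_top : (2 : ℕ∞) ≤ ⊤)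

theorem iteratedFDeriv_two_comp_add {E F G : Type*} [NormedAddCommGroup E] [NormedSpace ℝ E]
    [NormedAddCommGroup F] [NormedSpace ℝ F] [NormedAddCommGroup G] [NormedSpace ℝ G] {Ψ : E → G}
    (h : ContDiff ℝ 2 Ψ) (A : F →L[ℝ] E) (c : E) (y e : F) :
    iteratedFDeriv ℝ 2 (fun y => Ψ (c + A y)) y ![e, e] =
      iteratedFDeriv ℝ 2 Ψ (c + A y) ![A e, A e] := by
  have h1 : ContDiff ℝ 2 fun z => Ψ (c + z) := h.comp (contDiff_const.add contDiff_id)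
  have h2 := A.iteratedFDeriv_comp_right h1 y (i := 2) le_rfl
  change iteratedFDeriv ℝ 2 ((fun z => Ψ (c + z)) ∘ A) y ![e, e] = _
  rw [h2, iteratedFDeriv_comp_add_left]
  simp only [ContinuousMultilinearMap.compContinuousLinearMap_apply]
  congr 1
  funext i
  fin_cases i <;> rfl

variable {V : Type*} [NormedAddCommGroup V] [InnerProductSpace ℝ V] [FiniteDimensional ℝ V]
  [MeasurableSpace V] [BorelSpace V] {b : V → ℂ}

theorem waveInt_neg (b : V → ℂ) (x : V) (t : ℝ) : waveInt b x (-t) = waveInt b x t := by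
  simp only [waveInt, mul_neg, Real.cos_neg]

theorem waveInt_zero (b : V → ℂ) (x : V) : waveInt b x 0 = 𝓕⁻ b x := by
  simp [waveInt]

theorem norm_waveInt_le (hi : Integrable b) (x : V) (t : ℝ) :
    ‖waveInt b x t‖ ≤ ∫ ξ, ‖b ξ‖ := by
  rw [waveInt, Real.fourierInv_eq]
  refine norm_integral_le_of_norm_le hi.norm (.of_forall fun ξ => ?_)
  rw [Circle.norm_smul, norm_mul, Complex.norm_real]
  exact mul_le_of_le_one_left (norm_nonneg _) (Real.abs_cos_le_one _)

theorem integrable_of_moments (hb : Continuous b)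
    (hi : ∀ k : ℕ, Integrable fun ξ => ‖ξ‖ ^ k * ‖b ξ‖) : Integrable b := by
  have := hi 0
  simp only [pow_zero, one_mul] at this
  exact (integrable_norm_iff hb.aestronglyMeasurable).1 this

theorem contDiff_waveInt (hb : Continuous b) (hi : ∀ k : ℕ, Integrable fun ξ => ‖ξ‖ ^ k * ‖b ξ‖) :
    ContDiff ℝ ∞ fun z : V × ℝ => waveInt b z.1 z.2 := by
  simp_rw [waveInt_eq hb (integrable_of_moments hb hi)]
  exact ((contDiff_halfWave hb hi (by simp)).add (contDiff_halfWave hb hi (by simp))).div_const 2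

theorem waveInt_wave (hb : Continuous b) (hi : ∀ k : ℕ, Integrable fun ξ => ‖ξ‖ ^ k * ‖b ξ‖)
    {ι : Type*} [Fintype ι] (e : OrthonormalBasis ι ℝ V) (z : V × ℝ) :
    iteratedFDeriv ℝ 2 (fun z : V × ℝ => (waveInt b z.1 z.2).re) z ![(0, 1), (0, 1)] =
      ∑ i, iteratedFDeriv ℝ 2 (fun z : V × ℝ => (waveInt b z.1 z.2).re) z
        ![(e i, 0), (e i, 0)] := by
  have h1 := contDiff_halfWave hb hi (ε := 1) (by simp)
  have h2 := contDiff_halfWave hb hi (ε := -1) (by simp)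
  let M : ℂ →L[ℝ] ℝ := (1 / 2 : ℝ) • Complex.reCLM
  have e1 : (fun z : V × ℝ => (waveInt b z.1 z.2).re) =
      M ∘ (halfWave 1 b + halfWave (-1) b) := by
    funext z
    rw [waveInt_eq hb (integrable_of_moments hb hi)]
    simp [M]
    ring
  have h3 : ∀ v : Fin 2 → V × ℝ, iteratedFDeriv ℝ 2 (M ∘ (halfWave 1 b + halfWave (-1) b)) z v =
      M (iteratedFDeriv ℝ 2 (halfWave 1 b) z v) + M (iteratedFDeriv ℝ 2 (halfWave (-1) b) z v) := by
    intro v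
    have h1' : ContDiffAt ℝ 2 (halfWave 1 b) z := (h1.of_le two_le_infty).contDiffAt
    have h2' : ContDiffAt ℝ 2 (halfWave (-1) b) z :=
      (h2.of_le two_le_infty).contDiffAt
    have h12 : ContDiffAt ℝ 2 (halfWave 1 b + halfWave (-1) b) z := h1'.add h2'
    rw [M.iteratedFDeriv_comp_left h12 (i := 2) le_rfl]
    rw [iteratedFDeriv_add_apply (i := 2) (by exact_mod_cast h1') (by exact_mod_cast h2')]
    simp
  simp_rw [e1, h3]
  rw [wave_halfWave hb hi (by simp) e, wave_halfWave hb hi (by simp) e, map_sum, map_sum,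
    Finset.sum_add_distrib]

theorem isPressure_waveInt {d : ℕ} {b : Space d → ℂ} (hb : Continuous b)
    (hi : ∀ k : ℕ, Integrable fun ξ => ‖ξ‖ ^ k * ‖b ξ‖) {f : Space d → ℝ}
    (hf : ∀ x, (𝓕⁻ b x).re = f x) : IsPressure f fun x t => (waveInt b x t).re := by
  have hsm : ContDiff ℝ ∞ fun z : Space d × ℝ => (waveInt b z.1 z.2).re :=
    Complex.reCLM.contDiff.comp (contDiff_waveInt hb hi)
  have hsm2 : ContDiff ℝ 2 fun z : Space d × ℝ => (waveInt b z.1 z.2).re :=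
    hsm.of_le two_le_infty
  refine ⟨hsm.contDiffOn, fun x t _ => ?_, fun x => by rw [waveInt_zero, hf], fun x => ?_⟩
  · have ht := iteratedFDeriv_two_comp_add hsm2 (ContinuousLinearMap.inr ℝ (Space d) ℝ) (x, 0) t 1
    have hx := fun e : Space d =>
      iteratedFDeriv_two_comp_add hsm2 (ContinuousLinearMap.inl ℝ (Space d) ℝ) (0, t) x e
    simp only [ContinuousLinearMap.inr_apply, ContinuousLinearMap.inl_apply, Prod.mk_add_mk,
      add_zero, zero_add] at ht hx
    rw [InnerProductSpace.laplacian_eq_iteratedFDeriv_stdOrthonormalBasis]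
    simp only
    simp_rw [hx]
    rw [← waveInt_wave hb hi, ← ht, iteratedDeriv_eq_iteratedFDeriv]
    congr 1
    funext i
    fin_cases i <;> rfl
  · have hd : DifferentiableAt ℝ (fun t => (waveInt b x t).re) 0 := by
      have h1 := hsm.differentiable (by simp) (x, 0)
      exact DifferentiableAt.comp (g := fun z : Space d × ℝ => (waveInt b z.1 z.2).re)
        (f := fun t : ℝ => (x, t)) (0 : ℝ) h1
        ((differentiableAt_const x).prodMk differentiableAt_id)
    rw [hd.derivWithin (uniqueDiffOn_Ici 0 0 self_mem_Ici)]
    -- the solution is even in time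
    have h1 := deriv_comp_neg (fun t => (waveInt b x t).re) (0 : ℝ)
    simp only [waveInt_neg, neg_zero] at h1
    linarith

end WaveSolution

/-! ### Uniqueness for the wave equation by a weighted energy estimate -/

section Gradient

variable {d : ℕ} {f : Space d → ℝ} {q : Space d → ℝ → ℝ}

/-- The space-time derivative of `q` on `ℝ^d × [0, ∞)`, one-sided at time `0`. -/
def grad (q : Space d → ℝ → ℝ) : Space d × ℝ → (Space d × ℝ) →L[ℝ] ℝ :=
  fderivWithin ℝ (fun z : Space d × ℝ => q z.1 z.2) (univ ×ˢ Ici 0)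

/-- The second space-time derivative of `q`, used at positive times only. -/
def hess (q : Space d → ℝ → ℝ) :
    Space d × ℝ → (Space d × ℝ) →L[ℝ] (Space d × ℝ) →L[ℝ] ℝ :=
  fderiv ℝ (grad q)

theorem uniqueDiffOn_halfSpace : UniqueDiffOn ℝ ((univ : Set (Space d)) ×ˢ Ici (0 : ℝ)) :=
  uniqueDiffOn_univ.prod (uniqueDiffOn_Ici 0)

theorem halfSpace_mem_nhds {z : Space d × ℝ} (hz : 0 < z.2) :
    (univ : Set (Space d)) ×ˢ Ici (0 : ℝ) ∈ 𝓝 z := by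
  have : IsOpen {z : Space d × ℝ | 0 < z.2} := isOpen_lt continuous_const continuous_snd
  exact mem_of_superset (this.mem_nhds hz) fun w hw =>
    ⟨mem_univ _, mem_Ici.2 (le_of_lt hw)⟩

theorem eventually_time_pos {z : Space d × ℝ} (hz : 0 < z.2) : ∀ᶠ w in 𝓝 z, 0 < w.2 :=
  (isOpen_lt continuous_const continuous_snd).mem_nhds hz

theorem IsPressure.contDiffOn_grad (hq : IsPressure f q) :
    ContDiffOn ℝ ∞ (grad q) (univ ×ˢ Ici 0) :=
  hq.smooth.fderivWithin uniqueDiffOn_halfSpace (by simp)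

theorem IsPressure.hasFDerivAt (hq : IsPressure f q) {z : Space d × ℝ} (hz : 0 < z.2) :
    HasFDerivAt (fun z : Space d × ℝ => q z.1 z.2) (grad q z) z := by
  have h := hq.smooth.contDiffAt (halfSpace_mem_nhds hz)
  rw [grad, fderivWithin_of_mem_nhds (halfSpace_mem_nhds hz)]
  exact (h.differentiableAt (by simp)).hasFDerivAt

theorem IsPressure.hasFDerivAt_grad (hq : IsPressure f q) {z : Space d × ℝ} (hz : 0 < z.2) :
    HasFDerivAt (grad q) (hess q z) z :=
  ((hq.contDiffOn_grad.contDiffAt (halfSpace_mem_nhds hz)).differentiableAt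
    (by simp)).hasFDerivAt

theorem IsPressure.continuousAt_hess (hq : IsPressure f q) {z : Space d × ℝ} (hz : 0 < z.2) :
    ContinuousAt (hess q) z :=
  ((hq.contDiffOn_grad.contDiffAt (halfSpace_mem_nhds hz)).fderiv_right (m := 0)
    (by simp)).continuousAt

theorem IsPressure.hess_symm (hq : IsPressure f q) {z : Space d × ℝ} (hz : 0 < z.2)
    (v w : Space d × ℝ) : hess q z v w = hess q z w v :=
  second_derivative_symmetric_of_eventually
    ((eventually_time_pos hz).mono fun _ hw => hq.hasFDerivAt hw) (hq.hasFDerivAt_grad hz) v w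

theorem IsPressure.hasDerivAt_grad_time (hq : IsPressure f q) {x : Space d} {t : ℝ} (ht : 0 < t)
    (w : Space d × ℝ) : HasDerivAt (fun s => grad q (x, s) w) (hess q (x, t) (0, 1) w) t := by
  have h1 : HasDerivAt (fun s : ℝ => (x, s)) ((0 : Space d), (1 : ℝ)) t :=
    (hasDerivAt_const t x).prodMk (hasDerivAt_id t)
  have h2 := (hq.hasFDerivAt_grad (z := (x, t)) ht).comp_hasDerivAt t h1
  simpa using h2.clm_apply (hasDerivAt_const t w)

theorem IsPressure.hasFDerivAt_grad_space (hq : IsPressure f q) {x : Space d} {t : ℝ}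
    (ht : 0 < t) (w : Space d × ℝ) : HasFDerivAt (fun y => grad q (y, t) w)
      (((hess q (x, t)).flip w).comp (ContinuousLinearMap.inl ℝ (Space d) ℝ)) x := by
  have h1 : HasFDerivAt (fun y : Space d => (y, t)) (ContinuousLinearMap.inl ℝ (Space d) ℝ) x :=
    (hasFDerivAt_id x).prodMk (hasFDerivAt_const t x)
  have h2 := (hq.hasFDerivAt_grad (z := (x, t)) ht).comp x h1
  have h3 := h2.clm_apply (hasFDerivAt_const w x)
  refine h3.congr_fderiv ?_
  ext e
  simp

theorem IsPressure.hess_wave (hq : IsPressure f q) {x : Space d} {t : ℝ} (ht : 0 < t)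
    {ι : Type*} [Fintype ι] (e : OrthonormalBasis ι ℝ (Space d)) :
    hess q (x, t) (0, 1) (0, 1) = ∑ i, hess q (x, t) (e i, 0) (e i, 0) := by
  have h1 : iteratedDeriv 2 (q x) t = hess q (x, t) (0, 1) (0, 1) := by
    have hd : ∀ s, 0 < s → HasDerivAt (q x) (grad q (x, s) (0, 1)) s := fun s hs => by
      have h1 : HasDerivAt (fun s : ℝ => (x, s)) ((0 : Space d), (1 : ℝ)) s :=
        (hasDerivAt_const s x).prodMk (hasDerivAt_id s)
      exact (hq.hasFDerivAt (z := (x, s)) hs).comp_hasDerivAt s h1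
    rw [iteratedDeriv_succ, iteratedDeriv_one]
    have hev : deriv (q x) =ᶠ[𝓝 t] fun s => grad q (x, s) (0, 1) := by
      filter_upwards [lt_mem_nhds ht] with s hs using (hd s hs).deriv
    rw [hev.deriv_eq, (hq.hasDerivAt_grad_time ht (0, 1)).deriv]
  have h2 : Δ (fun y => q y t) x = ∑ i, hess q (x, t) (e i, 0) (e i, 0) := by
    have hd : ∀ y, HasFDerivAt (fun y => q y t)
        ((grad q (y, t)).comp (ContinuousLinearMap.inl ℝ (Space d) ℝ)) y := fun y => by
      have h1 : HasFDerivAt (fun y : Space d => (y, t))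
          (ContinuousLinearMap.inl ℝ (Space d) ℝ) y :=
        (hasFDerivAt_id y).prodMk (hasFDerivAt_const t y)
      exact (hq.hasFDerivAt (z := (y, t)) ht).comp y h1
    have hd' : fderiv ℝ (fun y => q y t) =
        fun y => (grad q (y, t)).comp (ContinuousLinearMap.inl ℝ (Space d) ℝ) :=
      funext fun y => (hd y).fderiv
    rw [InnerProductSpace.laplacian_eq_iteratedFDeriv_orthonormalBasis _ e]
    refine Finset.sum_congr rfl fun i _ => ?_
    rw [iteratedFDeriv_two_apply, hd']
    have h1 : HasFDerivAt (fun y : Space d => (y, t))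
        (ContinuousLinearMap.inl ℝ (Space d) ℝ) x :=
      (hasFDerivAt_id x).prodMk (hasFDerivAt_const t x)
    have h3 := ((hq.hasFDerivAt_grad (z := (x, t)) ht).comp x h1).clm_comp
      (hasFDerivAt_const (ContinuousLinearMap.inl ℝ (Space d) ℝ) x)
    have h4 : fderiv ℝ (fun y => (grad q (y, t)).comp (ContinuousLinearMap.inl ℝ (Space d) ℝ)) x
      = _ := h3.fderiv
    rw [h4]
    simp
  rw [← h1, ← h2, hq.wave x t ht]

theorem IsPressure.grad_zero_time (hq : IsPressure f q) (x : Space d) :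
    grad q (x, 0) (0, 1) = 0 := by
  have h1 : HasDerivWithinAt (fun s : ℝ => (x, s)) ((0 : Space d), (1 : ℝ)) (Ici 0) 0 :=
    ((hasDerivAt_const (0 : ℝ) x).prodMk (hasDerivAt_id (0 : ℝ))).hasDerivWithinAt
  have h2 : HasFDerivWithinAt (fun z : Space d × ℝ => q z.1 z.2) (grad q (x, 0))
      (univ ×ˢ Ici 0) (x, 0) :=
    (hq.smooth.differentiableOn (by simp) (x, 0) ⟨mem_univ _, self_mem_Ici⟩).hasFDerivWithinAt
  have h3 := h2.comp_hasDerivWithinAt (0 : ℝ) h1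
    (fun s hs => mk_mem_prod (mem_univ x) hs : MapsTo (fun s : ℝ => (x, s)) (Ici 0) _)
  have h4 : derivWithin (q x) (Ici 0) 0 = _ :=
    h3.derivWithin (uniqueDiffOn_Ici 0 0 self_mem_Ici)
  rw [← h4, hq.init_deriv]

theorem IsPressure.grad_zero_space (hq : IsPressure f q) (hf : ∀ x, f x = 0) (x e : Space d) :
    grad q (x, 0) (e, 0) = 0 := by
  have h1 : HasFDerivWithinAt (fun y : Space d => (y, (0 : ℝ)))
      (ContinuousLinearMap.inl ℝ (Space d) ℝ) univ x :=
    ((hasFDerivAt_id x).prodMk (hasFDerivAt_const (0 : ℝ) x)).hasFDerivWithinAt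
  have h2 : HasFDerivWithinAt (fun z : Space d × ℝ => q z.1 z.2) (grad q (x, 0))
      (univ ×ˢ Ici 0) (x, 0) :=
    (hq.smooth.differentiableOn (by simp) (x, 0) ⟨mem_univ _, self_mem_Ici⟩).hasFDerivWithinAt
  have h3 := (h2.comp x h1 (fun y _ => mk_mem_prod (mem_univ y) self_mem_Ici :
    MapsTo (fun y : Space d => (y, (0 : ℝ))) univ _)).hasFDerivAt univ_mem
  have h4 : ((fun z : Space d × ℝ => q z.1 z.2) ∘ fun y : Space d => (y, (0 : ℝ))) =
      fun _ => (0 : ℝ) := by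
    funext y
    simp [hq.init, hf]
  rw [h4] at h3
  have h5 := congrArg (fun L => L e) (h3.unique (hasFDerivAt_const (0 : ℝ) x))
  simpa using h5

end Gradient

section Weight

variable {V : Type*} [NormedAddCommGroup V]

/-- A smooth weight that is positive where `t + √(1 + ‖x‖²) < R` and zero elsewhere. Its level sets
are spacelike, so that the weighted energy of a wave does not increase. -/
def weight (R : ℝ) (z : V × ℝ) : ℝ := expNegInvGlue (R - (z.2 + √(1 + ‖z.1‖ ^ 2)))

/-- The absolute value of the time derivative of the weight. -/
def weightSlope (R : ℝ) (z : V × ℝ) : ℝ := deriv expNegInvGlue (R - (z.2 + √(1 + ‖z.1‖ ^ 2)))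

theorem contDiff_expNegInvGlue_one : ContDiff ℝ 1 expNegInvGlue := expNegInvGlue.contDiff (n := 1)

theorem continuous_weight (R : ℝ) : Continuous (weight R : V × ℝ → ℝ) := by
  have := contDiff_expNegInvGlue_one.continuous
  unfold weight
  fun_prop

theorem continuous_weightSlope (R : ℝ) : Continuous (weightSlope R : V × ℝ → ℝ) := by
  have : Continuous (deriv expNegInvGlue) := contDiff_expNegInvGlue_one.continuous_deriv le_rfl
  unfold weightSlope
  fun_prop

theorem weight_nonneg (R : ℝ) (z : V × ℝ) : 0 ≤ weight R z := expNegInvGlue.nonneg _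

theorem weightSlope_nonneg (R : ℝ) (z : V × ℝ) : 0 ≤ weightSlope R z :=
  expNegInvGlue.monotone.deriv_nonneg

theorem lt_sqrt_one_add_sq (x : V) : ‖x‖ < √(1 + ‖x‖ ^ 2) :=
  Real.lt_sqrt_of_sq_lt (by linarith)

theorem weight_eq_zero {R : ℝ} {z : V × ℝ} (ht : 0 ≤ z.2) (hx : R ≤ ‖z.1‖) : weight R z = 0 :=
  expNegInvGlue.zero_of_nonpos (by linarith [lt_sqrt_one_add_sq z.1])

theorem weightSlope_eq_zero {R : ℝ} {z : V × ℝ} (ht : 0 ≤ z.2) (hx : R ≤ ‖z.1‖) :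
    weightSlope R z = 0 := by
  have h1 : R - (z.2 + √(1 + ‖z.1‖ ^ 2)) < 0 := by linarith [lt_sqrt_one_add_sq z.1]
  have h2 : expNegInvGlue =ᶠ[𝓝 (R - (z.2 + √(1 + ‖z.1‖ ^ 2)))] fun _ => 0 := by
    filter_upwards [gt_mem_nhds h1] with s hs
    exact expNegInvGlue.zero_of_nonpos hs.le
  rw [weightSlope, h2.deriv_eq, deriv_const]

theorem weight_pos {R : ℝ} {z : V × ℝ} (h : z.2 + √(1 + ‖z.1‖ ^ 2) < R) : 0 < weight R z :=
  expNegInvGlue.pos_of_pos (by linarith)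

theorem hasDerivAt_weight_time (R : ℝ) (x : V) (t : ℝ) :
    HasDerivAt (fun s => weight R (x, s)) (-weightSlope R (x, t)) t := by
  have h1 : HasDerivAt (fun s => R - (s + √(1 + ‖x‖ ^ 2))) (-1) t :=
    ((hasDerivAt_id t).add_const _).const_sub R
  have h2 : HasDerivAt expNegInvGlue (weightSlope R (x, t)) (R - (t + √(1 + ‖x‖ ^ 2))) :=
    (contDiff_expNegInvGlue_one.differentiable (by simp) _).hasDerivAt
  have h3 := h2.comp t h1
  rw [mul_neg_one] at h3
  exact h3

theorem hasFDerivAt_weight_space [InnerProductSpace ℝ V] (R : ℝ) (x : V) (t : ℝ) :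
    HasFDerivAt (fun y => weight R (y, t))
      (-(weightSlope R (x, t) / √(1 + ‖x‖ ^ 2)) • innerSL ℝ x) x := by
  have h0 : 1 + ‖x‖ ^ 2 ≠ 0 := by positivity
  have h1 : HasFDerivAt (fun y : V => 1 + ‖y‖ ^ 2) (2 • innerSL ℝ x) x :=
    (hasStrictFDerivAt_norm_sq x).hasFDerivAt.const_add 1
  have h2 := ((h1.sqrt h0).const_add t).const_sub R
  have h3 : HasDerivAt expNegInvGlue (weightSlope R (x, t)) (R - (t + √(1 + ‖x‖ ^ 2))) :=
    (contDiff_expNegInvGlue_one.differentiable (by simp) _).hasDerivAt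
  have h4 := h3.comp_hasFDerivAt x h2
  refine h4.congr_fderiv ?_
  ext e
  simp
  field_simp

end Weight

section Energy

variable {d : ℕ} {f : Space d → ℝ} {q : Space d → ℝ → ℝ}

/-- The energy density `q_t² + |∇q|²`. -/
def energyDensity (q : Space d → ℝ → ℝ) (z : Space d × ℝ) : ℝ :=
  grad q z (0, 1) ^ 2 + ∑ i, grad q z (EuclideanSpace.basisFun (Fin d) ℝ i, 0) ^ 2

/-- The integral of the energy density against the weight at time `t`. The weight has compact
support in space, so the integral is finite for every smooth `q` and `t ≥ 0`. -/
def weightedEnergy (R : ℝ) (q : Space d → ℝ → ℝ) (t : ℝ) : ℝ :=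
  ∫ x, weight R (x, t) * energyDensity q (x, t)

/-- The time derivative of the integrand of the weighted energy. -/
def energyRate (R : ℝ) (q : Space d → ℝ → ℝ) (z : Space d × ℝ) : ℝ :=
  -weightSlope R z * energyDensity q z + weight R z * (2 * grad q z (0, 1) * hess q z (0, 1) (0, 1)
    + ∑ i, 2 * grad q z (EuclideanSpace.basisFun (Fin d) ℝ i, 0) *
      hess q z (0, 1) (EuclideanSpace.basisFun (Fin d) ℝ i, 0))

theorem energyDensity_nonneg (z : Space d × ℝ) : 0 ≤ energyDensity q z := by
  unfold energyDensity
  positivity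

theorem IsPressure.continuousOn_energyDensity (hq : IsPressure f q) :
    ContinuousOn (energyDensity q) (univ ×ˢ Ici 0) := by
  have h : ∀ w, ContinuousOn (fun z => grad q z w) (univ ×ˢ Ici 0) := fun w =>
    hq.contDiffOn_grad.continuousOn.clm_apply continuousOn_const
  exact ((h _).pow 2).add (continuousOn_finsetSum _ fun i _ => (h _).pow 2)

theorem IsPressure.continuousOn_weightedEnergy (hq : IsPressure f q) (R : ℝ) :
    ContinuousOn (weightedEnergy R q) (Ici 0) := by
  refine continuousOn_integral_of_compact_support (k := Metric.closedBall 0 R)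
    (isCompact_closedBall 0 R) ?_ ?_
  · refine ((continuous_weight R).continuousOn.mul hq.continuousOn_energyDensity).comp
      (continuous_swap (X := ℝ) (Y := Space d)).continuousOn ?_
    exact fun z hz => ⟨mem_univ _, hz.1⟩
  · intro t x ht hx
    rw [weight_eq_zero (z := (x, t)) ht (le_of_lt (by simpa using hx)), zero_mul]

theorem IsPressure.hasDerivAt_energy (hq : IsPressure f q) (R : ℝ) (x : Space d) {t : ℝ}
    (ht : 0 < t) : HasDerivAt (fun s => weight R (x, s) * energyDensity q (x, s))
      (energyRate R q (x, t)) t := by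
  have h1 := (hq.hasDerivAt_grad_time (x := x) ht (0, 1)).pow 2
  have h2 := HasDerivAt.fun_sum (u := Finset.univ) fun i _ =>
    (hq.hasDerivAt_grad_time (x := x) ht (EuclideanSpace.basisFun (Fin d) ℝ i, 0)).pow 2
  have h3 := (hasDerivAt_weight_time R x t).mul (h1.add h2)
  refine h3.congr_deriv ?_
  simp [energyRate, energyDensity]

theorem IsPressure.continuousOn_energyRate (hq : IsPressure f q) (R : ℝ) :
    ContinuousOn (energyRate R q) {z | 0 < z.2} := by
  have hsub : {z : Space d × ℝ | 0 < z.2} ⊆ univ ×ˢ Ici 0 := fun z hz =>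
    ⟨mem_univ _, mem_Ici.2 (le_of_lt hz)⟩
  have h : ∀ w, ContinuousOn (fun z => grad q z w) {z | 0 < z.2} := fun w =>
    (hq.contDiffOn_grad.continuousOn.mono hsub).clm_apply continuousOn_const
  have hh : ContinuousOn (hess q) {z | 0 < z.2} := fun z hz =>
    (hq.continuousAt_hess hz).continuousWithinAt
  have h2 : ∀ v w, ContinuousOn (fun z => hess q z v w) {z | 0 < z.2} := fun v w =>
    (hh.clm_apply continuousOn_const).clm_apply continuousOn_const
  exact ((continuous_weightSlope R).neg.continuousOn.mul
    (hq.continuousOn_energyDensity.mono hsub)).add ((continuous_weight R).continuousOn.mul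
      (((continuousOn_const.mul (h _)).mul (h2 _ _)).add
        (continuousOn_finsetSum _ fun i _ => (continuousOn_const.mul (h _)).mul (h2 _ _))))

theorem continuousOn_slice {X : Type*} [TopologicalSpace X] {g : Space d × ℝ → X}
    (hg : ContinuousOn g {z | 0 < z.2}) {t : ℝ} (ht : 0 < t) : Continuous fun x => g (x, t) :=
  hg.comp_continuous (by fun_prop) fun _ => ht

theorem integrable_of_zero_outside_ball {g : Space d → ℝ} (hg : Continuous g) (R : ℝ)
    (h : ∀ x, R ≤ ‖x‖ → g x = 0) : Integrable g := by
  refine hg.integrable_of_hasCompactSupport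
    (HasCompactSupport.of_support_subset_isCompact (isCompact_closedBall 0 R) fun x hx => ?_)
  by_contra hx'
  exact hx (h x (le_of_lt (by simpa using hx')))

theorem energyRate_eq_zero {R : ℝ} {z : Space d × ℝ} (ht : 0 ≤ z.2) (hx : R ≤ ‖z.1‖) :
    energyRate R q z = 0 := by
  rw [energyRate, weight_eq_zero ht hx, weightSlope_eq_zero ht hx]
  simp

theorem IsPressure.hasDerivAt_weightedEnergy (hq : IsPressure f q) (R : ℝ) {t : ℝ} (ht : 0 < t) :
    HasDerivAt (weightedEnergy R q) (∫ x, energyRate R q (x, t)) t := by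
  have hcomp : IsCompact (Metric.closedBall (0 : Space d) R ×ˢ Icc (t / 2) (2 * t)) :=
    (isCompact_closedBall 0 R).prod isCompact_Icc
  obtain ⟨M, hM⟩ := hcomp.exists_bound_of_continuousOn ((hq.continuousOn_energyRate R).mono
    fun z hz => lt_of_lt_of_le (half_pos ht) hz.2.1)
  have hsub : {z : Space d × ℝ | 0 < z.2} ⊆ univ ×ˢ Ici 0 := fun z hz =>
    ⟨mem_univ _, mem_Ici.2 (le_of_lt hz)⟩
  have hF : ContinuousOn (fun z => weight R z * energyDensity q z) {z | 0 < z.2} :=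
    (continuous_weight R).continuousOn.mul (hq.continuousOn_energyDensity.mono hsub)
  refine (hasDerivAt_integral_of_dominated_loc_of_deriv_le (s := Ioo (t / 2) (2 * t))
    (F := fun s x => weight R (x, s) * energyDensity q (x, s))
    (F' := fun s x => energyRate R q (x, s))
    (bound := (Metric.closedBall (0 : Space d) R).indicator fun _ => M)
    (Ioo_mem_nhds (by linarith) (by linarith)) ?_ ?_ ?_ ?_ ?_ ?_).2
  · filter_upwards [lt_mem_nhds ht] with s hs
    exact (continuousOn_slice hF hs).aestronglyMeasurable
  · refine integrable_of_zero_outside_ball (continuousOn_slice hF ht) R fun x hx => ?_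
    rw [weight_eq_zero (z := (x, t)) ht.le hx, zero_mul]
  · exact (continuousOn_slice (hq.continuousOn_energyRate R) ht).aestronglyMeasurable
  · refine .of_forall fun x s hs => ?_
    by_cases hx : x ∈ Metric.closedBall (0 : Space d) R
    · rw [indicator_of_mem hx]
      exact hM (x, s) ⟨hx, hs.1.le, hs.2.le⟩
    · rw [indicator_of_notMem hx, energyRate_eq_zero (z := (x, s))
        ((half_pos ht).trans hs.1).le (le_of_lt (by simpa using hx)), norm_zero]
  · exact (integrable_indicator_iff measurableSet_closedBall).2
      (integrableOn_const (isCompact_closedBall (0 : Space d) R).measure_lt_top.ne)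
  · exact .of_forall fun x s hs => hq.hasDerivAt_energy R x ((half_pos ht).trans hs.1)

/-- Integration by parts turns the rate of change of the weighted energy into a quadratic form
that is negative because the level sets of the weight are spacelike. -/
theorem IsPressure.integral_energyRate_nonpos (hq : IsPressure f q) (R : ℝ) {t : ℝ} (ht : 0 < t) :
    ∫ x, energyRate R q (x, t) ≤ 0 := by
  set e := EuclideanSpace.basisFun (Fin d) ℝ with he
  have hsub : {z : Space d × ℝ | 0 < z.2} ⊆ univ ×ˢ Ici 0 := fun z hz =>
    ⟨mem_univ _, mem_Ici.2 (le_of_lt hz)⟩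
  have hg : ∀ w, Continuous fun x => grad q (x, t) w := fun w => continuousOn_slice
    ((hq.contDiffOn_grad.continuousOn.mono hsub).clm_apply continuousOn_const) ht
  have hhc : ContinuousOn (hess q) {z | 0 < z.2} := fun z hz =>
    (hq.continuousAt_hess hz).continuousWithinAt
  have hh : ∀ v w, Continuous fun x => hess q (x, t) v w := fun v w => continuousOn_slice
    (g := fun z => hess q z v w) ((hhc.clm_apply continuousOn_const).clm_apply
      continuousOn_const) ht
  have hW : Continuous fun x : Space d => weight R (x, t) :=
    continuousOn_slice (continuous_weight R).continuousOn ht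
  have hS : Continuous fun x : Space d => weightSlope R (x, t) :=
    continuousOn_slice (continuous_weightSlope R).continuousOn ht
  have hWi : ∀ g : Space d → ℝ, Continuous g → Integrable fun x => weight R (x, t) * g x :=
    fun g hgc => integrable_of_zero_outside_ball (hW.mul hgc) R fun x hx => by
      rw [weight_eq_zero (z := (x, t)) ht.le hx, zero_mul]
  have hSi : ∀ g : Space d → ℝ, Continuous g → Integrable fun x => weightSlope R (x, t) * g x :=
    fun g hgc => integrable_of_zero_outside_ball (hS.mul hgc) R fun x hx => by
      rw [weightSlope_eq_zero (z := (x, t)) ht.le hx, zero_mul]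
  have hr : Continuous fun x : Space d => (√(1 + ‖x‖ ^ 2))⁻¹ :=
    Continuous.inv₀ (by fun_prop) fun x => (Real.sqrt_pos.2 (by positivity)).ne'
  -- the flux `q_t ∂_i q` and its divergence
  have hflux : ∀ (i : Fin d) (x : Space d), HasFDerivAt
      (fun y => grad q (y, t) (0, 1) * grad q (y, t) (e i, 0)) _ x := fun i x =>
    (hq.hasFDerivAt_grad_space ht (0, 1)).mul (hq.hasFDerivAt_grad_space ht (e i, 0))
  have hdiv : ∀ (i : Fin d) (x : Space d),
      fderiv ℝ (fun y => grad q (y, t) (0, 1) * grad q (y, t) (e i, 0)) x (e i) =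
        grad q (x, t) (0, 1) * hess q (x, t) (e i, 0) (e i, 0) +
          grad q (x, t) (e i, 0) * hess q (x, t) (0, 1) (e i, 0) := fun i x => by
    rw [(hflux i x).fderiv, hq.hess_symm (z := (x, t)) ht (0, 1)]
    simp
  have hWd : ∀ (i : Fin d) (x : Space d), fderiv ℝ (fun y => weight R (y, t)) x (e i) =
      weightSlope R (x, t) * (-(√(1 + ‖x‖ ^ 2))⁻¹ * x i) := fun i x => by
    rw [(hasFDerivAt_weight_space R x t).fderiv]
    simp [he, div_eq_mul_inv, EuclideanSpace.inner_single_right]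
    ring
  have hparts : ∀ i : Fin d, ∫ x, weight R (x, t) *
      (grad q (x, t) (0, 1) * hess q (x, t) (e i, 0) (e i, 0) +
          grad q (x, t) (e i, 0) * hess q (x, t) (0, 1) (e i, 0)) =
      ∫ x, weightSlope R (x, t) * ((√(1 + ‖x‖ ^ 2))⁻¹ * x i *
        (grad q (x, t) (0, 1) * grad q (x, t) (e i, 0))) := by
    intro i
    have h := integral_mul_fderiv_eq_neg_fderiv_mul_of_integrable
      (μ := (volume : Measure (Space d))) (f := fun x => weight R (x, t))
      (g := fun y => grad q (y, t) (0, 1) * grad q (y, t) (e i, 0)) (v := e i) ?_ ?_ ?_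
      (fun x _ => (hasFDerivAt_weight_space R x t).differentiableAt)
      (fun x _ => (hflux i x).differentiableAt)
    · simp only [hdiv, hWd] at h
      rw [h, ← integral_neg]
      refine integral_congr_ae (.of_forall fun x => ?_)
      simp only
      ring
    · simp only [hWd, mul_assoc]
      exact hSi _ (by fun_prop)
    · simp only [hdiv]
      exact hWi _ (by fun_prop)
    · exact hWi _ (by fun_prop)
  have hrate : ∀ x : Space d, energyRate R q (x, t) =
      weightSlope R (x, t) * (-energyDensity q (x, t)) + ∑ i, 2 * (weight R (x, t) *
        (grad q (x, t) (0, 1) * hess q (x, t) (e i, 0) (e i, 0) +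
          grad q (x, t) (e i, 0) * hess q (x, t) (0, 1) (e i, 0))) := by
    intro x
    rw [energyRate, hq.hess_wave ht e, ← he, Finset.mul_sum, ← Finset.sum_add_distrib,
      Finset.mul_sum, neg_mul, mul_neg]
    congr 1
    refine Finset.sum_congr rfl fun i _ => ?_
    ring
  have hen : Continuous fun x => energyDensity q (x, t) :=
    continuousOn_slice (hq.continuousOn_energyDensity.mono hsub) ht
  have hcollect : ∀ A B : Fin d → Space d → ℝ, (∀ i, Continuous (A i)) → (∀ i, Continuous (B i)) →
      (∀ i, ∫ x, weight R (x, t) * A i x = ∫ x, weightSlope R (x, t) * B i x) →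
      ∫ x, (weightSlope R (x, t) * (-energyDensity q (x, t)) +
        ∑ i, 2 * (weight R (x, t) * A i x)) =
      ∫ x, weightSlope R (x, t) * (-energyDensity q (x, t) + ∑ i, 2 * B i x) := by
    intro A B hA hB hAB
    have h1 := hSi _ hen.neg
    simp only [Pi.neg_apply] at h1
    have h2 : ∀ i, Integrable fun x => 2 * (weight R (x, t) * A i x) := fun i =>
      (hWi _ (hA i)).const_mul 2
    have h3 : ∀ i, Integrable fun x => 2 * (weightSlope R (x, t) * B i x) := fun i =>
      (hSi _ (hB i)).const_mul 2
    simp_rw [mul_add, Finset.mul_sum, mul_left_comm _ (2 : ℝ)]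
    rw [integral_add h1 (integrable_finsetSum _ fun i _ => h2 i),
      integral_add h1 (integrable_finsetSum _ fun i _ => h3 i),
      integral_finsetSum _ fun i _ => h2 i, integral_finsetSum _ fun i _ => h3 i]
    simp_rw [integral_const_mul, hAB]
  have htot : ∫ x, energyRate R q (x, t) = ∫ x, weightSlope R (x, t) *
      (-energyDensity q (x, t) + ∑ i, 2 * ((√(1 + ‖x‖ ^ 2))⁻¹ * x i *
        (grad q (x, t) (0, 1) * grad q (x, t) (e i, 0)))) := by
    simp_rw [hrate]
    exact hcollect _ _ (fun i => by fun_prop) (fun i => by fun_prop) hparts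
  rw [htot]
  refine integral_nonpos fun x => mul_nonpos_of_nonneg_of_nonpos (weightSlope_nonneg R _) ?_
  set r := (√(1 + ‖x‖ ^ 2))⁻¹ with hrdef
  set T := grad q (x, t) (0, 1) with hT
  have hr2 : r ^ 2 * (1 + ∑ i, x i ^ 2) = 1 := by
    have h1 : ‖x‖ ^ 2 = ∑ i, x i ^ 2 := by simp [EuclideanSpace.norm_sq_eq]
    rw [← h1, hrdef, inv_pow, Real.sq_sqrt (by positivity)]
    exact inv_mul_cancel₀ (by positivity)
  clear_value r
  -- completing squares; the slope `‖x‖ / √(1 + ‖x‖²)` of the level sets is less than one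
  have hsq : 0 ≤ (r * T) ^ 2 + ∑ i, (grad q (x, t) (e i, 0) - r * x i * T) ^ 2 := by positivity
  have hexp : (r * T) ^ 2 + ∑ i, (grad q (x, t) (e i, 0) - r * x i * T) ^ 2 =
      energyDensity q (x, t) - ∑ i, 2 * (r * x i * (T * grad q (x, t) (e i, 0))) := by
    have h1 : ∀ i, (grad q (x, t) (e i, 0) - r * x i * T) ^ 2 = grad q (x, t) (e i, 0) ^ 2 -
        2 * (r * x i * (T * grad q (x, t) (e i, 0))) + r ^ 2 * T ^ 2 * x i ^ 2 := fun i => by ring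
    simp_rw [h1]
    rw [Finset.sum_add_distrib, Finset.sum_sub_distrib, ← Finset.mul_sum, ← Finset.mul_sum,
      energyDensity, ← he,
      ← hT]
    linear_combination T ^ 2 * hr2
  linarith

theorem IsPressure.grad_time_eq_zero (hq : IsPressure f q) (hf : ∀ x, f x = 0) (x : Space d)
    {t : ℝ} (ht : 0 < t) : grad q (x, t) (0, 1) = 0 := by
  -- with this radius the weight is positive at `(x, t)`
  set R := t + √(1 + ‖x‖ ^ 2) + 1 with hR
  have hanti : AntitoneOn (weightedEnergy R q) (Ici 0) := by
    refine antitoneOn_of_deriv_nonpos (convex_Ici 0) (hq.continuousOn_weightedEnergy R) ?_ ?_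
    · rw [interior_Ici]
      exact fun s hs => (hq.hasDerivAt_weightedEnergy R hs).differentiableAt.differentiableWithinAt
    · rw [interior_Ici]
      intro s hs
      rw [(hq.hasDerivAt_weightedEnergy R hs).deriv]
      exact hq.integral_energyRate_nonpos R hs
  have h0 : weightedEnergy R q 0 = 0 := by
    simp [weightedEnergy, energyDensity, hq.grad_zero_time, hq.grad_zero_space hf]
  have h1 : weightedEnergy R q t ≤ 0 := h0 ▸ hanti self_mem_Ici (mem_Ici.2 ht.le) ht.le
  have hnn : ∀ y : Space d, 0 ≤ weight R (y, t) * energyDensity q (y, t) := fun y =>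
    mul_nonneg (weight_nonneg _ _) (energyDensity_nonneg _)
  have hsub : {z : Space d × ℝ | 0 < z.2} ⊆ univ ×ˢ Ici 0 := fun z hz =>
    ⟨mem_univ _, mem_Ici.2 (le_of_lt hz)⟩
  have hc : Continuous fun y : Space d => weight R (y, t) * energyDensity q (y, t) :=
    continuousOn_slice (g := fun z => weight R z * energyDensity q z)
      ((continuous_weight R).continuousOn.mul (hq.continuousOn_energyDensity.mono hsub)) ht
  have hi : Integrable fun y : Space d => weight R (y, t) * energyDensity q (y, t) :=
    integrable_of_zero_outside_ball hc R fun y hy => by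
      rw [weight_eq_zero (z := (y, t)) ht.le hy, zero_mul]
  have h2 : ∫ y, weight R (y, t) * energyDensity q (y, t) = 0 :=
    le_antisymm h1 (integral_nonneg hnn)
  rw [integral_eq_zero_iff_of_nonneg hnn hi] at h2
  have h3 : weight R (x, t) * energyDensity q (x, t) = 0 :=
    congrFun ((hc.ae_eq_iff_eq volume continuous_const).1 h2) x
  have h4 : 0 < weight R (x, t) := weight_pos (by simp only [hR]; linarith)
  have h5 : energyDensity q (x, t) = 0 := by
    simpa [h4.ne'] using h3
  have h6 : 0 ≤ ∑ i, grad q (x, t) (EuclideanSpace.basisFun (Fin d) ℝ i, 0) ^ 2 := by positivity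
  have h7 : grad q (x, t) (0, 1) ^ 2 = 0 := by
    unfold energyDensity at h5
    nlinarith [sq_nonneg (grad q (x, t) (0, 1))]
  exact pow_eq_zero_iff two_ne_zero |>.1 h7

/-- A solution with zero initial values is constant in time, also up to the time `0`, where only the
one-sided derivative is available. -/
theorem IsPressure.eq_zero (hq : IsPressure f q) (hf : ∀ x, f x = 0) (x : Space d)
    {t : ℝ} (ht : 0 ≤ t) : q x t = 0 := by
  have hc : ContinuousOn (q x) (Ici 0) :=
    hq.smooth.continuousOn.comp (f := fun s : ℝ => (x, s)) (by fun_prop)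
      fun s hs => ⟨mem_univ _, hs⟩
  have hd : ∀ s, 0 < s → HasDerivAt (q x) 0 s := fun s hs => by
    have h1 : HasDerivAt (fun s : ℝ => (x, s)) ((0 : Space d), (1 : ℝ)) s :=
      (hasDerivAt_const s x).prodMk (hasDerivAt_id s)
    have h2 := (hq.hasFDerivAt (z := (x, s)) hs).comp_hasDerivAt s h1
    rw [hq.grad_time_eq_zero hf x hs] at h2
    exact h2
  have h := constant_of_has_deriv_right_zero (f := q x) (a := 0) (b := t)
    (hc.mono fun s hs => hs.1) ?_ t (right_mem_Icc.2 ht)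
  · rw [h, hq.init, hf]
  · intro s hs
    rcases hs.1.eq_or_lt with rfl | hs0
    · refine hasDerivWithinAt_Ici_of_tendsto_deriv (s := Ioi 0) ?_
        ((hc 0 self_mem_Ici).mono Ioi_subset_Ici_self) self_mem_nhdsWithin ?_
      · exact fun s hs => (hd s hs).differentiableAt.differentiableWithinAt
      · refine tendsto_const_nhds.congr' ?_
        filter_upwards [self_mem_nhdsWithin] with s hs using (hd s hs).deriv.symm
    · exact (hd s hs0).hasDerivWithinAt

theorem IsPressure.contDiffAt_time {p : Space d → ℝ → ℝ} (hp : IsPressure f p) (x : Space d)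
    {t : ℝ} (ht : 0 < t) : ContDiffAt ℝ 2 (p x) t :=
  ((hp.smooth.contDiffAt (halfSpace_mem_nhds (z := (x, t)) ht)).comp t
    (contDiff_prodMk_right x).contDiffAt).of_le two_le_infty

theorem IsPressure.contDiffAt_space {p : Space d → ℝ → ℝ} (hp : IsPressure f p) (x : Space d)
    {t : ℝ} (ht : 0 < t) : ContDiffAt ℝ 2 (fun y => p y t) x :=
  ((hp.smooth.contDiffAt (halfSpace_mem_nhds (z := (x, t)) ht)).comp x
    (contDiff_prodMk_left t).contDiffAt).of_le two_le_infty

theorem IsPressure.sub {f₁ f₂ : Space d → ℝ} {p₁ p₂ : Space d → ℝ → ℝ} (h₁ : IsPressure f₁ p₁)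
    (h₂ : IsPressure f₂ p₂) : IsPressure (fun x => f₁ x - f₂ x) fun x t => p₁ x t - p₂ x t := by
  refine ⟨h₁.smooth.sub h₂.smooth, fun x t ht => ?_, fun x => by rw [h₁.init, h₂.init],
    fun x => ?_⟩
  · have e1 : iteratedDeriv 2 (fun t => p₁ x t - p₂ x t) t = _ :=
      iteratedDeriv_sub (n := 2) (h₁.contDiffAt_time x ht) (h₂.contDiffAt_time x ht)
    have e2 : Δ (fun y => p₁ y t - p₂ y t) x = _ :=
      (h₁.contDiffAt_space x ht).laplacian_sub (h₂.contDiffAt_space x ht)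
    rw [e1, e2, h₁.wave x t ht, h₂.wave x t ht]
  · have hd : ∀ {f : Space d → ℝ} {p : Space d → ℝ → ℝ}, IsPressure f p →
        DifferentiableWithinAt ℝ (p x) (Ici 0) 0 := fun {f p} hp =>
      (hp.smooth.differentiableOn (by simp) (x, 0) ⟨mem_univ _, self_mem_Ici⟩).comp
        (f := fun s : ℝ => (x, s)) (0 : ℝ)
        ((differentiableAt_const x).prodMk differentiableAt_id).differentiableWithinAt
        fun s hs => ⟨mem_univ _, hs⟩
    have e : derivWithin (fun t => p₁ x t - p₂ x t) (Ici 0) 0 = _ :=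
      derivWithin_sub (hd h₁) (hd h₂)
    rw [e, h₁.init_deriv, h₂.init_deriv, sub_zero]

/-- Solutions of the initial value problem are unique; no growth condition is needed. -/
theorem IsPressure.unique {p₁ p₂ : Space d → ℝ → ℝ} (h₁ : IsPressure f p₁) (h₂ : IsPressure f p₂)
    (x : Space d) {t : ℝ} (ht : 0 ≤ t) : p₁ x t = p₂ x t :=
  sub_eq_zero.1 ((h₁.sub h₂).eq_zero (fun _ => sub_self _) x ht)

theorem IsPressure.isPressure_pressure {p : Space d → ℝ → ℝ} (h : IsPressure f p) :
    IsPressure f (pressure f) := by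
  have he : ∃ p, IsPressure f p := ⟨p, h⟩
  rw [pressure, dif_pos he]
  exact he.choose_spec

theorem IsPressure.pressure_eq {p : Space d → ℝ → ℝ} (h : IsPressure f p) (x : Space d) {t : ℝ}
    (ht : 0 ≤ t) : pressure f x t = p x t :=
  h.isPressure_pressure.unique h x ht

end Energy

/-! ### Density of Gaussians among radial functions -/

section Gaussians

theorem exp_neg_mul_sq_le_rpow (n : ℕ) {b : ℝ} (hb : 0 < b) :
    ∃ C : ℝ, 0 ≤ C ∧ ∀ t : ℝ,
      Real.exp (-b * t ^ 2) ≤ C * (1 + |t|) ^ (-(2 * ((n + 1 : ℕ) : ℝ))) := by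
  set k : ℝ := ((n + 1 : ℕ) : ℝ) with hk
  have hk0 : 0 < k := by positivity
  set M := max 1 (k / b) with hM
  have hM1 : 1 ≤ M := le_max_left _ _
  refine ⟨(2 * M) ^ (n + 1), by positivity, fun t => ?_⟩
  have h1 : (1 + |t|) ^ 2 ≤ 2 * M * (1 + b / k * t ^ 2) := by
    have h2 : t ^ 2 ≤ M * (b / k * t ^ 2) := by
      have h3 : k / b * (b / k * t ^ 2) = t ^ 2 := by field_simp
      calc t ^ 2 = k / b * (b / k * t ^ 2) := h3.symm
        _ ≤ _ := mul_le_mul_of_nonneg_right (le_max_right _ _) (by positivity)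
    nlinarith [sq_abs t, sq_nonneg (1 - |t|)]
  have h2 : (1 + b / k * t ^ 2) ^ (n + 1) ≤ Real.exp (b * t ^ 2) := by
    calc (1 + b / k * t ^ 2) ^ (n + 1) ≤ Real.exp (b / k * t ^ 2) ^ (n + 1) := by
          refine pow_le_pow_left₀ (by positivity) ?_ _
          linarith [Real.add_one_le_exp (b / k * t ^ 2)]
      _ = Real.exp (b * t ^ 2) := by
          rw [← Real.exp_nat_mul]
          congr 1
          rw [← hk]
          field_simp
  have h3 : ((1 + |t|) ^ 2) ^ (n + 1) ≤ (2 * M) ^ (n + 1) * Real.exp (b * t ^ 2) := by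
    refine (pow_le_pow_left₀ (by positivity) h1 _).trans ?_
    rw [mul_pow]
    exact mul_le_mul_of_nonneg_left h2 (by positivity)
  have h4 : (1 + |t|) ^ (-(2 * k)) = (((1 + |t|) ^ 2) ^ (n + 1))⁻¹ := by
    rw [Real.rpow_neg (by positivity), ← pow_mul, ← Real.rpow_natCast]
    congr 2
    rw [hk]
    push_cast
    ring
  rw [h4, neg_mul, Real.exp_neg, ← div_eq_mul_inv, ← one_div, div_le_div_iff₀ (by positivity)
    (by positivity), one_mul]
  exact h3

/-- Every function `x P(x)` with a polynomial `P` and `x = exp (-τ²)` is the Fourier transform of an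
integrable admissible function, a combination of Gaussians. -/
theorem exists_admissible_fourier_eq (d : ℕ) (P : Polynomial ℝ) :
    ∃ w : ℝ → ℝ, IsAdmissible d w ∧ Integrable w ∧ ∀ τ, 𝓕 (fun t => (w t : ℂ)) τ =
      ((Real.exp (-τ ^ 2) * P.eval (Real.exp (-τ ^ 2)) : ℝ) : ℂ) := by
  -- the decay exponent is fixed so that sums can be treated
  suffices H : ∃ w : ℝ → ℝ, ((∀ t, w (-t) = w t) ∧
      ContDiffOn ℝ (d / 2 : ℕ) (fun s => w (√s)) (Ici 0) ∧
      ∃ C : ℝ, 0 ≤ C ∧ ∀ t, |radialDeriv (d / 2) w t| ≤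
        C * (1 + |t|) ^ (-(2 * ((d / 2 + 1 : ℕ) : ℝ)))) ∧
      Integrable w ∧ ∀ τ, 𝓕 (fun t => (w t : ℂ)) τ =
      ((Real.exp (-τ ^ 2) * P.eval (Real.exp (-τ ^ 2)) : ℝ) : ℂ) by
    obtain ⟨w, ⟨h1, h2, C, -, h3⟩, h4, h5⟩ := H
    exact ⟨w, ⟨h1, h2, C, _, by push_cast; linarith, h3⟩, h4, h5⟩
  induction P using Polynomial.induction_on' with
  | add P Q hP hQ =>
    obtain ⟨w, ⟨h1, h2, C, hC, h3⟩, h4, h5⟩ := hP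
    obtain ⟨w', ⟨h1', h2', C', hC', h3'⟩, h4', h5'⟩ := hQ
    refine ⟨fun t => w t + w' t, ⟨fun t => by simp [h1, h1'], h2.add h2', C + C', by positivity,
      fun t => ?_⟩, h4.add h4', fun τ => ?_⟩
    · have e : radialDeriv (d / 2) (fun t => w t + w' t) t =
          radialDeriv (d / 2) w t + radialDeriv (d / 2) w' t :=
        iteratedDerivWithin_add (mem_Ici.2 (sq_nonneg t)) (uniqueDiffOn_Ici 0)
          (h2 _ (mem_Ici.2 (sq_nonneg t))) (h2' _ (mem_Ici.2 (sq_nonneg t)))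
      rw [e, add_mul]
      exact (abs_add_le _ _).trans (add_le_add (h3 t) (h3' t))
    · have h4c : Integrable (fun t => (w t : ℂ)) := h4.ofReal
      have h4c' : Integrable (fun t => (w' t : ℂ)) := h4'.ofReal
      have e : 𝓕 (fun t => ((w t + w' t : ℝ) : ℂ)) τ =
          𝓕 (fun t => (w t : ℂ)) τ + 𝓕 (fun t => (w' t : ℂ)) τ := by
        simp only [Real.fourier_eq, Complex.ofReal_add, smul_add]
        exact integral_add ((Real.fourierIntegral_convergent_iff τ).2 h4c)
          ((Real.fourierIntegral_convergent_iff τ).2 h4c')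
      rw [e, h5, h5', Polynomial.eval_add]
      push_cast
      ring
  | monomial i c =>
    have hi : (0 : ℝ) < (i + 1 : ℕ) := by positivity
    -- the Gaussian with the transform `exp (-(i + 1) τ²)`
    set b : ℝ := Real.pi ^ 2 / (i + 1 : ℕ) with hb
    have hb0 : 0 < b := by positivity
    set a : ℝ := c * √(Real.pi / (i + 1 : ℕ)) with ha
    have hV : ∀ s ∈ Ici (0 : ℝ), a * Real.exp (-b * √s ^ 2) = a * Real.exp (-b * s) :=
      fun s hs => by rw [Real.sq_sqrt hs]
    have hsm : ContDiff ℝ (d / 2 : ℕ) fun s => a * Real.exp (-b * s) := by fun_prop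
    obtain ⟨C, hC, hle⟩ := exp_neg_mul_sq_le_rpow (d / 2) hb0
    refine ⟨fun t => a * Real.exp (-b * t ^ 2), ⟨fun t => by simp, hsm.contDiffOn.congr hV,
      |a * (-b) ^ (d / 2)| * C, by positivity, fun t => ?_⟩,
      (integrable_exp_neg_mul_sq hb0).const_mul a, fun τ => ?_⟩
    · rw [radialDeriv, iteratedDerivWithin_congr (f := fun s => a * Real.exp (-b * √s ^ 2)) hV
        (mem_Ici.2 (sq_nonneg t)), iteratedDerivWithin_eq_iteratedDeriv (uniqueDiffOn_Ici 0)
        hsm.contDiffAt (mem_Ici.2 (sq_nonneg t)), iteratedDeriv_const_mul_field,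
        iteratedDeriv_exp_const_mul]
      simp only
      rw [← mul_assoc, abs_mul, Real.abs_exp, mul_assoc |_|]
      exact mul_le_mul_of_nonneg_left (hle t) (abs_nonneg _)
    · have hbC : 0 < ((b : ℝ) : ℂ).re := by simpa using hb0
      have h1 := fourier_gaussian_innerProductSpace (V := ℝ) hbC τ
      have e : 𝓕 (fun t : ℝ => ((a * Real.exp (-b * t ^ 2) : ℝ) : ℂ)) τ =
          a * 𝓕 (fun t : ℝ => Complex.exp (-(b : ℂ) * (‖t‖ : ℂ) ^ 2)) τ := by
        simp only [Real.fourier_eq, Circle.smul_def, smul_eq_mul]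
        rw [← integral_const_mul]
        refine integral_congr_ae (.of_forall fun t => ?_)
        have h2 : (‖t‖ : ℂ) ^ 2 = (t : ℂ) ^ 2 := by
          rw [← Complex.ofReal_pow, Real.norm_eq_abs, sq_abs, Complex.ofReal_pow]
        simp only [h2]
        push_cast
        ring
      rw [e, h1]
      have h3 : (Real.pi : ℂ) / (b : ℂ) = (((i + 1 : ℕ) / Real.pi : ℝ) : ℂ) := by
        rw [← Complex.ofReal_div, hb]
        congr 1
        field_simp
      have h4 : -(Real.pi : ℂ) ^ 2 * (‖τ‖ : ℂ) ^ 2 / (b : ℂ) =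
          ((-((i + 1 : ℕ) * τ ^ 2) : ℝ) : ℂ) := by
        have h5 : (‖τ‖ : ℂ) ^ 2 = ((τ ^ 2 : ℝ) : ℂ) := by
          rw [← Complex.ofReal_pow, Real.norm_eq_abs, sq_abs]
        rw [h5, ← Complex.ofReal_pow, ← Complex.ofReal_neg, ← Complex.ofReal_mul,
          ← Complex.ofReal_div, hb]
        congr 1
        field_simp
      have h6 : ((Module.finrank ℝ ℝ : ℂ) / 2) = ((1 / 2 : ℝ) : ℂ) := by simp
      rw [h3, h4, h6, ← Complex.ofReal_cpow (by positivity), ← Complex.ofReal_exp,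
        ← Complex.ofReal_mul, ← Complex.ofReal_mul, ← Real.sqrt_eq_rpow, Polynomial.eval_monomial,
        ← Real.exp_nat_mul]
      congr 1
      have h7 : √(Real.pi / (i + 1 : ℕ)) * √((i + 1 : ℕ) / Real.pi) = 1 := by
        rw [← Real.sqrt_mul (by positivity), div_mul_div_comm, mul_comm Real.pi,
          div_self (by positivity), Real.sqrt_one]
      have h8 : Real.exp (-((i + 1 : ℕ) * τ ^ 2)) = Real.exp (-τ ^ 2) * Real.exp (i * -τ ^ 2) := by
        rw [← Real.exp_add]
        congr 1
        push_cast
        ring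
      rw [h8, ha]
      linear_combination (c * (Real.exp (-τ ^ 2) * Real.exp (i * -τ ^ 2))) * h7

/-- Polynomials in `exp (-τ²)` without constant term are dense in `L²` of measures on `[0, ∞)`.
Weierstrass' theorem in the variable `x = exp (-τ²) ∈ [0, 1]` is applied to `f / x`, where `f` is
continuous with compact support; the factor `x` then makes the uniform error square integrable. -/
theorem exists_polynomial_gaussian_approx {ν : Measure ℝ} [IsFiniteMeasureOnCompacts ν]
    (hν : ∀ᵐ τ ∂ν, 0 ≤ τ) (hG : MemLp (fun τ : ℝ => Real.exp (-τ ^ 2)) 2 ν) {g : ℝ → ℝ}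
    (hg : MemLp g 2 ν) {ε : ℝ} (hε : 0 < ε) : ∃ P : Polynomial ℝ,
      eLpNorm (g - fun τ => Real.exp (-τ ^ 2) * P.eval (Real.exp (-τ ^ 2))) 2 ν ≤
        ENNReal.ofReal ε := by
  obtain ⟨f, hfc, hle, hfcont, hf2⟩ := hg.exists_hasCompactSupport_eLpNorm_sub_le (by norm_num)
    (ε := ENNReal.ofReal (ε / 2)) (by simpa using hε)
  obtain ⟨R, hR⟩ := hfc.isCompact.isBounded.subset_closedBall 0
  have hzero : ∀ y, R < y → f y = 0 := by
    intro y hy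
    by_contra h
    have h1 := hR (subset_tsupport f h)
    rw [mem_closedBall_zero_iff, Real.norm_eq_abs] at h1
    linarith [le_abs_self y]
  have hF : ContinuousOn (fun x : ℝ => x⁻¹ * f √(-Real.log x)) (Icc 0 1) := by
    intro x hx
    rcases hx.1.eq_or_lt with rfl | hx0
    · have hev : (fun x : ℝ => x⁻¹ * f √(-Real.log x)) =ᶠ[𝓝[Icc 0 1] 0] fun _ => 0 := by
        have h1 : Iio (Real.exp (-(|R| + 1) ^ 2)) ∈ 𝓝[Icc (0 : ℝ) 1] 0 :=
          mem_nhdsWithin_of_mem_nhds (Iio_mem_nhds (Real.exp_pos _))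
        filter_upwards [h1, self_mem_nhdsWithin] with y hy hy1
        rcases hy1.1.eq_or_lt with rfl | hy0
        · simp
        · have h2 : Real.log y < -(|R| + 1) ^ 2 := (Real.log_lt_iff_lt_exp hy0).2 hy
          have h3 : R < √(-Real.log y) := by
            refine (le_abs_self R).trans_lt (Real.lt_sqrt_of_sq_lt ?_)
            nlinarith [abs_nonneg R]
          rw [hzero _ h3, mul_zero]
      exact (continuousWithinAt_const (b := (0 : ℝ))).congr_of_eventuallyEq hev (by simp)
    · have h1 : ContinuousAt (fun x : ℝ => x⁻¹ * f √(-Real.log x)) x :=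
        (continuousAt_inv₀ hx0.ne').mul (hfcont.continuousAt.comp
          (Real.continuous_sqrt.continuousAt.comp (Real.continuousAt_log hx0.ne').neg))
      exact h1.continuousWithinAt
  set N := (eLpNorm (fun τ : ℝ => Real.exp (-τ ^ 2)) 2 ν).toReal with hN
  have hN0 : 0 ≤ N := ENNReal.toReal_nonneg
  set δ := ε / 2 / (N + 1) with hδ
  have hδ0 : 0 < δ := by positivity
  obtain ⟨P, hP⟩ := exists_polynomial_near_of_continuousOn 0 1 _ hF δ hδ0
  refine ⟨P, ?_⟩
  have hPm : AEStronglyMeasurable (fun τ => Real.exp (-τ ^ 2) * P.eval (Real.exp (-τ ^ 2))) ν :=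
    Continuous.aestronglyMeasurable (by fun_prop)
  have h1 : eLpNorm (f - fun τ => Real.exp (-τ ^ 2) * P.eval (Real.exp (-τ ^ 2))) 2 ν ≤
      ENNReal.ofReal (ε / 2) := by
    have h2 : eLpNorm (f - fun τ => Real.exp (-τ ^ 2) * P.eval (Real.exp (-τ ^ 2))) 2 ν ≤
        eLpNorm (δ • fun τ : ℝ => Real.exp (-τ ^ 2)) 2 ν := by
      refine eLpNorm_mono_ae ?_
      filter_upwards [hν] with τ hτ
      set x := Real.exp (-τ ^ 2) with hx
      have hx0 : 0 < x := Real.exp_pos _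
      have hx1 : x ≤ 1 := Real.exp_le_one_iff.2 (by nlinarith)
      have h3 := hP x ⟨hx0.le, hx1⟩
      have h4 : √(-Real.log x) = τ := by rw [hx, Real.log_exp, neg_neg, Real.sqrt_sq hτ]
      rw [h4] at h3
      have h5 : f τ - x * P.eval x = -(x * (P.eval x - x⁻¹ * f τ)) := by
        field_simp
        ring
      simp only [Pi.sub_apply, Pi.smul_apply, smul_eq_mul, Real.norm_eq_abs, ← hx]
      rw [h5, abs_neg, abs_mul, abs_of_pos hx0, abs_of_pos (mul_pos hδ0 hx0), mul_comm x]
      exact mul_le_mul_of_nonneg_right h3.le hx0.le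
    refine h2.trans ?_
    rw [eLpNorm_const_smul, ← ENNReal.ofReal_toReal hG.2.ne, ← hN, ← ofReal_norm,
      ← ENNReal.ofReal_mul (norm_nonneg _), Real.norm_eq_abs, abs_of_pos hδ0]
    refine ENNReal.ofReal_le_ofReal ?_
    rw [hδ, div_mul_eq_mul_div]
    exact div_le_of_le_mul₀ (by positivity) (by positivity) (by nlinarith)
  have e : (g - fun τ => Real.exp (-τ ^ 2) * P.eval (Real.exp (-τ ^ 2))) =
      (g - f) + (f - fun τ => Real.exp (-τ ^ 2) * P.eval (Real.exp (-τ ^ 2))) := by abel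
  rw [e]
  refine (eLpNorm_add_le (hg.sub hf2).aestronglyMeasurable (hf2.aestronglyMeasurable.sub hPm)
    (by norm_num)).trans ((add_le_add hle h1).trans ?_)
  rw [← ENNReal.ofReal_add (by positivity) (by positivity), add_halves]

section NormMap

variable {V : Type*} [NormedAddCommGroup V] [InnerProductSpace ℝ V] [FiniteDimensional ℝ V]
  [MeasurableSpace V] [BorelSpace V]

/-- The distribution of the norm under Lebesgue measure is locally finite. -/
instance isFiniteMeasureOnCompacts_map_norm :
    IsFiniteMeasureOnCompacts ((volume : Measure V).map norm) := by
  refine ⟨fun K hK => ?_⟩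
  obtain ⟨R, hR⟩ := hK.isBounded.subset_closedBall 0
  rw [Measure.map_apply measurable_norm hK.measurableSet]
  refine (measure_mono fun x hx => ?_).trans_lt
    (isCompact_closedBall (0 : V) R).measure_lt_top
  have h1 := hR hx
  rwa [mem_closedBall_zero_iff, norm_norm, ← mem_closedBall_zero_iff] at h1

theorem memLp_gaussian : MemLp (fun x : V => Real.exp (-‖x‖ ^ 2)) 2 (volume : Measure V) := by
  have hi : Integrable fun x : V => Real.exp (-2 * ‖x‖ ^ 2) := by
    have h1 := GaussianFourier.integrable_cexp_neg_mul_sq_norm_add (V := V) (b := 2) (by simp) 0 0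
    refine h1.norm.congr (.of_forall fun x => ?_)
    simp only [zero_mul, add_zero, Complex.norm_exp]
    congr 1
    have : (-2 * (‖x‖ : ℂ) ^ 2) = ((-2 * ‖x‖ ^ 2 : ℝ) : ℂ) := by push_cast; ring
    rw [this, Complex.ofReal_re]
  rw [memLp_two_iff_integrable_sq (Continuous.aestronglyMeasurable (by fun_prop))]
  refine hi.congr (.of_forall fun x => ?_)
  simp only
  rw [← Real.exp_nat_mul]
  congr 1
  push_cast
  ring

theorem eLpNorm_map_norm {E : Type*} [NormedAddCommGroup E] {g : ℝ → E}
    (hg : AEStronglyMeasurable g ((volume : Measure V).map norm)) :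
    eLpNorm g 2 ((volume : Measure V).map norm) = eLpNorm (fun x : V => g ‖x‖) 2 volume :=
  eLpNorm_map_measure hg measurable_norm.aemeasurable

end NormMap

/-- An even function `g` and its radial extension are approximated simultaneously by the Fourier
transforms of an admissible function and of its image under `R^♯`. Both errors are errors in `L²` of
one measure on `[0, ∞)`, the sum of the distributions of `|τ|` and of `‖ξ‖`. -/
theorem exists_admissible_approx {d : ℕ} {g : ℝ → ℝ} (hgm : Measurable g)
    (hev : ∀ τ, g (-τ) = g τ) (h1 : MemLp g 2 volume)
    (h2 : MemLp (fun ξ : Space d => g ‖ξ‖) 2 volume) {ε : ℝ} (hε : 0 < ε) :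
    ∃ (w : ℝ → ℝ) (h : ℝ → ℝ), IsAdmissible d w ∧ Integrable w ∧
      (∀ τ, 𝓕 (fun t => (w t : ℂ)) τ = (h τ : ℂ)) ∧
      eLpNorm (fun τ => g τ - h τ) 2 volume ≤ ENNReal.ofReal ε ∧
      eLpNorm (fun ξ : Space d => g ‖ξ‖ - h ‖ξ‖) 2 volume ≤ ENNReal.ofReal ε := by
  set ν₁ : Measure ℝ := (volume : Measure ℝ).map norm with hν₁
  set ν₂ : Measure ℝ := (volume : Measure (Space d)).map norm with hν₂
  have habs : ∀ τ, g ‖τ‖ = g τ := fun τ => by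
    rcases abs_choice τ with h | h
    · rw [Real.norm_eq_abs, h]
    · rw [Real.norm_eq_abs, h, hev]
  have : IsFiniteMeasureOnCompacts (ν₁ + ν₂) := ⟨fun K hK => by
    rw [Measure.add_apply]
    exact ENNReal.add_lt_top.2 ⟨hK.measure_lt_top, hK.measure_lt_top⟩⟩
  have hadd : ∀ {k : ℝ → ℝ}, Measurable k → MemLp (fun τ : ℝ => k ‖τ‖) 2 volume →
      MemLp (fun ξ : Space d => k ‖ξ‖) 2 volume → MemLp k 2 (ν₁ + ν₂) := by
    intro k hk hk1 hk2
    refine ⟨hk.aestronglyMeasurable, ?_⟩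
    have h3 : MemLp k 2 ν₁ :=
      (memLp_map_measure_iff hk.aestronglyMeasurable measurable_norm.aemeasurable).2 hk1
    have h4 : MemLp k 2 ν₂ :=
      (memLp_map_measure_iff hk.aestronglyMeasurable measurable_norm.aemeasurable).2 hk2
    have h5 : eLpNorm k 2 (ν₁ + ν₂) ^ 2 < ⊤ := by
      rw [eLpNorm_two_sq, lintegral_add_measure, ← eLpNorm_two_sq, ← eLpNorm_two_sq]
      exact ENNReal.add_lt_top.2 ⟨ENNReal.pow_lt_top h3.2, ENNReal.pow_lt_top h4.2⟩
    exact (ENNReal.pow_lt_top_iff.1 h5).resolve_right two_ne_zero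
  have hpos : ∀ᵐ τ ∂(ν₁ + ν₂), 0 ≤ τ := by
    rw [ae_add_measure_iff]
    constructor
    · exact (ae_map_iff measurable_norm.aemeasurable measurableSet_Ici).2
        (.of_forall fun x => norm_nonneg x)
    · exact (ae_map_iff measurable_norm.aemeasurable measurableSet_Ici).2
        (.of_forall fun x => norm_nonneg x)
  obtain ⟨P, hP⟩ := exists_polynomial_gaussian_approx hpos
    (hadd (by fun_prop) memLp_gaussian memLp_gaussian)
    (hadd hgm (by simpa only [habs] using h1) h2) hε
  obtain ⟨w, hw1, hw2, hw3⟩ := exists_admissible_fourier_eq d P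
  set h : ℝ → ℝ := fun τ => Real.exp (-τ ^ 2) * P.eval (Real.exp (-τ ^ 2)) with hh
  have hhc : Continuous h := by fun_prop
  have hm : ∀ μ : Measure ℝ, AEStronglyMeasurable (g - h) μ := fun μ =>
    (hgm.sub hhc.measurable).aestronglyMeasurable
  refine ⟨w, h, hw1, hw2, hw3, ?_, ?_⟩
  · have e : (fun τ => g τ - h τ) = fun τ => (g - h) ‖τ‖ := funext fun τ => by
      simp only [Pi.sub_apply, hh, Real.norm_eq_abs, sq_abs]
      rw [← Real.norm_eq_abs, habs]
    rw [e, ← eLpNorm_map_norm (hm _)]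
    exact (eLpNorm_mono_measure _ (Measure.le_add_right le_rfl)).trans hP
  · rw [← eLpNorm_map_norm (g := fun τ => g τ - h τ) (hm _)]
    exact (eLpNorm_mono_measure _ (Measure.le_add_left le_rfl)).trans hP

end Gaussians

/-! ### Canonical duals and the reproducing formula in terms of symbols -/

section Symbols

theorem toReal_tsum_enorm_sq {Λ : Type*} (a : Λ → ℝ) :
    (∑' k, ‖a k‖ₑ ^ 2).toReal = ∑' k, a k ^ 2 := by
  rw [ENNReal.tsum_toReal_eq (fun k => ENNReal.pow_ne_top enorm_ne_top)]
  exact tsum_congr fun k => by simp [ENNReal.toReal_pow, sq_abs]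

theorem sum_sq_bounds {Λ : Type*} {a : Λ → ℝ} {A B : ℝ} (hB : 0 < B)
    (hl : ENNReal.ofReal A ≤ ∑' k, ‖a k‖ₑ ^ 2) (hr : ∑' k, ‖a k‖ₑ ^ 2 ≤ ENNReal.ofReal B) :
    Summable (fun k => a k ^ 2) ∧ A ≤ ∑' k, a k ^ 2 ∧ ∑' k, a k ^ 2 ≤ B := by
  have hfin : ∑' k, ‖a k‖ₑ ^ 2 ≠ ⊤ := (hr.trans_lt ENNReal.ofReal_lt_top).ne
  refine ⟨?_, ?_, ?_⟩
  · have := ENNReal.summable_toReal hfin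
    simpa [ENNReal.toReal_pow, sq_abs] using this
  · rw [← toReal_tsum_enorm_sq]
    exact (ENNReal.ofReal_le_iff_le_toReal hfin).1 hl
  · rw [← toReal_tsum_enorm_sq]
    exact ENNReal.toReal_le_of_le_ofReal hB.le hr

variable {V : Type*} [NormedAddCommGroup V] [InnerProductSpace ℝ V] [FiniteDimensional ℝ V]
  [MeasurableSpace V] [BorelSpace V] {Λ : Type*}

/-- Null sets of radii give null sets of vectors. -/
theorem ae_norm_of_ae [Nontrivial V] {P : ℝ → Prop} (h : ∀ᵐ τ : ℝ, P τ) : ∀ᵐ ξ : V, P ‖ξ‖ := by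
  set N := toMeasurable volume {τ : ℝ | ¬P τ} with hN
  have hN0 : volume N = 0 := by rw [hN, measure_toMeasurable]; exact h
  have hNm : MeasurableSet N := measurableSet_toMeasurable _ _
  set k : ℝ → ℝ := N.indicator 1 with hk
  have hk0 : ∀ᵐ τ : ℝ, k τ = 0 := by
    filter_upwards [measure_eq_zero_iff_ae_notMem.1 hN0] with τ hτ
    exact indicator_of_notMem hτ _
  have hz : (fun y : ℝ => y ^ (Module.finrank ℝ V - 1) • k y) =ᵐ[volume.restrict (Ioi 0)] 0 := by
    filter_upwards [ae_restrict_of_ae hk0] with y hy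
    simp [hy]
  have hi : Integrable (fun ξ : V => k ‖ξ‖) volume :=
    (integrable_fun_norm_addHaar volume).2 ((integrable_zero _ _ _).congr hz.symm)
  have hint : ∫ ξ : V, k ‖ξ‖ = 0 := by
    rw [integral_fun_norm_addHaar, integral_congr_ae hz]
    simp
  have hnn : 0 ≤ᵐ[volume] fun ξ : V => k ‖ξ‖ :=
    .of_forall fun ξ => indicator_nonneg (fun _ _ => zero_le_one) _
  filter_upwards [(integral_eq_zero_iff_of_nonneg_ae hnn hi).1 hint] with ξ hξ
  by_contra hP
  have hmem : ‖ξ‖ ∈ N := subset_toMeasurable _ _ hP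
  simp [hk, hmem] at hξ

/-- For a family with real symbols `a` the canonical dual has the symbols `a_λ / ∑_μ a_μ²`. -/
theorem isCanonicalDual_iff {u a w : Λ → V → ℝ}
    (ha : ∀ l ξ, 𝓕 (fun x => (u l x : ℂ)) ξ = (a l ξ : ℂ)) :
    IsCanonicalDual u w ↔ ∀ l, IsFT (fun x => (w l x : ℂ))
      fun ξ => ((a l ξ / ∑' k, a k ξ ^ 2 : ℝ) : ℂ) := by
  have e : ∀ l, (fun ξ => 𝓕 (fun x => (u l x : ℂ)) ξ /
      ((∑' k, ‖𝓕 (fun x => (u k x : ℂ)) ξ‖ ^ 2 : ℝ) : ℂ)) =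
      fun ξ => ((a l ξ / ∑' k, a k ξ ^ 2 : ℝ) : ℂ) := fun l => by
    ext ξ
    simp only [ha, Complex.norm_real, Real.norm_eq_abs, sq_abs, Complex.ofReal_div]
  simp only [← e]
  rfl

theorem measurable_tsum_sq {α : Type*} [MeasurableSpace α] [Countable Λ] {a : Λ → α → ℝ}
    (ha : ∀ l, Measurable (a l)) : Measurable fun ξ => ∑' k, a k ξ ^ 2 := by
  simp_rw [← toReal_tsum_enorm_sq]
  exact (Measurable.tsum fun l => ((ha l).enorm.pow_const 2)).ennreal_toReal

theorem memLp_dualSymbol [Countable Λ] {a : Λ → V → ℝ} {A B : ℝ} (hA : 0 < A) (hB : 0 < B)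
    (ham : ∀ l, Measurable (a l))
    (hl : ∀ᵐ ξ : V, ENNReal.ofReal A ≤ ∑' l, ‖a l ξ‖ₑ ^ 2)
    (hr : ∀ᵐ ξ : V, ∑' l, ‖a l ξ‖ₑ ^ 2 ≤ ENNReal.ofReal B) {l : Λ}
    (h2 : MemLp (a l) 2 volume) : MemLp (fun ξ => a l ξ / ∑' k, a k ξ ^ 2) 2 volume := by
  refine (h2.const_mul A⁻¹).of_le ((ham l).div (measurable_tsum_sq ham)).aestronglyMeasurable ?_
  filter_upwards [hl, hr] with ξ h1 h2
  obtain ⟨-, h3, -⟩ := sum_sq_bounds hB h1 h2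
  rw [norm_div, norm_mul, norm_inv, div_eq_inv_mul, Real.norm_of_nonneg hA.le,
    Real.norm_of_nonneg (hA.le.trans h3)]
  gcongr

theorem exists_isCanonicalDual [Countable Λ] {u a : Λ → V → ℝ}
    (ha : ∀ l ξ, 𝓕 (fun x => (u l x : ℂ)) ξ = (a l ξ : ℂ)) {A B : ℝ} (hA : 0 < A) (hB : 0 < B)
    (ham : ∀ l, Measurable (a l)) (hev : ∀ l ξ, a l (-ξ) = a l ξ)
    (hl : ∀ᵐ ξ : V, ENNReal.ofReal A ≤ ∑' l, ‖a l ξ‖ₑ ^ 2)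
    (hr : ∀ᵐ ξ : V, ∑' l, ‖a l ξ‖ₑ ^ 2 ≤ ENNReal.ofReal B)
    (h2 : ∀ l, MemLp (a l) 2 volume) : ∃ w, IsCanonicalDual u w := by
  have h : ∀ l, ∃ w : V → ℝ, IsFT (fun x => (w x : ℂ))
      fun ξ => ((a l ξ / ∑' k, a k ξ ^ 2 : ℝ) : ℂ) := fun l =>
    exists_real_isFT (memLp_ofReal_iff.2 (memLp_dualSymbol hA hB ham hl hr (h2 l)))
      fun ξ => by rw [Complex.conj_ofReal]; simp only [hev]
  choose w hw using h
  exact ⟨w, (isCanonicalDual_iff ha).2 hw⟩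

theorem hasFrameBounds_dual [Countable Λ] {w a : Λ → V → ℝ}
    (hw : ∀ l, IsFT (fun x => (w l x : ℂ)) fun ξ => ((a l ξ / ∑' k, a k ξ ^ 2 : ℝ) : ℂ))
    {A B : ℝ} (hA : 0 < A) (hB : 0 < B)
    (hl : ∀ᵐ ξ : V, ENNReal.ofReal A ≤ ∑' l, ‖a l ξ‖ₑ ^ 2)
    (hr : ∀ᵐ ξ : V, ∑' l, ‖a l ξ‖ₑ ^ 2 ≤ ENNReal.ofReal B) : HasFrameBounds w := by
  have key : ∀ᵐ ξ : V, ENNReal.ofReal B⁻¹ ≤ ∑' l, ‖a l ξ / ∑' k, a k ξ ^ 2‖ₑ ^ 2 ∧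
      ∑' l, ‖a l ξ / ∑' k, a k ξ ^ 2‖ₑ ^ 2 ≤ ENNReal.ofReal A⁻¹ := by
    filter_upwards [hl, hr] with ξ h1 h2
    obtain ⟨hs, h3, h4⟩ := sum_sq_bounds hB h1 h2
    set σ := ∑' k, a k ξ ^ 2 with hσ
    have hσ0 : 0 < σ := hA.trans_le h3
    -- the squares of the dual symbols sum up to `1 / σ`
    have e : ∑' l, ‖a l ξ / σ‖ₑ ^ 2 = ENNReal.ofReal σ⁻¹ := by
      have h5 : HasSum (fun l => (a l ξ / σ) ^ 2) σ⁻¹ := by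
        have h6 := hs.hasSum.div_const (σ ^ 2)
        rw [← hσ] at h6
        simp only [div_pow]
        rwa [sq σ, div_mul_cancel_right₀ hσ0.ne', ← sq] at h6
      rw [← h5.tsum_eq, ENNReal.ofReal_tsum_of_nonneg (fun l => sq_nonneg _) h5.summable]
      refine tsum_congr fun l => ?_
      rw [Real.enorm_eq_ofReal_abs, ← ENNReal.ofReal_pow (abs_nonneg _), sq_abs]
    rw [e]
    exact ⟨ENNReal.ofReal_le_ofReal (inv_anti₀ hσ0 h4), ENNReal.ofReal_le_ofReal (inv_anti₀ hA h3)⟩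
  exact hasFrameBounds_of_symbol hw (inv_pos.2 hB) (inv_pos.2 hA) (key.mono fun _ h => h.1)
    (key.mono fun _ h => h.2)

theorem IsFT.sub_sum {f : V → ℂ} {b : V → ℂ} (hf : IsFT f b) {g c : Λ → V → ℂ}
    (h : ∀ l, IsFT (g l) (c l)) (s : Finset Λ) :
    IsFT (fun x => f x - ∑ l ∈ s, g l x) (fun ξ => b ξ - ∑ l ∈ s, c l ξ) := by
  classical
  induction s using Finset.induction_on with
  | empty => simpa using hf
  | insert i s hi ih =>
    have h1 := ih.sub (h i)
    refine h1.congr (.of_forall fun x => ?_) (.of_forall fun x => ?_) <;>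
    · simp only [Pi.sub_apply, Finset.sum_insert hi]
      ring

/-- The reproducing formula: the symbols `a_λ² / ∑_μ a_μ²` sum up to one, and the partial sums are
dominated by one. -/
theorem hasL2Sum_dual [Countable Λ] {u w a : Λ → V → ℝ}
    (hu : ∀ l, IsFT (fun x => (u l x : ℂ)) fun ξ => (a l ξ : ℂ))
    (hw : ∀ l, IsFT (fun x => (w l x : ℂ)) fun ξ => ((a l ξ / ∑' k, a k ξ ^ 2 : ℝ) : ℂ))
    {A B : ℝ} (hA : 0 < A) (hB : 0 < B)
    (hl : ∀ᵐ ξ : V, ENNReal.ofReal A ≤ ∑' l, ‖a l ξ‖ₑ ^ 2)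
    (hr : ∀ᵐ ξ : V, ∑' l, ‖a l ξ‖ₑ ^ 2 ≤ ENNReal.ofReal B)
    (hC : ∀ l, ∃ C : ℝ, ∀ ξ : V, |a l ξ| ≤ C) {f : V → ℝ} (hf : MemLp f 2 volume) :
    HasL2Sum (fun l => conv (w l) (conv (u l) f)) f := by
  obtain ⟨b, hb⟩ := exists_isFT (memLp_ofReal_iff.2 hf)
  have h1 : ∀ l, IsFT (fun x => (conv (w l) (conv (u l) f) x : ℂ))
      (fun ξ => ((a l ξ / ∑' k, a k ξ ^ 2 : ℝ) : ℂ) * ((a l ξ : ℂ) * b ξ)) := fun l => by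
    obtain ⟨C, hC⟩ := hC l
    have h2 := (hu l).conv hb (C := C) (.of_forall fun ξ => by simpa using hC ξ)
    refine (hw l).conv h2 (C := A⁻¹ * C) ?_
    filter_upwards [hl, hr] with ξ h1 h2
    obtain ⟨-, h3, -⟩ := sum_sq_bounds hB h1 h2
    rw [Complex.norm_real, norm_div, div_eq_inv_mul, Real.norm_of_nonneg (hA.le.trans h3)]
    exact mul_le_mul (inv_anti₀ hA h3) (hC ξ) (norm_nonneg _) (by positivity)
  refine ⟨fun l => memLp_ofReal_iff.1 (h1 l).memLp_left, hf, ?_⟩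
  have h2 : ∀ s : Finset Λ,
      eLpNorm (fun x => f x - ∑ l ∈ s, conv (w l) (conv (u l) f) x) 2 volume ^ 2 =
      ∫⁻ ξ, ‖b ξ - ∑ l ∈ s, ((a l ξ / ∑' k, a k ξ ^ 2 : ℝ) : ℂ) * ((a l ξ : ℂ) * b ξ)‖ₑ ^ 2 := by
    intro s
    have h3 := hb.sub_sum h1 s
    rw [← eLpNorm_two_sq, h3.eLpNorm_eq, ← eLpNorm_ofReal]
    congr 2
    ext x
    push_cast
    rfl
  have hlim : Tendsto (fun s : Finset Λ => ∫⁻ ξ, ‖b ξ - ∑ l ∈ s,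
      ((a l ξ / ∑' k, a k ξ ^ 2 : ℝ) : ℂ) * ((a l ξ : ℂ) * b ξ)‖ₑ ^ 2) atTop (𝓝 (∫⁻ _ : V, 0)) := by
    have hsum : ∀ (s : Finset Λ) (ξ : V), ∑ l ∈ s,
        ((a l ξ / ∑' k, a k ξ ^ 2 : ℝ) : ℂ) * ((a l ξ : ℂ) * b ξ) =
        (((∑ l ∈ s, a l ξ ^ 2) / ∑' k, a k ξ ^ 2 : ℝ) : ℂ) * b ξ := by
      intro s ξ
      rw [Finset.sum_div, Complex.ofReal_sum, Finset.sum_mul]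
      refine Finset.sum_congr rfl fun l _ => ?_
      push_cast
      ring
    refine tendsto_lintegral_filter_of_dominated_convergence' (fun ξ => ‖b ξ‖ₑ ^ 2)
      (.of_forall fun s => ((hb.sub_sum h1 s).memLp_right.aestronglyMeasurable.enorm.pow_const 2))
      (.of_forall fun s => ?_) ?_ ?_
    · filter_upwards [hl, hr] with ξ h1 h2
      obtain ⟨hs, h3, -⟩ := sum_sq_bounds hB h1 h2
      have hσ0 : 0 < ∑' k, a k ξ ^ 2 := hA.trans_le h3
      have h4 : (∑ l ∈ s, a l ξ ^ 2) / ∑' k, a k ξ ^ 2 ≤ 1 :=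
        (div_le_one hσ0).2 (hs.sum_le_tsum s fun _ _ => sq_nonneg _)
      have h5 : 0 ≤ (∑ l ∈ s, a l ξ ^ 2) / ∑' k, a k ξ ^ 2 :=
        div_nonneg (Finset.sum_nonneg fun _ _ => sq_nonneg _) hσ0.le
      rw [hsum, ← one_sub_mul, ← Complex.ofReal_one, ← Complex.ofReal_sub]
      refine pow_le_pow_left' ?_ 2
      rw [← ofReal_norm, ← ofReal_norm, norm_mul, Complex.norm_real]
      refine ENNReal.ofReal_le_ofReal (mul_le_of_le_one_left (norm_nonneg _) ?_)
      rw [Real.norm_eq_abs, abs_le]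
      constructor <;> linarith
    · rw [← eLpNorm_two_sq]
      exact ENNReal.pow_ne_top hb.memLp_right.2.ne
    · filter_upwards [hl, hr] with ξ h1 h2
      obtain ⟨hs, h3, -⟩ := sum_sq_bounds hB h1 h2
      have hσ0 : 0 < ∑' k, a k ξ ^ 2 := hA.trans_le h3
      simp only [hsum]
      have h4 : Tendsto (fun s : Finset Λ => b ξ -
          (((∑ l ∈ s, a l ξ ^ 2) / ∑' k, a k ξ ^ 2 : ℝ) : ℂ) * b ξ) atTop
          (𝓝 (b ξ - (1 : ℝ) * b ξ)) := by
        have h5 : Tendsto (fun s : Finset Λ => (∑ l ∈ s, a l ξ ^ 2) / ∑' k, a k ξ ^ 2)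
            atTop (𝓝 1) := by
          have h6 := (show Tendsto (fun s : Finset Λ => ∑ l ∈ s, a l ξ ^ 2) atTop _ from
            hs.hasSum).div_const (∑' k, a k ξ ^ 2)
          rwa [div_self hσ0.ne'] at h6
        exact ((((Complex.continuous_ofReal.tendsto 1).comp h5)).mul_const _).const_sub _
      have h7 := (ENNReal.continuous_pow 2).tendsto _ |>.comp ((continuous_enorm.tendsto _).comp h4)
      simpa [Function.comp_def] using h7
  rw [lintegral_zero] at hlim
  simp_rw [← h2] at hlim
  have h5 := ((ENNReal.continuous_rpow_const (y := 1 / 2)).tendsto _).comp hlim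
  have h6 : ∀ x : ℝ≥0∞, (x ^ 2) ^ (1 / 2 : ℝ) = x := fun x => by
    rw [← ENNReal.rpow_natCast, ← ENNReal.rpow_mul]; simp
  simpa only [Function.comp_def, h6, ENNReal.zero_rpow_of_pos (one_half_pos (α := ℝ))] using h5

end Symbols

/-! ### Time convolution of wave data -/

section TimeConvolution

/-- The cosine transform over `ℝ`. For an even integrable `v` it is the Fourier transform of `v`, as
a real function (`fourier_eq_cosTransform`). -/
def cosTransform (v : ℝ → ℝ) (τ : ℝ) : ℝ :=
  ∫ s, v s * Real.cos (2 * Real.pi * τ * s)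

theorem cosTransform_neg (v : ℝ → ℝ) (τ : ℝ) : cosTransform v (-τ) = cosTransform v τ := by
  simp only [cosTransform, mul_neg, neg_mul, Real.cos_neg]

theorem abs_cosTransform_le {v : ℝ → ℝ} (hv : Integrable v) (τ : ℝ) :
    |cosTransform v τ| ≤ ∫ s, |v s| := by
  rw [cosTransform, ← Real.norm_eq_abs]
  refine norm_integral_le_of_norm_le hv.norm (.of_forall fun s => ?_)
  rw [norm_mul]
  exact mul_le_of_le_one_right (norm_nonneg _) (Real.abs_cos_le_one _)

theorem integrable_mul_cos {v : ℝ → ℝ} (hv : Integrable v) (a : ℝ) :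
    Integrable fun s => v s * Real.cos (a * s) :=
  hv.mul_bdd (c := 1) (Continuous.aestronglyMeasurable (by fun_prop))
    (.of_forall fun s => Real.abs_cos_le_one _)

theorem integrable_mul_sin {v : ℝ → ℝ} (hv : Integrable v) (a : ℝ) :
    Integrable fun s => v s * Real.sin (a * s) :=
  hv.mul_bdd (c := 1) (Continuous.aestronglyMeasurable (by fun_prop))
    (.of_forall fun s => Real.abs_sin_le_one _)

theorem integral_mul_sin_eq_zero {v : ℝ → ℝ} (hev : ∀ t, v (-t) = v t) (a : ℝ) :
    ∫ s, v s * Real.sin (a * s) = 0 := by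
  have h := integral_neg_eq_self (fun s => v s * Real.sin (a * s)) (volume : Measure ℝ)
  simp only [hev, mul_neg, Real.sin_neg, integral_neg] at h
  linarith

theorem fourier_eq_cosTransform {v : ℝ → ℝ} (hv : Integrable v) (hev : ∀ t, v (-t) = v t)
    (τ : ℝ) : 𝓕 (fun t => (v t : ℂ)) τ = (cosTransform v τ : ℂ) := by
  rw [Real.fourier_real_eq_integral_exp_smul]
  have e : ∀ s : ℝ, Complex.exp (((-2 * Real.pi * s * τ : ℝ) : ℂ) * Complex.I) • (v s : ℂ) =
      ((v s * Real.cos (2 * Real.pi * τ * s) : ℝ) : ℂ) -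
        Complex.I * ((v s * Real.sin (2 * Real.pi * τ * s) : ℝ) : ℂ) := by
    intro s
    have h : -2 * Real.pi * s * τ = -(2 * Real.pi * τ * s) := by ring
    rw [h, Complex.exp_mul_I, ← Complex.ofReal_cos, ← Complex.ofReal_sin, Real.cos_neg,
      Real.sin_neg, smul_eq_mul]
    push_cast
    ring
  simp_rw [e]
  rw [integral_sub (integrable_mul_cos hv _).ofReal ((integrable_mul_sin hv _).ofReal.const_mul _),
    integral_const_mul, integral_complex_ofReal, integral_complex_ofReal,
    integral_mul_sin_eq_zero hev]
  simp [cosTransform]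

theorem continuous_cosTransform {v : ℝ → ℝ} (hv : Integrable v) (hev : ∀ t, v (-t) = v t) :
    Continuous (cosTransform v) := by
  have h : Continuous (𝓕 fun t => (v t : ℂ)) :=
    VectorFourier.fourierIntegral_continuous Real.continuous_fourierChar continuous_inner hv.ofReal
  refine (Complex.continuous_re.comp h).congr fun τ => ?_
  rw [Function.comp_apply, fourier_eq_cosTransform hv hev, Complex.ofReal_re]

theorem integral_mul_cos_sub {v : ℝ → ℝ} (hv : Integrable v) (hev : ∀ t, v (-t) = v t)
    (τ t : ℝ) : ∫ s, v s * Real.cos (2 * Real.pi * τ * (t - s)) =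
      Real.cos (2 * Real.pi * τ * t) * cosTransform v τ := by
  have e : ∀ s, v s * Real.cos (2 * Real.pi * τ * (t - s)) =
      Real.cos (2 * Real.pi * τ * t) * (v s * Real.cos (2 * Real.pi * τ * s)) +
      Real.sin (2 * Real.pi * τ * t) * (v s * Real.sin (2 * Real.pi * τ * s)) := by
    intro s
    rw [mul_sub, Real.cos_sub]
    ring
  simp_rw [e]
  rw [integral_add ((integrable_mul_cos hv _).const_mul _) ((integrable_mul_sin hv _).const_mul _),
    integral_const_mul, integral_const_mul, integral_mul_sin_eq_zero hev, mul_zero, add_zero,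
    cosTransform]

variable {V : Type*} [NormedAddCommGroup V] [InnerProductSpace ℝ V] [FiniteDimensional ℝ V]
  [MeasurableSpace V] [BorelSpace V] {b : V → ℂ}

/-- In frequency space, convolution in time with an even function `v` is multiplication by the
radial symbol `cosTransform v ‖ξ‖`. -/
theorem integral_mul_waveInt (hb : Integrable b) {v : ℝ → ℝ} (hv : Integrable v)
    (hev : ∀ t, v (-t) = v t) (x : V) (t : ℝ) :
    ∫ s, (v s : ℂ) * waveInt b x (t - s) =
      waveInt (fun ξ => (cosTransform v ‖ξ‖ : ℂ) * b ξ) x t := by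
  have hc := Real.continuous_fourierChar
  set k : ℝ → V → ℂ := fun s ξ => (Real.fourierChar (inner ℝ ξ x) : ℂ) *
    (Real.cos (2 * Real.pi * ‖ξ‖ * (t - s)) : ℂ) with hk
  have hi : Integrable (fun p : ℝ × V => k p.1 p.2 * ((v p.1 : ℂ) * b p.2))
      (volume.prod volume) := by
    refine (Integrable.mul_prod (f := fun s => (v s : ℂ)) hv.ofReal hb).bdd_mul (c := 1)
      (Continuous.aestronglyMeasurable (by fun_prop)) (.of_forall fun p => ?_)
    rw [hk, norm_mul, Circle.norm_coe, one_mul, Complex.norm_real]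
    exact Real.abs_cos_le_one _
  calc ∫ s, (v s : ℂ) * waveInt b x (t - s)
      = ∫ s, ∫ ξ, k s ξ * ((v s : ℂ) * b ξ) := by
        refine integral_congr_ae (.of_forall fun s => ?_)
        simp only [waveInt, Real.fourierInv_eq]
        rw [← integral_const_mul]
        refine integral_congr_ae (.of_forall fun ξ => ?_)
        simp only [hk, Circle.smul_def, smul_eq_mul]
        ring
    _ = ∫ ξ, ∫ s, k s ξ * ((v s : ℂ) * b ξ) := integral_integral_swap hi
    _ = _ := by
        rw [waveInt, Real.fourierInv_eq]
        refine integral_congr_ae (.of_forall fun ξ => ?_)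
        have e : ∀ s, k s ξ * ((v s : ℂ) * b ξ) = (Real.fourierChar (inner ℝ ξ x) : ℂ) * b ξ *
            ((v s * Real.cos (2 * Real.pi * ‖ξ‖ * (t - s)) : ℝ) : ℂ) := by
          intro s
          simp only [hk]
          push_cast
          ring
        simp only [e]
        rw [integral_const_mul, integral_complex_ofReal, integral_mul_cos_sub hv hev]
        simp only [Circle.smul_def, smul_eq_mul]
        push_cast
        ring

theorem integrable_mul_waveInt (hb : Continuous b)
    (hi : ∀ k : ℕ, Integrable fun ξ => ‖ξ‖ ^ k * ‖b ξ‖) {v : ℝ → ℝ} (hv : Integrable v)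
    (x : V) (t : ℝ) : Integrable fun s => (v s : ℂ) * waveInt b x (t - s) := by
  have hp : Continuous fun s : ℝ => (x, t - s) := by fun_prop
  have hc := (contDiff_waveInt hb hi).continuous.comp hp
  simp only [Function.comp_def] at hc
  have hvc : Integrable fun s => (v s : ℂ) := hv.ofReal
  exact hvc.mul_bdd (c := ∫ ξ, ‖b ξ‖) hc.aestronglyMeasurable
    (.of_forall fun s => norm_waveInt_le (integrable_of_moments hb hi) x _)

end TimeConvolution

section Data

variable {d : ℕ} {f : Space d → ℝ}

theorem waveOp_eq_waveInt {b : Space d → ℂ} (hb : Continuous b)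
    (hi : ∀ k : ℕ, Integrable fun ξ => ‖ξ‖ ^ k * ‖b ξ‖) (hf : ∀ x, (𝓕⁻ b x).re = f x)
    (S : Set (Space d)) : waveOp S f = fun (x : S) t => (waveInt b (x : Space d) t).re := by
  ext x t
  rw [waveOp, (isPressure_waveInt hb hi hf).pressure_eq x (abs_nonneg t)]
  rcases abs_choice t with h | h <;> rw [h]
  rw [waveInt_neg]

/-- Test functions have Fourier transforms with integrable moments. -/
theorem testFunction_symbol (hs : ContDiff ℝ ∞ f) (hc : HasCompactSupport f) :
    Continuous (𝓕 fun x => (f x : ℂ)) ∧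
    (∀ k : ℕ, Integrable fun ξ => ‖ξ‖ ^ k * ‖𝓕 (fun x => (f x : ℂ)) ξ‖) ∧
    (∀ x, 𝓕⁻ (𝓕 fun x => (f x : ℂ)) x = (f x : ℂ)) ∧
    IsFT (fun x => (f x : ℂ)) (𝓕 fun x => (f x : ℂ)) := by
  have hs' : ContDiff ℝ ∞ fun x => (f x : ℂ) := Complex.ofRealCLM.contDiff.comp hs
  have hc' : HasCompactSupport fun x => (f x : ℂ) := hc.comp_left Complex.ofReal_zero
  set φ : SchwartzMap (Space d) ℂ := hc'.toSchwartzMap hs' with hφ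
  have e : (𝓕 fun x => (f x : ℂ)) = (𝓕 φ : SchwartzMap (Space d) ℂ) := rfl
  have hi : Integrable fun x => (f x : ℂ) := φ.integrable
  refine ⟨by rw [e]; exact (𝓕 φ).continuous, fun k => by
    rw [e]; exact (𝓕 φ).integrable_pow_mul volume k, fun x => ?_, isFT_fourier hi (φ.memLp 2 _)⟩
  rw [hs'.continuous.fourierInv_fourier_eq hi (by rw [e]; exact (𝓕 φ).integrable)]

theorem isPressure_testFunction (hs : ContDiff ℝ ∞ f) (hc : HasCompactSupport f) :
    IsPressure f (pressure f) := by
  obtain ⟨hb, hi, hinv, -⟩ := testFunction_symbol hs hc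
  exact (isPressure_waveInt hb hi fun x => by rw [hinv, Complex.ofReal_re]).isPressure_pressure

variable {v : ℝ → ℝ} {u : Space d → ℝ}

/-- The convolution of a test function with a function whose symbol is `cosTransform v ‖ξ‖` is an
initial value for which the wave equation has a smooth solution, and its wave data are the time
convolutions with `v` of those of the test function. -/
theorem wave_conv (hv : Integrable v) (hev : ∀ t, v (-t) = v t)
    (hu : IsFT (fun x => (u x : ℂ)) fun ξ => (cosTransform v ‖ξ‖ : ℂ)) (hs : ContDiff ℝ ∞ f)
    (hc : HasCompactSupport f) (S : Set (Space d)) :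
    IsPressure (conv u f) (pressure (conv u f)) ∧
    (∀ x : S, ConvolutionExists v (waveOp S f x) (ContinuousLinearMap.lsmul ℝ ℝ) volume) ∧
    waveOp S (conv u f) = timeConv v (waveOp S f) := by
  obtain ⟨hb, hi, hinv, hft⟩ := testFunction_symbol hs hc
  set b : Space d → ℂ := 𝓕 fun x => (f x : ℂ) with hbdef
  have hf : ∀ x, (𝓕⁻ b x).re = f x := fun x => by rw [hinv, Complex.ofReal_re]
  set c : Space d → ℂ := fun ξ => (cosTransform v ‖ξ‖ : ℂ) * b ξ with hcdef
  have hcos := continuous_cosTransform hv hev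
  have hcc : Continuous c := by fun_prop
  have hci : ∀ k : ℕ, Integrable fun ξ => ‖ξ‖ ^ k * ‖c ξ‖ := fun k => by
    refine ((hi k).const_mul (∫ s, |v s|)).mono'
      (Continuous.aestronglyMeasurable (by fun_prop)) (.of_forall fun ξ => ?_)
    rw [norm_mul, norm_norm, norm_pow, norm_norm, hcdef, norm_mul, Complex.norm_real,
      mul_left_comm]
    exact mul_le_mul_of_nonneg_right (abs_cosTransform_le hv _) (by positivity)
  have hcf : ∀ x, (𝓕⁻ c x).re = conv u f x := fun x => by
    rw [← conv_eq_fourierInv hu hft, Complex.ofReal_re]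
  have e : ∀ (x : S) (t s : ℝ), ContinuousLinearMap.lsmul ℝ ℝ (v s) (waveOp S f x (t - s)) =
      ((v s : ℂ) * waveInt b x (t - s)).re := fun x t s => by
    rw [waveOp_eq_waveInt hb hi hf, Complex.re_ofReal_mul]
    rfl
  refine ⟨(isPressure_waveInt hcc hci hcf).isPressure_pressure, fun x t => ?_, ?_⟩
  · simp only [ConvolutionExistsAt, e]
    exact (integrable_mul_waveInt hb hi hv x t).re
  · rw [waveOp_eq_waveInt hcc hci hcf]
    ext x t
    rw [timeConv, conv, convolution_def]
    simp only [e]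
    rw [← integral_mul_waveInt (integrable_of_moments hb hi) hv hev]
    exact (integral_re (integrable_mul_waveInt hb hi hv x t)).symm

end Data

/-! ### Transfer of frames and canonical duals -/

section Transfer

variable {d : ℕ}

/-- The two Fourier transforms of an admissible function and of its image under `R^♯`. -/
theorem IsAdmissible.isFT {v : ℝ → ℝ} (hv : IsAdmissible d v) (hi : Integrable v) :
    IsFT (fun t => (v t : ℂ)) (fun τ => (cosTransform v τ : ℂ)) ∧
    IsFT (fun x => (RSharp d v x : ℂ)) (fun ξ => (cosTransform v ‖ξ‖ : ℂ)) := by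
  have h1 : MemLp v 1 volume := memLp_one_iff_integrable.2 hi
  have hF := fourier_eq_cosTransform hi hv.even
  obtain ⟨h3, h4, h5⟩ := hv.fourier_RSharp one_ne_zero ENNReal.one_ne_top h1
  constructor
  · have h := isFT_fourier (hi.ofReal (𝕜 := ℂ))
      (memLp_ofReal_iff.2 (hv.memLp_two_of_memLp one_ne_zero ENNReal.one_ne_top h1))
    exact h.congr Filter.EventuallyEq.rfl (.of_forall hF)
  · have h := isFT_fourier (h3.ofReal (𝕜 := ℂ)) (memLp_ofReal_iff.2 h4)
    exact h.congr Filter.EventuallyEq.rfl (.of_forall fun ξ => (h5 ξ).trans (hF _))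

/-- By Plancherel's theorem `u = R^♯ v` holds in the `L²` sense as soon as the transform of `u` is
the radial extension of that of `v`. -/
theorem isRSharpL2_of_isFT {v : ℝ → ℝ} {u : Space d → ℝ} {g : ℝ → ℝ} (hgm : Measurable g)
    (hev : ∀ τ, g (-τ) = g τ) (hv : IsFT (fun t => (v t : ℂ)) fun τ => (g τ : ℂ))
    (hu : IsFT (fun x => (u x : ℂ)) fun ξ => (g ‖ξ‖ : ℂ)) : IsRSharpL2 d v u := by
  refine ⟨memLp_ofReal_iff.1 hv.memLp_left, memLp_ofReal_iff.1 hu.memLp_left, fun ε hε => ?_⟩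
  obtain ⟨w, h, hw, hwi, hwF, h1, h2⟩ := exists_admissible_approx (d := d) hgm hev
    (memLp_ofReal_iff.1 hv.memLp_right) (memLp_ofReal_iff.1 hu.memLp_right) hε
  have hh : ∀ τ, cosTransform w τ = h τ := fun τ => by
    have := (fourier_eq_cosTransform hwi hw.even τ).symm.trans (hwF τ)
    exact_mod_cast this
  obtain ⟨h3, h4⟩ := hw.isFT hwi
  simp only [hh] at h3 h4
  refine ⟨w, hw, memLp_ofReal_iff.1 h3.memLp_left, memLp_ofReal_iff.1 h4.memLp_left, ?_, ?_⟩
  · refine le_trans (le_of_eq ?_) h1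
    rw [← eLpNorm_ofReal, ← eLpNorm_ofReal 2 fun τ => g τ - h τ]
    have := (hv.sub h3).eLpNorm_eq.symm
    simpa only [Pi.sub_def, Complex.ofReal_sub] using this
  · refine le_trans (le_of_eq ?_) h2
    rw [← eLpNorm_ofReal, ← eLpNorm_ofReal 2 fun ξ : Space d => g ‖ξ‖ - h ‖ξ‖]
    have := (hu.sub h4).eLpNorm_eq.symm
    simpa only [Pi.sub_def, Complex.ofReal_sub] using this

/-- An admissible function with symbol `g` is mapped by `R^♯` to a function with symbol `g ‖ξ‖`. -/
theorem RSharp_ae_eq_of_isFT [Nontrivial (Space d)] {v w : ℝ → ℝ} {u : Space d → ℝ} {g : ℝ → ℝ}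
    (hv : IsFT (fun t => (v t : ℂ)) fun τ => (g τ : ℂ))
    (hu : IsFT (fun x => (u x : ℂ)) fun ξ => (g ‖ξ‖ : ℂ)) (hw : IsAdmissible d w)
    (hvw : v =ᵐ[volume] w) : u =ᵐ[volume] RSharp d w := by
  have h2 : MemLp w 2 volume := (memLp_congr_ae hvw).1 (memLp_ofReal_iff.1 hv.memLp_left)
  obtain ⟨h3, h4⟩ := hw.isFT (hw.integrable_of_memLp two_ne_zero ENNReal.ofNat_ne_top h2)
  have h5 : IsFT (fun t => (w t : ℂ)) fun τ => (g τ : ℂ) :=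
    hv.congr (hvw.mono fun t ht => by simp only [ht]) Filter.EventuallyEq.rfl
  have h6 := ae_norm_of_ae (V := Space d) (h3.right_unique h5)
  filter_upwards [hu.left_unique (h4.congr Filter.EventuallyEq.rfl h6)] with x hx
  exact_mod_cast hx

end Transfer

end PAT

end

theorem theorem3p4 (d : ℕ) (hd : 1 ≤ d) {Λ : Type*} [Countable Λ] (S : Set (PAT.Space d))
    (v : Λ → ℝ → ℝ) (hv : PAT.IsConvFrame v) (hadm : ∀ l, PAT.IsAdmissible d (v l))
    (u : Λ → PAT.Space d → ℝ) (hu : ∀ l, u l = PAT.RSharp d (v l)) :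
    -- the pair is a convolution factorization
    PAT.IsConvFactorization S u v ∧
    -- the canonical duals exist
    (∃ vp : Λ → ℝ → ℝ, PAT.IsCanonicalDual v vp) ∧
    (∃ up : Λ → PAT.Space d → ℝ, PAT.IsCanonicalDual u up) ∧
    ∀ (vp : Λ → ℝ → ℝ) (up : Λ → PAT.Space d → ℝ),
      PAT.IsCanonicalDual v vp → PAT.IsCanonicalDual u up →
      -- the canonical dual of `u` is the image under `R^♯` of the canonical dual of `v`
      PAT.HasFrameBounds up ∧
      (∀ l, PAT.IsRSharpL2 d (vp l) (up l)) ∧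
      (∀ l, ∀ w : ℝ → ℝ, PAT.IsAdmissible d w → vp l =ᵐ[volume] w →
        up l =ᵐ[volume] PAT.RSharp d w) ∧
      -- reproducing formula, equation for the factors, and recovery from the data
      ∀ f : PAT.Space d → ℝ, ContDiff ℝ ∞ f → HasCompactSupport f →
        PAT.HasL2Sum (fun l => PAT.conv (up l) (PAT.conv (u l) f)) f ∧
        PAT.IsPressure f (PAT.pressure f) ∧
        (∀ l, PAT.IsPressure (PAT.conv (u l) f) (PAT.pressure (PAT.conv (u l) f))) ∧
        (∀ l, PAT.waveOp S (PAT.conv (u l) f) = PAT.timeConv (v l) (PAT.waveOp S f)) ∧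
        ∀ X : Set (PAT.Space d → ℝ), (∀ l, PAT.conv (u l) f ∈ X) → InjOn (PAT.waveOp S) X →
          ∀ g : Λ → PAT.Space d → ℝ,
            (∀ l, g l ∈ X ∧ PAT.waveOp S (g l) = PAT.timeConv (v l) (PAT.waveOp S f)) →
            PAT.HasL2Sum (fun l => PAT.conv (up l) (g l)) f := by
  open PAT in
  -- in dimension zero the radial transfer of null sets would fail
  have hd0 : Nonempty (Fin d) := ⟨⟨0, hd⟩⟩
  have hvi : ∀ l, Integrable (v l) := fun l => memLp_one_iff_integrable.1 (hv.memL1 l)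
  obtain rfl : u = fun l => RSharp d (v l) := funext hu
  have hft := fun l => (hadm l).isFT (hvi l)
  set a : Λ → ℝ → ℝ := fun l => cosTransform (v l) with ha
  have hRi := fun l => (hadm l).fourier_RSharp one_ne_zero ENNReal.one_ne_top (hv.memL1 l)
  have hFv : ∀ l τ, 𝓕 (fun t => (v l t : ℂ)) τ = (a l τ : ℂ) := fun l =>
    fourier_eq_cosTransform (hvi l) (hadm l).even
  have hFu : ∀ l (ξ : Space d), 𝓕 (fun x => (RSharp d (v l) x : ℂ)) ξ = (a l ‖ξ‖ : ℂ) :=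
    fun l ξ => ((hRi l).2.2 ξ).trans (hFv l _)
  have hac : ∀ l, Continuous (a l) := fun l => continuous_cosTransform (hvi l) (hadm l).even
  have ham : ∀ l, Measurable (a l) := fun l => (hac l).measurable
  have ham' : ∀ l, Measurable fun ξ : Space d => a l ‖ξ‖ := fun l => (ham l).comp measurable_norm
  have hae : ∀ l τ, a l (-τ) = a l τ := fun l => cosTransform_neg (v l)
  have hC : ∀ l, ∃ C : ℝ, ∀ τ, |a l τ| ≤ C := fun l => ⟨_, abs_cosTransform_le (hvi l)⟩
  have hC' : ∀ l, ∃ C : ℝ, ∀ ξ : Space d, |a l ‖ξ‖| ≤ C := fun l =>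
    ⟨_, fun ξ => abs_cosTransform_le (hvi l) ‖ξ‖⟩
  obtain ⟨A, B, hA, hB, hl, hr⟩ := hv.bounds.symbol (fun l => (hft l).1) ham hae hC
  have hl' := ae_norm_of_ae (V := Space d) hl
  have hr' := ae_norm_of_ae (V := Space d) hr
  have hwave : ∀ f : Space d → ℝ, ContDiff ℝ ∞ f → HasCompactSupport f → ∀ l, _ :=
    fun f hs hc l => wave_conv (hvi l) (hadm l).even (hft l).2 hs hc S
  refine ⟨⟨⟨fun l => memLp_one_iff_integrable.2 (hRi l).1, fun l => (hRi l).2.1,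
      hasFrameBounds_of_symbol (fun l => (hft l).2) hA hB hl' hr'⟩, hv,
      fun f hs hc l => (hwave f hs hc l).2⟩,
    exists_isCanonicalDual hFv hA hB ham hae hl hr fun l =>
      memLp_ofReal_iff.1 (hft l).1.memLp_right,
    exists_isCanonicalDual hFu hA hB ham' (fun l ξ => by simp only [norm_neg]) hl' hr' fun l =>
      memLp_ofReal_iff.1 (hft l).2.memLp_right, fun vp up hvp hup => ?_⟩
  rw [isCanonicalDual_iff hFv] at hvp
  rw [isCanonicalDual_iff hFu] at hup
  refine ⟨hasFrameBounds_dual hup hA hB hl' hr', fun l => ?_, fun l w hw hvw => ?_,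
    fun f hs hc => ?_⟩
  · refine isRSharpL2_of_isFT ((ham l).div (measurable_tsum_sq ham)) (fun τ => ?_) (hvp l) (hup l)
    simp only [Pi.div_apply, hae]
  · exact RSharp_ae_eq_of_isFT (g := fun τ => a l τ / ∑' k, a k τ ^ 2) (hvp l) (hup l) hw hvw
  · have hf2 : MemLp f 2 volume := hs.continuous.memLp_of_hasCompactSupport hc
    have hsum := hasL2Sum_dual (fun l => (hft l).2) hup hA hB hl' hr' hC' hf2
    refine ⟨hsum, isPressure_testFunction hs hc, fun l => (hwave f hs hc l).1,
      fun l => (hwave f hs hc l).2.2, fun X hX hinj g hg => ?_⟩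
    have e : g = fun l => conv (RSharp d (v l)) f := funext fun l =>
      hinj (hg l).1 (hX l) ((hg l).2.trans (hwave f hs hc l).2.2.symm)
    rw [e]
    exact hsum
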